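/- Let $A\in\mathbb R^{n\times n}$, $B\in\mathbb R^{n\times q}$, $C\in\mathbb R^{q\times n}$, $L\in\mathbb R^{n\times q}$ be real matrices. Suppose that $\dot x=(A+BC)x$ is exponentially stable, that $(A,C)$ is detectable, and that $A+LC$ is Hurwitz. Put $F_{11}=A+BC$, $F_{12}=B$, $F_{21}=-C(A+BC)$, $F_{22}=-CB$, $F=\begin{pmatrix}F_{11}&F_{12}\\F_{21}&F_{22}\end{pmatrix}$; $|\cdot|$ is the Euclidean norm and the induced matrix norm, and $\mathrm{dz}(s)=0$ if $|s|\le1$, $\mathrm{dz}(s)=\mathrm{sgn}(s)(|s|-1)$ if $|s|\ge 1$. For $0<\Delta<\rho$ consider hybrid systems with state $(x,\hat x,\nu,\tau)\in\mathbb R^n\times\mathbb R^n\times\mathbb R^q\times\mathbb R^p$, timers $\tau_i\ge 0$, and flow $$\dot x=Ax+B\nu,\quad \dot{\hat x}=A\hat x+B\nu+L(C\hat x-Cx),\quad \dot\nu=0,\quad \dot\tau_i=1-\mathrm{dz}(\tau_i/\rho)$$ on a flow set; at jumps, allowed on a jump set, $x$ and $\hat x$ are unchanged. Write $e=\nu-C\hat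 x$. Solutions are hybrid arcs (locally absolutely continuous on each flow interval) which start in the union of the flow and jump sets, flow in the flow set and jump from the jump set. A set $\mathcal A$ is globally asymptotically stable (GAS) if it is stable, every maximal solution is complete, every solution is bounded, and every complete solution converges to $\mathcal A$; it is globally exponentially stable (GES) if moreover, for some $k,\gamma>0$, every solution $X$ satisfies $|X(t,j)|_{\mathcal A}\le k e^{-\gamma(t+j)}|X(0,0)|_{\mathcal A}$ on its domain. 1. (Synchronous policy, $p=1$.) Let $\gamma_x,\gamma_e>0$, $Q=Q^T>0$ and symmetric $P=\mathrm{diag}(P_1,P_2)>0$ satisfy $F_{11}^TP_1+P_1F_{11}\le -Q$ and $\gamma_xI<Q$, and let $V(x,e)=\frac12(x^TP_1x+e^TP_2e)$. Let $\overline{\mathcal C}$ be the set of $(x,e)$ with $\langle\nabla V(x,e),F\binom xe\rangle\le-\gamma_x|x|^2$ and $|e|\le\gamma_e|x|$, and $\overline{\mathcal D}$ the set of $(x,e)$ with $\langle\nabla V(x,e),F\binom xe\rangle\ge-\gamma_x|x|^2$ or $|e|\ge\gamma_e|x|$. The system flows when $(\hat x,e)\in\overline{\mathcal C}$ or $0\le\tau\le\Delta$,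 and may jump, with $\nu^+=C\hat x$, $\tau^+=0$, when $(\hat x,e)\in\overline{\mathcal D}$ and $\tau\ge\Delta$. Then there is $\rho_0>0$ such that for all $0<\Delta<\rho\le\rho_0$ the set $\{0\}\times\{0\}\times\{0\}\times[0,2\rho]$ is GAS, and it is GES if $B$ has full column rank. 2. (Asynchronous policy, $p=q$.) Let $\gamma_x>0$, $0<\epsilon\le 1/q$, $Q=Q^T>0$, $P_1=P_1^T>0$, $p_1,\dots,p_q>0$ satisfy $F_{11}^TP_1+P_1F_{11}\le-Q$ and $\frac{\gamma_x}{\epsilon}I<Q$, and let $\sum_{i=1}^q\alpha_i=1$ with each $\alpha_i>\epsilon$. With $a=2|P_1F_{12}|$, $b=2|F_{21}|$, $c=2|F_{22}|$, let $\overline{\mathcal C}_i$ (resp. $\overline{\mathcal D}_i$) be the set of $(x,e_i)\in\mathbb R^n\times\mathbb R$ with $-\alpha_ix^TQx+(a+bp_i)|x||e_i|+cp_ie_i^2\le-\gamma_x|x|^2$ (resp. $\ge$). The system flows when, for all $i$, $(\hat x,e_i)\in\overline{\mathcal C}_i$ or $0\le\tau_i\le\Delta$, and may jump when at least one sensor $i$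 is enabled, i.e. $(\hat x,e_i)\in\overline{\mathcal D}_i$ and $\tau_i\ge\Delta$. At a jump, every transmitting sensor has $\nu_i^+=(C\hat x)_i$, $\tau_i^+=0$, and the other $\nu_i,\tau_i$ are unchanged; either all enabled sensors transmit in the same jump, or (set-valued variant) exactly one enabled sensor transmits per jump. Then, for both variants, there is $\rho_0>0$ such that for all $0<\Delta<\rho\le\rho_0$ the set $\{0\}\times\{0\}\times\{0\}\times[0,2\rho]^q$ is GAS if $CB\ne0$ or $B$ has full column rank, and it is GES if $B$ has full column rank. -/

import Mathlib

open Set MeasureTheory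

noncomputable section

namespace TLazy

/-! ### Hybrid systems -/

/-- Hybrid system data: flow set, jump set, set-valued flow map and set-valued jump map. -/
structure HybridSystem (E : Type*) where
  flowSet : Set E
  jumpSet : Set E
  flowMap : E → Set E
  jumpMap : E → Set E

/-- A hybrid time domain: a union of infinitely many intervals `[t_j, t_{j+1}] × {j}` with
`0 = t_0 ≤ t_1 ≤ …`, or of finitely many of them, the last one (with index `J`) being of the form
`[t_J, t_{J+1}]`, `[t_J, t_{J+1})` or `[t_J, ∞)`. -/
def IsHybridTimeDomain (T : Set (ℝ × ℕ)) : Prop :=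
  ∃ t : ℕ → ℝ, t 0 = 0 ∧ Monotone t ∧
    ((T = ⋃ j : ℕ, Icc (t j) (t (j + 1)) ×ˢ {j}) ∨
      ∃ (J : ℕ) (I : Set ℝ),
        (I = Icc (t J) (t (J + 1)) ∨ (t J < t (J + 1) ∧ I = Ico (t J) (t (J + 1))) ∨
          I = Ici (t J)) ∧
        T = (⋃ j ∈ Set.Iio J, Icc (t j) (t (j + 1)) ×ˢ {j}) ∪ I ×ˢ {J})

section Solutions

variable {E : Type*} [NormedAddCommGroup E] [NormedSpace ℝ E]

/-- The interval `I_j` of ordinary times spent after exactly `j` jumps. -/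
def timeSlice (T : Set (ℝ × ℕ)) (j : ℕ) : Set ℝ := {t | (t, j) ∈ T}

/-- A hybrid arc with domain `T`: the values of `φ` outside `T` are irrelevant, and
`t ↦ φ t j` is locally absolutely continuous on each `I_j`. -/
def IsHybridArc (T : Set (ℝ × ℕ)) (φ : ℝ → ℕ → E) : Prop :=
  IsHybridTimeDomain T ∧
    ∀ j : ℕ, ∀ a ∈ timeSlice T j, ∀ b ∈ timeSlice T j,
      AbsolutelyContinuousOnInterval (fun t => φ t j) a b

/-- `(T, φ)` is a solution of the hybrid system `H`; it starts in the union of the flow set and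
the jump set. -/
structure IsSolution (H : HybridSystem E) (T : Set (ℝ × ℕ)) (φ : ℝ → ℕ → E) : Prop where
  arc : IsHybridArc T φ
  init : φ 0 0 ∈ H.flowSet ∪ H.jumpSet
  flow_mem : ∀ j : ℕ, ∀ t ∈ timeSlice T j, (∃ s ∈ timeSlice T j, t < s) → φ t j ∈ H.flowSet
  flow : ∀ j : ℕ, ∀ᵐ t ∂(volume.restrict (timeSlice T j)),
    ∃ v ∈ H.flowMap (φ t j), HasDerivAt (fun s => φ s j) v t
  jump : ∀ (t : ℝ) (j : ℕ), (t, j) ∈ T → (t, j + 1) ∈ T →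
    φ t j ∈ H.jumpSet ∧ φ t (j + 1) ∈ H.jumpMap (φ t j)

/-- A solution is maximal if it is not a truncation of another solution to a proper subset of
the domain of the latter. -/
def IsMaximalSolution (H : HybridSystem E) (T : Set (ℝ × ℕ)) (φ : ℝ → ℕ → E) : Prop :=
  IsSolution H T φ ∧
    ¬ ∃ (T' : Set (ℝ × ℕ)) (φ' : ℝ → ℕ → E),
      IsSolution H T' φ' ∧ T ⊂ T' ∧ ∀ t j, (t, j) ∈ T → φ' t j = φ t j

/-- A solution is complete if its domain is unbounded. -/
def IsCompleteDomain (T : Set (ℝ × ℕ)) : Prop :=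
  ∀ M : ℝ, ∃ t j, (t, j) ∈ T ∧ M < t + (j : ℝ)

/-- The solution is bounded. -/
def BoundedArc (T : Set (ℝ × ℕ)) (φ : ℝ → ℕ → E) : Prop :=
  ∃ M : ℝ, ∀ t j, (t, j) ∈ T → ‖φ t j‖ ≤ M

/-- `|φ(t,j)|_𝒜 → 0` as `t + j → ∞` along the domain. -/
def ConvergesTo (K : Set E) (T : Set (ℝ × ℕ)) (φ : ℝ → ℕ → E) : Prop :=
  ∀ ε > 0, ∃ M : ℝ, ∀ t j, (t, j) ∈ T → M ≤ t + (j : ℝ) → Metric.infDist (φ t j) K < ε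

def IsStableSet (H : HybridSystem E) (K : Set E) : Prop :=
  ∀ ε > 0, ∃ δ > 0, ∀ T φ, IsSolution H T φ → Metric.infDist (φ 0 0) K ≤ δ →
    ∀ t j, (t, j) ∈ T → Metric.infDist (φ t j) K ≤ ε

def IsAttractiveSet (H : HybridSystem E) (K : Set E) : Prop :=
  (∀ T φ, IsMaximalSolution H T φ → IsCompleteDomain T) ∧
    ∃ δ > 0, ∀ T φ, IsSolution H T φ → Metric.infDist (φ 0 0) K ≤ δ →
      BoundedArc T φ ∧ (IsCompleteDomain T → ConvergesTo K T φ)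

def IsAsymptoticallyStableSet (H : HybridSystem E) (K : Set E) : Prop :=
  IsStableSet H K ∧ IsAttractiveSet H K

def IsExponentiallyStableSet (H : HybridSystem E) (K : Set E) : Prop :=
  ∃ γ > 0, ∃ k > 0, ∀ T φ, IsSolution H T φ → ∀ t j, (t, j) ∈ T →
    Metric.infDist (φ t j) K ≤
      k * Real.exp (-γ * (t + (j : ℝ))) * Metric.infDist (φ 0 0) K

/-- Points from which each solution is bounded and each complete solution converges to `K`. -/
def basin (H : HybridSystem E) (K : Set E) : Set E :=
  {z | ∀ T φ, IsSolution H T φ → φ 0 0 = z →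
    BoundedArc T φ ∧ (IsCompleteDomain T → ConvergesTo K T φ)}

/-- Global asymptotic stability. -/
def IsGAS (H : HybridSystem E) (K : Set E) : Prop :=
  IsAsymptoticallyStableSet H K ∧ basin H K = univ

/-- Global exponential stability. -/
def IsGES (H : HybridSystem E) (K : Set E) : Prop :=
  IsExponentiallyStableSet H K ∧ basin H K = univ

end Solutions

/-! ### Linear systems -/

/-- `ℝ^k` with the Euclidean norm. -/
abbrev Vec (k : ℕ) : Type := EuclideanSpace ℝ (Fin k)

/-- Matrix times vector on Euclidean spaces. -/
abbrev mul {ι κ : Type} [Fintype ι] [Fintype κ] [DecidableEq κ]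
    (M : Matrix ι κ ℝ) (v : EuclideanSpace ℝ κ) : EuclideanSpace ℝ ι :=
  Matrix.toEuclideanLin M v

/-- The matrix norm induced by the Euclidean norms. -/
def inducedNorm {m k : ℕ} (M : Matrix (Fin m) (Fin k) ℝ) : ℝ :=
  ‖LinearMap.toContinuousLinearMap (Matrix.toEuclideanLin M)‖

/-- All complex eigenvalues have negative real part. -/
def IsHurwitz {n : ℕ} (M : Matrix (Fin n) (Fin n) ℝ) : Prop :=
  ∀ s ∈ spectrum ℂ (M.map (algebraMap ℝ ℂ)), s.re < 0

/-- Detectability of the pair `(A, C)`. -/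
def IsDetectable {n q : ℕ} (A : Matrix (Fin n) (Fin n) ℝ) (C : Matrix (Fin q) (Fin n) ℝ) : Prop :=
  ∃ K : Matrix (Fin n) (Fin q) ℝ, IsHurwitz (A + K * C)

/-- Exponential stability of the linear system `ẋ = M x`. -/
def IsExpStableLinear {n : ℕ} (M : Matrix (Fin n) (Fin n) ℝ) : Prop :=
  ∃ k > 0, ∃ γ > 0, ∀ x : ℝ → Vec n,
    (∀ t, 0 ≤ t → HasDerivWithinAt x (mul M (x t)) (Ici 0) t) →
      ∀ t, 0 ≤ t → ‖x t‖ ≤ k * Real.exp (-γ * t) * ‖x 0‖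

section ErrorDynamics

variable {n q : ℕ} (A : Matrix (Fin n) (Fin n) ℝ) (B : Matrix (Fin n) (Fin q) ℝ)
  (C : Matrix (Fin q) (Fin n) ℝ)

def F11 : Matrix (Fin n) (Fin n) ℝ := A + B * C
def F12 : Matrix (Fin n) (Fin q) ℝ := B
def F21 : Matrix (Fin q) (Fin n) ℝ := -(C * (A + B * C))
def F22 : Matrix (Fin q) (Fin q) ℝ := -(C * B)

/-- The matrix of the state-feedback error dynamics. -/
def errorMatrix : Matrix (Fin n ⊕ Fin q) (Fin n ⊕ Fin q) ℝ :=
  Matrix.fromBlocks (F11 A B C) (F12 B) (F21 A B C) (F22 B C)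

end ErrorDynamics

/-! ### The closed loop with transmission-lazy sensors and an observer -/

/-- The deadzone function on scalars. -/
def deadzone (s : ℝ) : ℝ := if |s| ≤ 1 then 0 else Real.sign s * (|s| - 1)

/-- The state `(x, x̂, ν, τ) ∈ ℝ^n × ℝ^n × ℝ^q × ℝ^p` with its Euclidean norm. -/
abbrev State (n q p : ℕ) : Type := EuclideanSpace ℝ (Fin n ⊕ Fin n ⊕ Fin q ⊕ Fin p)

namespace State

variable {n q p : ℕ}

def mk (x xh : Vec n) (ν : Vec q) (τ : Vec p) : State n q p :=
  WithLp.toLp 2 (Sum.elim (fun i => x i)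
    (Sum.elim (fun i => xh i) (Sum.elim (fun i => ν i) (fun i => τ i))))

/-- Plant-controller state. -/
def x (X : State n q p) : Vec n := WithLp.toLp 2 fun i => X (Sum.inl i)
/-- Observer state. -/
def xh (X : State n q p) : Vec n := WithLp.toLp 2 fun i => X (Sum.inr (Sum.inl i))
/-- Last transmitted samples. -/
def ν (X : State n q p) : Vec q := WithLp.toLp 2 fun i => X (Sum.inr (Sum.inr (Sum.inl i)))
/-- Timers. -/
def τ (X : State n q p) : Vec p := WithLp.toLp 2 fun i => X (Sum.inr (Sum.inr (Sum.inr i)))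

end State

section ClosedLoop

variable {n q p : ℕ} (A : Matrix (Fin n) (Fin n) ℝ) (B : Matrix (Fin n) (Fin q) ℝ)
  (C : Matrix (Fin q) (Fin n) ℝ) (L : Matrix (Fin n) (Fin q) ℝ)

/-- Flow dynamics: `ẋ = A x + B ν`, the Luenberger observer
`x̂' = A x̂ + B ν + L (C x̂ - y)` with `y = C x`, `ν' = 0`, and `τ_i' = 1 - dz(τ_i/ρ)`. -/
def flowField (ρ : ℝ) (X : State n q p) : State n q p :=
  State.mk (mul A X.x + mul B X.ν)
    (mul A X.xh + mul B X.ν + mul L (mul C X.xh - mul C X.x))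
    0
    (WithLp.toLp 2 fun i => 1 - deadzone (X.τ i / ρ))

/-- The closed loop under a transmission policy with flow set `CΔ` and jump set `DΔ` (conditions
on `(x̂, ν, τ)`), where `GH x̂ ν τ` is the set of possible values of `(ν⁺, τ⁺)`. Timers live in
`[0, ∞)`. -/
def closedLoop (ρ : ℝ) (CΔ DΔ : Set (Vec n × Vec q × Vec p))
    (GH : Vec n → Vec q → Vec p → Set (Vec q × Vec p)) : HybridSystem (State n q p) where
  flowSet := {X | (∀ i, 0 ≤ X.τ i) ∧ (X.xh, X.ν, X.τ) ∈ CΔ}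
  jumpSet := {X | (∀ i, 0 ≤ X.τ i) ∧ (X.xh, X.ν, X.τ) ∈ DΔ}
  flowMap X := {flowField A B C L ρ X}
  jumpMap X := {Y | ∃ w ∈ GH X.xh X.ν X.τ, Y = State.mk X.x X.xh w.1 w.2}

end ClosedLoop

/-- The set `{0} × {0} × {0} × [0, 2ρ]^p`. -/
def attractor (n q p : ℕ) (ρ : ℝ) : Set (State n q p) :=
  {X | X.x = 0 ∧ X.xh = 0 ∧ X.ν = 0 ∧ ∀ i, X.τ i ∈ Icc 0 (2 * ρ)}

/-! ### Synchronous policy -/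

section Synchronous

variable {n q : ℕ} (A : Matrix (Fin n) (Fin n) ℝ) (B : Matrix (Fin n) (Fin q) ℝ)
  (C : Matrix (Fin q) (Fin n) ℝ) (L : Matrix (Fin n) (Fin q) ℝ)

/-- The vector `(x, e)`. -/
def pair (x : Vec n) (e : Vec q) : EuclideanSpace ℝ (Fin n ⊕ Fin q) :=
  WithLp.toLp 2 (Sum.elim (fun i => x i) (fun i => e i))

/-- `V(z) = ½ zᵀ diag(P₁, P₂) z` with `z = (x, e)`. -/
def lyapV (P₁ : Matrix (Fin n) (Fin n) ℝ) (P₂ : Matrix (Fin q) (Fin q) ℝ)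
    (z : EuclideanSpace ℝ (Fin n ⊕ Fin q)) : ℝ :=
  1 / 2 * inner ℝ z (mul (Matrix.fromBlocks P₁ 0 0 P₂) z)

/-- `⟨∇V(x,e), F (x,e)⟩`. -/
def lyapRate (P₁ : Matrix (Fin n) (Fin n) ℝ) (P₂ : Matrix (Fin q) (Fin q) ℝ)
    (x : Vec n) (e : Vec q) : ℝ :=
  inner ℝ (gradient (lyapV P₁ P₂) (pair x e)) (mul (errorMatrix A B C) (pair x e))

/-- The conditions on the parameters of the synchronous policy. -/
structure SyncParams (γx γe : ℝ) (Q P₁ : Matrix (Fin n) (Fin n) ℝ)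
    (P₂ : Matrix (Fin q) (Fin q) ℝ) : Prop where
  γx_pos : 0 < γx
  γe_pos : 0 < γe
  Q_pos : Q.PosDef
  P_pos : (Matrix.fromBlocks P₁ 0 0 P₂).PosDef
  lyap : (-Q - ((F11 A B C).transpose * P₁ + P₁ * F11 A B C)).PosSemidef
  Q_gt : (Q - γx • (1 : Matrix (Fin n) (Fin n) ℝ)).PosDef

def syncC (γx γe : ℝ) (P₁ : Matrix (Fin n) (Fin n) ℝ) (P₂ : Matrix (Fin q) (Fin q) ℝ) :
    Set (Vec n × Vec q) :=
  {w | lyapRate A B C P₁ P₂ w.1 w.2 ≤ -γx * ‖w.1‖ ^ 2 ∧ ‖w.2‖ ≤ γe * ‖w.1‖}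

def syncD (γx γe : ℝ) (P₁ : Matrix (Fin n) (Fin n) ℝ) (P₂ : Matrix (Fin q) (Fin q) ℝ) :
    Set (Vec n × Vec q) :=
  {w | lyapRate A B C P₁ P₂ w.1 w.2 ≥ -γx * ‖w.1‖ ^ 2 ∨ ‖w.2‖ ≥ γe * ‖w.1‖}

/-- The closed loop under the synchronous policy: one timer, and at each transmission
`ν⁺ = C x̂`, `τ⁺ = 0`. -/
def syncSystem (γx γe : ℝ) (P₁ : Matrix (Fin n) (Fin n) ℝ) (P₂ : Matrix (Fin q) (Fin q) ℝ)
    (Δ ρ : ℝ) : HybridSystem (State n q 1) :=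
  closedLoop A B C L ρ
    {w | (w.1, w.2.1 - mul C w.1) ∈ syncC A B C γx γe P₁ P₂ ∨ w.2.2 0 ≤ Δ}
    {w | (w.1, w.2.1 - mul C w.1) ∈ syncD A B C γx γe P₁ P₂ ∧ Δ ≤ w.2.2 0}
    (fun xh _ _ => {(mul C xh, 0)})

end Synchronous

/-! ### Asynchronous policy -/

section Asynchronous

variable {n q : ℕ} (A : Matrix (Fin n) (Fin n) ℝ) (B : Matrix (Fin n) (Fin q) ℝ)
  (C : Matrix (Fin q) (Fin n) ℝ) (L : Matrix (Fin n) (Fin q) ℝ)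

/-- The conditions on the parameters of the asynchronous policy, with `P₂ = diag(p₁, …, p_q)`. -/
structure AsyncParams (γx ε : ℝ) (Q P₁ : Matrix (Fin n) (Fin n) ℝ) (p α : Fin q → ℝ) : Prop where
  γx_pos : 0 < γx
  ε_pos : 0 < ε
  ε_le : ε ≤ 1 / (q : ℝ)
  Q_pos : Q.PosDef
  P₁_pos : P₁.PosDef
  p_pos : ∀ i, 0 < p i
  lyap : (-Q - ((F11 A B C).transpose * P₁ + P₁ * F11 A B C)).PosSemidef
  Q_gt : (Q - (γx / ε) • (1 : Matrix (Fin n) (Fin n) ℝ)).PosDef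
  α_sum : ∑ i, α i = 1
  α_gt : ∀ i, ε < α i

/-- `-α_i xᵀQx + (a + b p_i) |x| |e_i| + c p_i e_i²` with `a = 2|P₁F₁₂|`, `b = 2|F₂₁|`,
`c = 2|F₂₂|`. -/
def sensorRate (Q P₁ : Matrix (Fin n) (Fin n) ℝ) (pi αi : ℝ) (x : Vec n) (ei : ℝ) : ℝ :=
  -αi * inner ℝ x (mul Q x)
    + (2 * inducedNorm (P₁ * F12 B) + 2 * inducedNorm (F21 A B C) * pi) * ‖x‖ * |ei|
    + 2 * inducedNorm (F22 B C) * pi * ei ^ 2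

def sensorC (γx : ℝ) (Q P₁ : Matrix (Fin n) (Fin n) ℝ) (pi αi : ℝ) : Set (Vec n × ℝ) :=
  {w | sensorRate A B C Q P₁ pi αi w.1 w.2 ≤ -γx * ‖w.1‖ ^ 2}

def sensorD (γx : ℝ) (Q P₁ : Matrix (Fin n) (Fin n) ℝ) (pi αi : ℝ) : Set (Vec n × ℝ) :=
  {w | sensorRate A B C Q P₁ pi αi w.1 w.2 ≥ -γx * ‖w.1‖ ^ 2}

/-- The set of sensors that may transmit at `(x̂, ν, τ)`. -/
def enabled (γx : ℝ) (Q P₁ : Matrix (Fin n) (Fin n) ℝ) (p α : Fin q → ℝ) (Δ : ℝ)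
    (xh : Vec n) (ν τ : Vec q) : Set (Fin q) :=
  {i | (xh, ν i - mul C xh i) ∈ sensorD A B C γx Q P₁ (p i) (α i) ∧ Δ ≤ τ i}

open Classical in
/-- The value of `(ν⁺, τ⁺)` when exactly the sensors in `S` transmit: `ν_i⁺ = (C x̂)_i`, `τ_i⁺ = 0`
for `i ∈ S`, the other entries being unchanged. -/
def transmit (S : Set (Fin q)) (xh : Vec n) (ν τ : Vec q) : Vec q × Vec q :=
  (WithLp.toLp 2 fun i => if i ∈ S then mul C xh i else ν i,
    WithLp.toLp 2 fun i => if i ∈ S then 0 else τ i)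

/-- The closed loop under the asynchronous policy, one timer per sensor, for a rule `R` giving,
from the set of enabled sensors, the possible sets of sensors which transmit in one jump. -/
def asyncSystemOf (R : Set (Fin q) → Set (Set (Fin q))) (γx : ℝ)
    (Q P₁ : Matrix (Fin n) (Fin n) ℝ) (p α : Fin q → ℝ) (Δ ρ : ℝ) :
    HybridSystem (State n q q) :=
  closedLoop A B C L ρ
    {w | ∀ i, (w.1, w.2.1 i - mul C w.1 i) ∈ sensorC A B C γx Q P₁ (p i) (α i) ∨ w.2.2 i ≤ Δ}
    {w | ∃ i, i ∈ enabled A B C γx Q P₁ p α Δ w.1 w.2.1 w.2.2}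
    (fun xh ν τ =>
      {v | ∃ S ∈ R (enabled A B C γx Q P₁ p α Δ xh ν τ), v = transmit C S xh ν τ})

/-- All enabled sensors transmit in the same jump. -/
def asyncSystem (γx : ℝ) (Q P₁ : Matrix (Fin n) (Fin n) ℝ) (p α : Fin q → ℝ) (Δ ρ : ℝ) :
    HybridSystem (State n q q) :=
  asyncSystemOf A B C L (fun S => {S}) γx Q P₁ p α Δ ρ

/-- Set-valued variant: at each jump one enabled sensor transmits, and simultaneous transmissions
are sequences of consecutive jumps. -/
def asyncSystemSeq (γx : ℝ) (Q P₁ : Matrix (Fin n) (Fin n) ℝ) (p α : Fin q → ℝ) (Δ ρ : ℝ) :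
    HybridSystem (State n q q) :=
  asyncSystemOf A B C L (fun S => {U | ∃ i ∈ S, U = {i}}) γx Q P₁ p α Δ ρ

end Asynchronous

end TLazy

end

open TLazy

noncomputable section

open TLazy

namespace TLazy

/-! ### Hybrid time domains -/

/-! In the coordinates x̂, e = ν − Cx̂ and w = x̂ − x the loop is a cascade. The observation error
obeys ẇ = (A+LC)w, is untouched by jumps, and decays exponentially because A+LC is Hurwitz
(`LazyLoop.exists_obs_decay`). The rest reads x̂' = F₁₁x̂ + Be + LCw, e' = −Cx̂', and a transmission
resets some entries of e to zero.

Both policies are instances of `LazyLoop`, and for both a quadratic form V in (x̂, e) is a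
certificate (`LazyLyapunov`): V' ≤ −cV + K(r² + |w|²) as long as every block of sensors either
satisfies its waiting condition or has errors at most r. During flow the second alternative is
needed only while the timer is at most Δ. Timers run at unit speed up to ρ > Δ, so the last
transmission (or the initial time) then lies at most Δ back, and since then e has drifted by at most
Δ times the recent size of the state. Thus r is of order Δ times the very bound on (x̂, e) that is
sought, up to initial data. This small-gain loop is closed in `LazyLoop.exists_decay`:
`LazyLoop.decay_bound_improve` turns a weighted bound Y into one in which Y appears with a factor of
order Δ, and for small ρ₀ that term is absorbed.

V need not control e; it is used with P₂ = 0 for the asynchronous policy. The bound of |e_i| by |x̂|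
comes from the waiting condition instead. The delicate point is x̂ = 0, where that condition may say
nothing; `LazyLoop.err_le_or` then uses injectivity of B and the invertible dynamics of w.

Transmissions of one block are at least Δ apart, so decay in t becomes decay in t + j
(`LazyLoop.jump_count_le`). Timer excess over 2ρ decays at rate 1/ρ, and maximal solutions are
complete (`LazyLoop.complete`). The resulting exponential bound, valid for all solutions, gives GAS
and GES together. -/

theorem IsHybridTimeDomain.exists_jumpTimes {T : Set (ℝ × ℕ)} (hT : IsHybridTimeDomain T) :
    ∃ t : ℕ → ℝ, t 0 = 0 ∧ Monotone t ∧ (0, 0) ∈ T ∧ ∀ s j, (s, j) ∈ T → t j ≤ s ∧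
      (∀ u ∈ Icc (t j) s, (u, j) ∈ T) ∧ ∀ i, j = i + 1 → (t j, i) ∈ T := by
  obtain ⟨t, h0, hm, rfl | ⟨J, I, hI, rfl⟩⟩ := hT
  · refine ⟨t, h0, hm, ?_, ?_⟩
    · simp only [mem_iUnion]
      exact ⟨0, ⟨⟨h0.le, h0 ▸ hm (Nat.zero_le 1)⟩, rfl⟩⟩
    · intro s j hs
      simp only [mem_iUnion, mem_prod, mem_singleton_iff] at hs ⊢
      obtain ⟨j', ⟨h1, h2⟩, rfl⟩ := hs
      refine ⟨h1, fun u hu => ⟨j, ⟨hu.1, hu.2.trans h2⟩, rfl⟩, ?_⟩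
      rintro i rfl
      exact ⟨i, ⟨hm (Nat.le_succ i), le_rfl⟩, rfl⟩
  · have hmem : ∀ s ∈ I, t J ≤ s ∧ ∀ u ∈ Icc (t J) s, u ∈ I := by
      rcases hI with rfl | ⟨-, rfl⟩ | rfl
      · exact fun s hs => ⟨hs.1, fun u hu => ⟨hu.1, hu.2.trans hs.2⟩⟩
      · exact fun s hs => ⟨hs.1, fun u hu => ⟨hu.1, hu.2.trans_lt hs.2⟩⟩
      · exact fun s hs => ⟨hs, fun u hu => hu.1⟩
    have hJ : t J ∈ I := by
      rcases hI with rfl | ⟨h, rfl⟩ | rfl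
      · exact ⟨le_rfl, hm (Nat.le_succ J)⟩
      · exact ⟨le_rfl, h⟩
      · exact mem_Ici.2 le_rfl
    refine ⟨t, h0, hm, ?_, ?_⟩
    · rcases Nat.eq_zero_or_pos J with rfl | h
      · exact Or.inr ⟨h0 ▸ hJ, rfl⟩
      · refine Or.inl ?_
        simp only [mem_iUnion]
        exact ⟨0, h, ⟨h0.le, h0 ▸ hm (Nat.zero_le 1)⟩, rfl⟩
    · intro s j hs
      have key : ∀ i, j = i + 1 → j ≤ J →
          (t j, i) ∈ (⋃ j ∈ Set.Iio J, Icc (t j) (t (j + 1)) ×ˢ {j}) ∪ I ×ˢ {J} := by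
        rintro i rfl hi
        refine Or.inl ?_
        simp only [mem_iUnion]
        exact ⟨i, hi, ⟨hm (Nat.le_succ i), le_rfl⟩, rfl⟩
      rcases hs with hs | ⟨hs, rfl⟩
      · simp only [mem_iUnion, mem_prod, mem_singleton_iff] at hs
        obtain ⟨j', hj', ⟨h1, h2⟩, rfl⟩ := hs
        refine ⟨h1, fun u hu => Or.inl ?_, fun i hi => key i hi (le_of_lt hj')⟩
        simp only [mem_iUnion]
        exact ⟨j, hj', ⟨hu.1, hu.2.trans h2⟩, rfl⟩
      · exact ⟨(hmem s hs).1, fun u hu => Or.inr ⟨(hmem s hs).2 u hu, rfl⟩,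
          fun i hi => key i hi le_rfl⟩

theorem IsHybridTimeDomain.zero_mem {T : Set (ℝ × ℕ)} (hT : IsHybridTimeDomain T) :
    (0, 0) ∈ T := by
  obtain ⟨t, -, -, h, -⟩ := hT.exists_jumpTimes
  exact h

theorem IsHybridTimeDomain.nonneg {T : Set (ℝ × ℕ)} (hT : IsHybridTimeDomain T) {s : ℝ} {j : ℕ}
    (h : (s, j) ∈ T) : 0 ≤ s := by
  obtain ⟨t, h0, hm, -, ht⟩ := hT.exists_jumpTimes
  exact (h0 ▸ hm (Nat.zero_le j)).trans (ht s j h).1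

theorem IsHybridTimeDomain.ordConnected {T : Set (ℝ × ℕ)} (hT : IsHybridTimeDomain T) {a b : ℝ}
    {j : ℕ} (ha : (a, j) ∈ T) (hb : (b, j) ∈ T) {s : ℝ} (hs : s ∈ Icc a b) : (s, j) ∈ T := by
  obtain ⟨t, -, -, -, ht⟩ := hT.exists_jumpTimes
  exact (ht b j hb).2.1 s ⟨(ht a j ha).1.trans hs.1, hs.2⟩

/-- Induction along a hybrid time domain. -/
theorem IsHybridTimeDomain.induction {T : Set (ℝ × ℕ)} (hT : IsHybridTimeDomain T)
    {P : ℝ → ℕ → Prop} (h0 : P 0 0)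
    (hjump : ∀ t j, (t, j) ∈ T → (t, j + 1) ∈ T → P t j → P t (j + 1))
    (hflow : ∀ a b j, a < b → (a, j) ∈ T → (b, j) ∈ T → P a j → P b j) {s : ℝ} {j : ℕ}
    (hs : (s, j) ∈ T) : P s j := by
  obtain ⟨t, ht0, hm, hz, ht⟩ := hT.exists_jumpTimes
  have hflow' : ∀ a b j, a ≤ b → (a, j) ∈ T → (b, j) ∈ T → P a j → P b j := by
    intro a b j hab ha hb hP
    rcases hab.eq_or_lt with rfl | h
    · exact hP
    · exact hflow a b j h ha hb hP
  induction j generalizing s with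
  | zero => exact hflow' 0 s 0 (ht0 ▸ (ht s 0 hs).1) hz hs h0
  | succ j ih =>
    have h1 : (t (j + 1), j) ∈ T := (ht s _ hs).2.2 j rfl
    have h2 : (t (j + 1), j + 1) ∈ T := (ht s _ hs).2.1 _ ⟨le_rfl, (ht s _ hs).1⟩
    exact hflow' _ s _ (ht s _ hs).1 h2 hs (hjump _ _ h1 h2 (ih h1))

/-! ### Flows are classical solutions -/

section

variable {E : Type*} [NormedAddCommGroup E] [NormedSpace ℝ E]

theorem lipschitzOnWith_Icc_of_hasDerivAt {u : ℝ → E} {K a b : ℝ} (hab : a < b)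
    (hc : ContinuousOn u (Icc a b)) (hd : ∀ t ∈ Ioo a b, ∃ v, ‖v‖ ≤ K ∧ HasDerivAt u v t) :
    LipschitzOnWith K.toNNReal u (Icc a b) := by
  rw [← closure_Ioo hab.ne] at hc ⊢
  refine LipschitzOnWith.closure hc ?_
  choose! v hv hv' using hd
  refine (convex_Ioo _ _).lipschitzOnWith_of_nnnorm_hasDerivWithin_le
    (f' := v) (fun t ht => (hv' t ht).hasDerivWithinAt) fun t ht => ?_
  exact NNReal.le_toNNReal_of_coe_le (by simpa using hv t ht)

theorem norm_sub_le_of_hasDerivAt {u : ℝ → E} {K a b : ℝ} (hab : a < b)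
    (hc : ContinuousOn u (Icc a b)) (hd : ∀ t ∈ Ioo a b, ∃ v, ‖v‖ ≤ K ∧ HasDerivAt u v t) :
    ‖u b - u a‖ ≤ K * (b - a) := by
  have hK : 0 ≤ K := by
    obtain ⟨v, hv, -⟩ := hd ((a + b) / 2) ⟨by linarith, by linarith⟩
    exact (norm_nonneg v).trans hv
  have := (lipschitzOnWith_Icc_of_hasDerivAt hab hc hd).norm_sub_le
    (right_mem_Icc.2 hab.le) (left_mem_Icc.2 hab.le)
  rwa [Real.coe_toNNReal _ hK, Real.norm_of_nonneg (sub_nonneg.2 hab.le)] at this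

/-- The difference between u and the primitive of v is absolutely continuous with derivative zero
almost everywhere, hence constant, and the primitive of a continuous function is differentiable
everywhere. -/
theorem hasDerivAt_of_absolutelyContinuousOnInterval [CompleteSpace E] {u v : ℝ → E} {a b : ℝ}
    (hab : a < b)
    (hu : AbsolutelyContinuousOnInterval u a b) (hv : ContinuousOn v (Icc a b))
    (h : ∀ᵐ t, t ∈ Icc a b → HasDerivAt u (v t) t) :
    ∀ t ∈ Ioo a b, HasDerivAt u (v t) t := by
  have hvi : ∀ t ∈ Ioo a b, HasDerivAt (fun s => ∫ r in a..s, v r) (v t) t := by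
    intro t ht
    have hI : IntervalIntegrable v volume a t :=
      (hv.mono (by rw [uIcc_of_le ht.1.le]; exact Icc_subset_Icc_right ht.2.le)).intervalIntegrable
    exact intervalIntegral.integral_hasDerivAt_right hI
      ((hv.mono Ioo_subset_Icc_self).stronglyMeasurableAtFilter isOpen_Ioo t ht)
      (hv.continuousAt (Icc_mem_nhds ht.1 ht.2))
  obtain ⟨K, hK⟩ := isCompact_Icc.exists_bound_of_continuousOn hv
  have hac : AbsolutelyContinuousOnInterval (fun s => ∫ r in a..s, v r) a b := by
    have hc : ContinuousOn (fun s => ∫ r in a..s, v r) (uIcc a b) := by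
      refine intervalIntegral.continuousOn_primitive_interval ?_
      rw [uIcc_of_le hab.le]
      exact hv.integrableOn_Icc
    rw [uIcc_of_le hab.le] at hc
    refine LipschitzOnWith.absolutelyContinuousOnInterval (K := K.toNNReal) ?_
    rw [uIcc_of_le hab.le]
    exact lipschitzOnWith_Icc_of_hasDerivAt hab hc
      fun t ht => ⟨v t, hK t (Ioo_subset_Icc_self ht), hvi t ht⟩
  have hdiff := hu.sub hac
  obtain ⟨c, hc⟩ := hdiff.const_of_ae_hasDerivAt_zero (by
    have hne : ∀ᵐ t : ℝ, t ≠ a ∧ t ≠ b := by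
      have h1 := (Set.countable_singleton a).ae_notMem (volume : Measure ℝ)
      have h2 := (Set.countable_singleton b).ae_notMem (volume : Measure ℝ)
      filter_upwards [h1, h2] with t h1 h2 using ⟨h1, h2⟩
    filter_upwards [h, hne] with t ht hn htI
    rw [uIcc_of_le hab.le] at htI
    have hto : t ∈ Ioo a b := ⟨lt_of_le_of_ne htI.1 (Ne.symm hn.1), lt_of_le_of_ne htI.2 hn.2⟩
    simpa using (ht htI).sub (hvi t hto))
  intro t ht
  have : u =ᶠ[nhds t] fun s => c + ∫ r in a..s, v r := by
    filter_upwards [Ioo_mem_nhds ht.1 ht.2] with s hs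
    have := hc s (by rw [uIcc_of_le hab.le]; exact Ioo_subset_Icc_self hs)
    simp only [Pi.sub_apply] at this
    rw [← this]; abel
  exact ((hvi t ht).const_add c).congr_of_eventuallyEq this

theorem IsSolution.continuousOn {H : HybridSystem E} {T : Set (ℝ × ℕ)} {φ : ℝ → ℕ → E}
    (h : IsSolution H T φ) {a b : ℝ} {j : ℕ} (hab : a ≤ b) (ha : (a, j) ∈ T) (hb : (b, j) ∈ T) :
    ContinuousOn (fun t => φ t j) (Icc a b) := by
  have := (h.arc.2 j a ha b hb).continuousOn
  rwa [uIcc_of_le hab] at this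

/-- A continuous single-valued flow map upgrades the almost-everywhere inclusion to a classical
differential equation, so that ordinary calculus applies on flow intervals. -/
theorem IsSolution.hasDerivAt [CompleteSpace E] {H : HybridSystem E} {T : Set (ℝ × ℕ)}
    {φ : ℝ → ℕ → E} {f : E → E}
    (h : IsSolution H T φ) (hf : Continuous f) (hH : ∀ X, H.flowMap X = {f X}) {a b : ℝ} {j : ℕ}
    (hab : a < b) (ha : (a, j) ∈ T) (hb : (b, j) ∈ T) :
    ∀ t ∈ Ioo a b, HasDerivAt (fun s => φ s j) (f (φ t j)) t := by
  refine hasDerivAt_of_absolutelyContinuousOnInterval hab (h.arc.2 j a ha b hb)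
    (hf.comp_continuousOn (h.continuousOn hab.le ha hb)) ?_
  have h1 := h.flow j
  have h2 : ∀ᵐ t ∂(volume.restrict (Icc a b)),
      ∃ v ∈ H.flowMap (φ t j), HasDerivAt (fun s => φ s j) v t :=
    ae_mono (Measure.restrict_mono_set _ fun s hs => h.arc.1.ordConnected ha hb hs) h1
  rw [ae_restrict_iff' measurableSet_Icc] at h2
  filter_upwards [h2] with t ht htI
  obtain ⟨v, hv, hd⟩ := ht htI
  rw [hH, mem_singleton_iff] at hv
  exact hv ▸ hd

end

/-! ### Hurwitz matrices: contraction of an Euler step -/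

open Filter Topology in
-- Gelfand's formula: the k-th roots of ‖T^k‖ tend to the spectral radius, so ‖T^k‖ ≤ r^k eventually
-- for some r < 1.
theorem tendsto_pow_zero_of_spectrum_norm_lt_one {R : Type*} [NormedRing R] [NormedAlgebra ℂ R]
    [CompleteSpace R] [Nontrivial R] {T : R} (hT : ∀ z ∈ spectrum ℂ T, ‖z‖ < 1) :
    Tendsto (fun k : ℕ => T ^ k) atTop (𝓝 0) := by
  have h1 : spectralRadius ℂ T < (1 : NNReal) :=
    spectrum.spectralRadius_lt_of_forall_lt T fun z hz => by
      rw [← NNReal.coe_lt_coe]; simpa using hT z hz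
  obtain ⟨r, hr1, hr2⟩ := ENNReal.lt_iff_exists_nnreal_btwn.1 h1
  have h2 := (spectrum.pow_nnnorm_pow_one_div_tendsto_nhds_spectralRadius T).eventually_lt_const hr1
  have hr : r < 1 := by exact_mod_cast hr2
  rw [tendsto_zero_iff_norm_tendsto_zero]
  refine squeeze_zero' (g := fun k : ℕ => (r : ℝ) ^ k) (Eventually.of_forall fun k => norm_nonneg _)
    ?_ (tendsto_pow_atTop_nhds_zero_of_lt_one r.2 hr)
  filter_upwards [h2, eventually_gt_atTop 0] with k hk hk0
  have h3 : ((‖T ^ k‖₊ : ENNReal) ^ (1 / k : ℝ)) ^ (k : ℝ) ≤ (r : ENNReal) ^ (k : ℝ) :=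
    ENNReal.rpow_le_rpow hk.le (by positivity)
  rw [← ENNReal.rpow_mul, one_div_mul_cancel (by positivity), ENNReal.rpow_one,
    ENNReal.rpow_natCast] at h3
  have h4 : ‖T ^ k‖₊ ≤ r ^ k := by exact_mod_cast h3
  exact_mod_cast h4

open Filter Topology in
/-- A forward Euler step of a Hurwitz system is a contraction after finitely many iterations. -/
theorem IsHurwitz.exists_euler_contraction {n : ℕ} {M : Matrix (Fin n) (Fin n) ℝ}
    (hM : IsHurwitz M) : ∃ h : ℝ, 0 < h ∧ ∃ N : ℕ,
      ∀ z : Vec n, ‖mul ((1 + h • M) ^ (N + 1)) z‖ ≤ 1 / 2 * ‖z‖ := by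
  classical
  rcases Nat.eq_zero_or_pos n with rfl | hn
  · exact ⟨1, one_pos, 0, fun z => by
      rw [Subsingleton.elim (mul _ z) 0, Subsingleton.elim z 0]; simp⟩
  have : Nonempty (Fin n) := ⟨⟨0, hn⟩⟩
  let _ := Matrix.linftyOpNormedRing (n := Fin n) (α := ℂ)
  let _ := Matrix.linftyOpNormedAlgebra (n := Fin n) (R := ℂ) (α := ℂ)
  set Mc : Matrix (Fin n) (Fin n) ℂ := M.map (algebraMap ℝ ℂ) with hMc
  have hfin : (spectrum ℂ Mc).Finite := Matrix.finite_spectrum Mc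
  -- |1 + hs|² − 1 = h(2 Re s + h|s|²), which is negative for small h > 0 when Re s < 0. The
  -- spectrum is finite, so one h serves all eigenvalues.
  have hev : ∀ s ∈ spectrum ℂ Mc, ∀ᶠ h : ℝ in 𝓝[>] 0, ‖1 + (h : ℂ) * s‖ < 1 := by
    intro s hs
    have hre := hM s hs
    have hlim : Tendsto (fun h : ℝ => 2 * s.re + h * (s.re ^ 2 + s.im ^ 2)) (𝓝[>] 0)
        (𝓝 (2 * s.re + 0 * (s.re ^ 2 + s.im ^ 2))) :=
      (Continuous.tendsto (by fun_prop) 0).mono_left nhdsWithin_le_nhds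
    filter_upwards [hlim.eventually_lt_const (u := 0) (by linarith), self_mem_nhdsWithin]
      with h h1 h2
    have h2 : 0 < h := h2
    rw [← sq_lt_one_iff₀ (norm_nonneg _), ← Complex.normSq_eq_norm_sq, Complex.normSq_apply]
    simp
    nlinarith
  have hev' := (hfin.eventually_all (l := 𝓝[>] (0 : ℝ)) |>.2 hev).and self_mem_nhdsWithin
  obtain ⟨h, hh, hpos⟩ := hev'.exists
  have hpos : 0 < h := hpos
  have hspec : ∀ z ∈ spectrum ℂ (1 + (h : ℂ) • Mc), ‖z‖ < 1 := by
    have e : 1 + (h : ℂ) • Mc = Polynomial.aeval Mc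
        (1 + Polynomial.C (h : ℂ) * Polynomial.X : Polynomial ℂ) := by
      simp [Algebra.smul_def]
    rw [e, spectrum.map_polynomial_aeval]
    rintro _ ⟨s, hs, rfl⟩
    simpa using hh s hs
  have hpow := tendsto_pow_zero_of_spectrum_norm_lt_one hspec
  -- The complex powers are the real ones entrywise, so the limit descends to the real matrix by
  -- taking real parts.
  have hmap : ∀ k : ℕ, (1 + (h : ℂ) • Mc) ^ k = ((1 + h • M) ^ k).map (algebraMap ℝ ℂ) := by
    intro k
    have e := map_pow (algebraMap ℝ ℂ).mapMatrix (1 + h • M) k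
    rw [RingHom.mapMatrix_apply] at e
    rw [e]
    congr 1
    ext i j
    by_cases hij : i = j <;> simp [hMc, hij]
  have hreal : Tendsto (fun k : ℕ => (1 + h • M) ^ k) atTop (𝓝 0) := by
    refine tendsto_pi_nhds.2 fun i => tendsto_pi_nhds.2 fun j => ?_
    have h1 : Tendsto (fun k : ℕ => ((1 + (h : ℂ) • Mc) ^ k) i j) atTop (𝓝 0) :=
      ((continuous_id.matrix_elem i j).tendsto (0 : Matrix (Fin n) (Fin n) ℂ)).comp hpow
    have h2 := (Complex.continuous_re.tendsto 0).comp h1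
    simp only [hmap] at h2
    simpa [Function.comp_def] using h2
  let Φ : Matrix (Fin n) (Fin n) ℝ →ₗ[ℝ] (Vec n →L[ℝ] Vec n) :=
    (LinearMap.toContinuousLinearMap.toLinearMap).comp Matrix.toEuclideanLin.toLinearMap
  have hΦ : Tendsto (fun k : ℕ => ‖Φ ((1 + h • M) ^ k)‖) atTop (𝓝 0) := by
    have h1 := (Φ.continuous_of_finiteDimensional.tendsto 0).comp hreal
    rw [map_zero] at h1
    simpa using h1.norm
  obtain ⟨N, hN⟩ := (((tendsto_add_atTop_iff_nat 1).2 hΦ).eventually_le_const (u := 1 / 2)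
    (by norm_num)).exists
  exact ⟨h, hpos, N, fun z => (ContinuousLinearMap.le_opNorm (Φ _) z).trans (by gcongr)⟩

/-! ### Scalar comparison -/

theorem le_of_hasDerivAt_nonpos {f f' : ℝ → ℝ} {a b : ℝ} (hab : a ≤ b)
    (hc : ContinuousOn f (Icc a b)) (hd : ∀ t ∈ Ioo a b, HasDerivAt f (f' t) t)
    (hf : ∀ t ∈ Ioo a b, f' t ≤ 0) : f b ≤ f a := by
  refine antitoneOn_of_deriv_nonpos (convex_Icc a b) hc ?_ ?_ ⟨le_rfl, hab⟩ ⟨hab, le_rfl⟩ hab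
  · rw [interior_Icc]
    exact fun t ht => (hd t ht).differentiableAt.differentiableWithinAt
  · rw [interior_Icc]
    exact fun t ht => (hd t ht).deriv ▸ hf t ht

/-- The integrating factor exp(c(t − a)) makes the product non-increasing. No sign is required of c
or f. -/
theorem le_exp_mul_of_hasDerivAt_le {f f' : ℝ → ℝ} {a b c : ℝ} (hab : a ≤ b)
    (hc : ContinuousOn f (Icc a b)) (hd : ∀ t ∈ Ioo a b, HasDerivAt f (f' t) t)
    (hf : ∀ t ∈ Ioo a b, f' t ≤ -c * f t) : f b ≤ Real.exp (-c * (b - a)) * f a := by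
  have hexp : ∀ t, HasDerivAt (fun t => Real.exp (c * (t - a))) (Real.exp (c * (t - a)) * c) t := by
    intro t
    have := (((hasDerivAt_id t).sub_const a).const_mul c).exp
    simpa using this
  have h1 : Real.exp (c * (b - a)) * f b ≤ Real.exp (c * (a - a)) * f a := by
    refine le_of_hasDerivAt_nonpos (f := fun t => Real.exp (c * (t - a)) * f t)
      (f' := fun t => Real.exp (c * (t - a)) * c * f t + Real.exp (c * (t - a)) * f' t) hab
      (ContinuousOn.mul (by fun_prop) hc) (fun t ht => (hexp t).mul (hd t ht)) fun t ht => ?_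
    nlinarith [hf t ht, Real.exp_pos (c * (t - a))]
  rw [sub_self, mul_zero, Real.exp_zero, one_mul] at h1
  rw [neg_mul, Real.exp_neg]
  have h2 := Real.exp_pos (c * (b - a))
  rw [inv_mul_eq_div, le_div_iff₀ h2]
  linarith

theorem le_exp_mul_add_of_hasDerivAt_le {f f' : ℝ → ℝ} {a b c l K v : ℝ} (hab : a ≤ b)
    (hc : ContinuousOn f (Icc a b)) (hd : ∀ t ∈ Ioo a b, HasDerivAt f (f' t) t) (hcl : l < c)
    (hf : ∀ t ∈ Ioo a b, f' t ≤ -c * f t + K * Real.exp (-l * t)) (hv : 0 ≤ v)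
    (ha : f a ≤ (v + K / (c - l)) * Real.exp (-l * a)) :
    f b ≤ (v + K / (c - l)) * Real.exp (-l * b) := by
  -- Q·exp(−lt) solves the comparison equation exactly; subtracting it leaves the homogeneous
  -- inequality.
  set Q := K / (c - l) with hQ
  have hQ' : K = Q * (c - l) := by rw [hQ, div_mul_cancel₀]; linarith
  have hexp : ∀ t, HasDerivAt (fun t => Real.exp (-l * t)) (Real.exp (-l * t) * (-l)) t := by
    intro t
    have := ((hasDerivAt_id t).const_mul (-l)).exp
    simpa using this
  have h1 := le_exp_mul_of_hasDerivAt_le (f := fun t => f t - Q * Real.exp (-l * t))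
    (f' := fun t => f' t - Q * (Real.exp (-l * t) * (-l))) (c := c) hab
    (hc.sub (by fun_prop)) (fun t ht => (hd t ht).sub ((hexp t).const_mul Q)) (fun t ht => by
      have := hf t ht
      rw [hQ'] at this
      linarith)
  have h2 : Real.exp (-c * (b - a)) * (f a - Q * Real.exp (-l * a)) ≤
      Real.exp (-c * (b - a)) * (v * Real.exp (-l * a)) := by
    gcongr
    linarith
  have h3 : Real.exp (-c * (b - a)) * (v * Real.exp (-l * a)) ≤ v * Real.exp (-l * b) := by
    rw [mul_left_comm, ← Real.exp_add]
    gcongr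
    nlinarith
  linarith

/-! ### Matrix action and quadratic Lyapunov functions -/

theorem mul_mul_apply {ι κ μ : Type} [Fintype ι] [Fintype κ] [Fintype μ] [DecidableEq κ]
    [DecidableEq μ]
    (M : Matrix ι κ ℝ) (N : Matrix κ μ ℝ) (z : EuclideanSpace ℝ μ) :
    mul (M * N) z = mul M (mul N z) := by
  simp [mul, Matrix.toLpLin_apply, Matrix.mulVec_mulVec]

theorem mul_add_apply {ι κ : Type} [Fintype ι] [Fintype κ] [DecidableEq κ]
    (M N : Matrix ι κ ℝ) (z : EuclideanSpace ℝ κ) : mul (M + N) z = mul M z + mul N z := by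
  simp [mul]

@[simp]
theorem mul_zero_apply {ι κ : Type} [Fintype ι] [Fintype κ] [DecidableEq κ]
    (M : Matrix ι κ ℝ) : mul M (0 : EuclideanSpace ℝ κ) = 0 := by
  simp [mul]

theorem hasDerivAt_mul {ι κ : Type} [Fintype ι] [Fintype κ] [DecidableEq κ]
    (M : Matrix ι κ ℝ) {z : ℝ → EuclideanSpace ℝ κ} {z' : EuclideanSpace ℝ κ} {t : ℝ}
    (h : HasDerivAt z z' t) : HasDerivAt (fun s => mul M (z s)) (mul M z') t :=
  (LinearMap.toContinuousLinearMap (Matrix.toEuclideanLin M)).hasFDerivAt.comp_hasDerivAt t h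

@[fun_prop]
theorem continuous_mul_left {ι κ : Type} [Fintype ι] [Fintype κ] [DecidableEq κ]
    (M : Matrix ι κ ℝ) : Continuous fun z : EuclideanSpace ℝ κ => mul M z :=
  (Matrix.toEuclideanLin M).continuous_of_finiteDimensional

/-- A Hurwitz matrix admits a quadratic Lyapunov function. -/
theorem IsHurwitz.exists_lyapunov {n : ℕ} {M : Matrix (Fin n) (Fin n) ℝ} (hM : IsHurwitz M) :
    ∃ (W : Vec n → ℝ) (K c : ℝ), 0 < K ∧ 0 < c ∧ (∀ z, ‖z‖ ^ 2 ≤ W z ∧ W z ≤ K * ‖z‖ ^ 2) ∧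
      ∀ (z : ℝ → Vec n) (a b : ℝ), a ≤ b → ContinuousOn z (Icc a b) →
        (∀ t ∈ Ioo a b, HasDerivAt z (mul M (z t)) t) →
        W (z b) ≤ Real.exp (-c * (b - a)) * W (z a) := by
  obtain ⟨h, hpos, N, hN⟩ := hM.exists_euler_contraction
  set T := 1 + h • M with hT
  -- With T = 1 + hM one has hM = T − 1, so differentiating W = ∑ ‖T^k z‖² along the flow gives a
  -- sum bounded by a telescoping one. The matrix exponential is not needed.
  let S : ℕ → Vec n → Vec n := fun k z => mul (T ^ k) z
  have hS0 : ∀ z, S 0 z = z := fun z => by simp [S, mul]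
  have hSM : ∀ k z, h • S k (mul M z) = S (k + 1) z - S k z := by
    intro k z
    simp only [S]
    rw [← mul_mul_apply, pow_succ, ← map_smul, ← LinearMap.sub_apply, ← map_sub]
    have : T ^ k * T - T ^ k = h • (T ^ k * M) := by
      rw [hT, mul_add, mul_one, add_sub_cancel_left, mul_smul_comm]
    rw [this, map_smul]; simp
  choose K hK0 hK using fun k =>
    (LinearMap.toContinuousLinearMap (Matrix.toEuclideanLin (T ^ k))).bound
  have hSb : ∀ k z, ‖S k z‖ ^ 2 ≤ K k ^ 2 * ‖z‖ ^ 2 := fun k z => by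
    rw [← mul_pow]; exact pow_le_pow_left₀ (norm_nonneg _) (hK k z) 2
  let W : Vec n → ℝ := fun z => ∑ k ∈ Finset.range (N + 1), ‖S k z‖ ^ 2
  have hW1 : ∀ z, ‖z‖ ^ 2 ≤ W z := by
    intro z
    have := Finset.single_le_sum (f := fun k => ‖S k z‖ ^ 2) (fun k _ => sq_nonneg _)
      (Finset.mem_range.2 (Nat.succ_pos N))
    simpa only [hS0] using this
  set K₀ := ∑ k ∈ Finset.range (N + 1), K k ^ 2 with hK₀
  have hW2 : ∀ z, W z ≤ K₀ * ‖z‖ ^ 2 := by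
    intro z
    rw [hK₀, Finset.sum_mul]
    exact Finset.sum_le_sum fun k _ => hSb k z
  have hKpos : 0 < K₀ := Finset.sum_pos (fun k _ => pow_pos (hK0 k) 2) ⟨0, by simp⟩
  refine ⟨W, K₀, 3 / (4 * h * K₀), hKpos, by positivity, fun z => ⟨hW1 z, hW2 z⟩, ?_⟩
  intro z a b hab hz hz'
  refine le_exp_mul_of_hasDerivAt_le (f := fun t => W (z t))
    (f' := fun t => ∑ k ∈ Finset.range (N + 1), 2 * inner ℝ (S k (z t)) (S k (mul M (z t)))) hab
    ?_ ?_ ?_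
  · exact continuousOn_finsetSum _ fun k _ =>
      (((continuous_mul_left (T ^ k)).comp_continuousOn hz).norm.pow 2)
  · intro t ht
    exact HasDerivAt.fun_sum fun k _ => (hasDerivAt_mul (T ^ k) (hz' t ht)).norm_sq
  · intro t _
    set ζ := z t
    -- The inequality 2⟨u, v − u⟩ ≤ ‖v‖² − ‖u‖², with u = T^k ζ and v = T^(k+1) ζ.
    have h1 : ∀ k, h * (2 * inner ℝ (S k ζ) (S k (mul M ζ))) ≤
        ‖S (k + 1) ζ‖ ^ 2 - ‖S k ζ‖ ^ 2 := by
      intro k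
      have e : h * (2 * inner ℝ (S k ζ) (S k (mul M ζ))) =
          2 * inner ℝ (S k ζ) (S (k + 1) ζ - S k ζ) := by
        rw [← hSM, inner_smul_right]; ring
      rw [e, inner_sub_right, real_inner_self_eq_norm_sq]
      have := norm_sub_sq_real (S k ζ) (S (k + 1) ζ)
      nlinarith [sq_nonneg ‖S k ζ - S (k + 1) ζ‖]
    have h2 : h * ∑ k ∈ Finset.range (N + 1), 2 * inner ℝ (S k ζ) (S k (mul M ζ)) ≤
        ‖S (N + 1) ζ‖ ^ 2 - ‖S 0 ζ‖ ^ 2 := by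
      rw [Finset.mul_sum, ← Finset.sum_range_sub (fun k => ‖S k ζ‖ ^ 2)]
      exact Finset.sum_le_sum fun k _ => h1 k
    have h3 : ‖S (N + 1) ζ‖ ^ 2 ≤ 1 / 4 * ‖ζ‖ ^ 2 := by
      have := pow_le_pow_left₀ (norm_nonneg _) (hN ζ) 2
      rw [mul_pow] at this
      linarith
    rw [hS0] at h2
    have h4 : 3 / (4 * h * K₀) * W ζ ≤ 3 / (4 * h) * ‖ζ‖ ^ 2 := by
      calc 3 / (4 * h * K₀) * W ζ ≤ 3 / (4 * h * K₀) * (K₀ * ‖ζ‖ ^ 2) := by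
            gcongr; exact hW2 ζ
        _ = _ := by field_simp
    have h5 : ∑ k ∈ Finset.range (N + 1), 2 * inner ℝ (S k ζ) (S k (mul M ζ)) ≤
        -(3 / (4 * h) * ‖ζ‖ ^ 2) := by
      have : -(3 / (4 * h) * ‖ζ‖ ^ 2) = (-(3 / 4) * ‖ζ‖ ^ 2) / h := by field_simp
      rw [this, le_div_iff₀ hpos]
      linarith
    linarith

/-- A kernel vector is a constant trajectory, on which W would have to decay strictly unless the
vector is zero. -/
theorem IsHurwitz.mul_injective {n : ℕ} {M : Matrix (Fin n) (Fin n) ℝ} (hM : IsHurwitz M)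
    {z : Vec n}
    (hz : mul M z = 0) : z = 0 := by
  obtain ⟨W, K, c, -, hc, hW, hd⟩ := hM.exists_lyapunov
  have h1 := hd (fun _ => z) 0 1 zero_le_one continuousOn_const fun t _ => by
    rw [hz]; exact hasDerivAt_const t z
  have h2 : Real.exp (-c * (1 - 0)) < 1 := by rw [Real.exp_lt_one_iff]; linarith
  have h3 := (hW z).1
  have h4 : ‖z‖ ^ 2 ≤ 0 := by
    by_contra h
    nlinarith
  exact norm_eq_zero.1 (by nlinarith [norm_nonneg z])

/-! ### The state and its coordinates -/

/-- Writing the dead zone as s minus its clipping to [−1, 1] makes continuity, the Lipschitz bound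
and the timer inequalities immediate. -/
theorem deadzone_eq (s : ℝ) : deadzone s = s - max (-1) (min 1 s) := by
  unfold deadzone
  split_ifs with h
  · rw [abs_le] at h
    rw [min_eq_right h.2, max_eq_right h.1, sub_self]
  · rw [not_le] at h
    rcases lt_or_ge s 0 with hs | hs
    · rw [abs_of_neg hs] at h ⊢
      rw [Real.sign_of_neg hs, min_eq_right (by linarith), max_eq_left (by linarith)]
      ring
    · rw [abs_of_nonneg hs] at h ⊢
      rw [Real.sign_of_pos (by linarith), min_eq_left h.le, max_eq_right (by norm_num)]
      ring

theorem continuous_deadzone : Continuous deadzone := by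
  rw [funext deadzone_eq]; fun_prop

namespace State

variable {n q p : ℕ}

def xL : State n q p →L[ℝ] Vec n :=
  LinearMap.toContinuousLinearMap
    { toFun := State.x, map_add' := fun _ _ => rfl, map_smul' := fun _ _ => rfl }

def xhL : State n q p →L[ℝ] Vec n :=
  LinearMap.toContinuousLinearMap
    { toFun := State.xh, map_add' := fun _ _ => rfl, map_smul' := fun _ _ => rfl }

def νL : State n q p →L[ℝ] Vec q :=
  LinearMap.toContinuousLinearMap
    { toFun := State.ν, map_add' := fun _ _ => rfl, map_smul' := fun _ _ => rfl }

def τL : State n q p →L[ℝ] Vec p :=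
  LinearMap.toContinuousLinearMap
    { toFun := State.τ, map_add' := fun _ _ => rfl, map_smul' := fun _ _ => rfl }

@[fun_prop] theorem continuous_x : Continuous (State.x : State n q p → Vec n) := xL.continuous
@[fun_prop] theorem continuous_xh : Continuous (State.xh : State n q p → Vec n) := xhL.continuous
@[fun_prop] theorem continuous_ν : Continuous (State.ν : State n q p → Vec q) := νL.continuous

@[simp] theorem mk_x (x xh : Vec n) (ν : Vec q) (τ : Vec p) : (mk x xh ν τ).x = x := rfl
@[simp] theorem mk_xh (x xh : Vec n) (ν : Vec q) (τ : Vec p) : (mk x xh ν τ).xh = xh := rfl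
@[simp] theorem mk_ν (x xh : Vec n) (ν : Vec q) (τ : Vec p) : (mk x xh ν τ).ν = ν := rfl
@[simp] theorem mk_τ (x xh : Vec n) (ν : Vec q) (τ : Vec p) : (mk x xh ν τ).τ = τ := rfl

/-- The transmission error `e = ν - C x̂`. -/
def err (C : Matrix (Fin q) (Fin n) ℝ) (X : State n q p) : Vec q := X.ν - mul C X.xh

/-- The observation error `x̂ - x`. -/
def obs (X : State n q p) : Vec n := X.xh - X.x

@[fun_prop]
theorem continuous_err (C : Matrix (Fin q) (Fin n) ℝ) :
    Continuous (err C : State n q p → Vec q) := by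
  unfold err; fun_prop

@[fun_prop]
theorem continuous_obs : Continuous (obs : State n q p → Vec n) := by
  unfold obs; fun_prop

theorem norm_sq_eq (X : State n q p) :
    ‖X‖ ^ 2 = ‖X.x‖ ^ 2 + (‖X.xh‖ ^ 2 + (‖X.ν‖ ^ 2 + ‖X.τ‖ ^ 2)) := by
  simp [EuclideanSpace.norm_sq_eq, Fintype.sum_sum_type, x, xh, ν, τ]

end State

/-! ### Flow dynamics in terms of x̂, e and the observation error -/

section Flow

variable {n q p : ℕ} (A : Matrix (Fin n) (Fin n) ℝ) (B : Matrix (Fin n) (Fin q) ℝ)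
  (C : Matrix (Fin q) (Fin n) ℝ) (L : Matrix (Fin n) (Fin q) ℝ)

/-- The velocity of `x̂` along flows in terms of `x̂`, the transmission error and the observation
error. -/
def observerRate (x : Vec n) (e : Vec q) (w : Vec n) : Vec n :=
  mul (F11 A B C) x + mul B e + mul (L * C) w

theorem flowField_xh (ρ : ℝ) (X : State n q p) :
    (flowField A B C L ρ X).xh = observerRate A B C L X.xh (X.err C) X.obs := by
  simp only [flowField, State.mk_xh, observerRate, State.err, State.obs, F11, mul_mul_apply,
    map_sub,
    mul_add_apply]
  abel

theorem flowField_obs (ρ : ℝ) (X : State n q p) :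
    (flowField A B C L ρ X).obs = mul (A + L * C) X.obs := by
  simp only [flowField, State.mk_xh, State.mk_x, State.obs, mul_mul_apply, map_sub, mul_add_apply]
  abel

theorem flowField_err (ρ : ℝ) (X : State n q p) :
    (flowField A B C L ρ X).err C = -mul C (observerRate A B C L X.xh (X.err C) X.obs) := by
  rw [← flowField_xh A B C L ρ]
  simp [State.err, flowField]

theorem flowField_τ (ρ : ℝ) (X : State n q p) (k : Fin p) :
    (flowField A B C L ρ X).τ k = 1 - deadzone (X.τ k / ρ) := rfl

theorem continuous_flowField (ρ : ℝ) : Continuous (flowField A B C L ρ : State n q p → _) := by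
  unfold flowField State.mk
  have h : ∀ i, Continuous fun X : State n q p => deadzone (X.τ i / ρ) := fun i =>
    continuous_deadzone.comp (by fun_prop)
  refine (PiLp.continuous_toLp 2 _).comp (continuous_pi fun i => ?_)
  rcases i with i | i | i | i
  · simp only [Sum.elim_inl]; fun_prop
  · simp only [Sum.elim_inl, Sum.elim_inr]; fun_prop
  · simp only [Sum.elim_inl, Sum.elim_inr]; fun_prop
  · simp only [Sum.elim_inr]
    exact continuous_const.sub (h i)

theorem exists_observerRate_bound : ∃ κ > 0, ∀ x e w,
    ‖observerRate A B C L x e w‖ ≤ κ * (‖x‖ + ‖e‖ + ‖w‖) ∧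
    ‖mul C (observerRate A B C L x e w)‖ ≤ κ * (‖x‖ + ‖e‖ + ‖w‖) := by
  obtain ⟨a, ha, ha'⟩ := (LinearMap.toContinuousLinearMap (Matrix.toEuclideanLin (F11 A B C))).bound
  obtain ⟨b, hb, hb'⟩ := (LinearMap.toContinuousLinearMap (Matrix.toEuclideanLin B)).bound
  obtain ⟨l, hl, hl'⟩ := (LinearMap.toContinuousLinearMap (Matrix.toEuclideanLin (L * C))).bound
  obtain ⟨c, hc, hc'⟩ := (LinearMap.toContinuousLinearMap (Matrix.toEuclideanLin C)).bound
  have h1 : ∀ x e w, ‖observerRate A B C L x e w‖ ≤ (a + b + l) * (‖x‖ + ‖e‖ + ‖w‖) := by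
    intro x e w
    have h := norm_add₃_le (a := mul (F11 A B C) x) (b := mul B e) (c := mul (L * C) w)
    have := ha' x
    have := hb' e
    have := hl' w
    simp only [LinearMap.coe_toContinuousLinearMap'] at *
    unfold observerRate
    have := norm_nonneg x
    have := norm_nonneg e
    have := norm_nonneg w
    refine h.trans ?_
    have e1 : (a + b + l) * (‖x‖ + ‖e‖ + ‖w‖) = a * ‖x‖ + b * ‖e‖ + l * ‖w‖ +
      (a * (‖e‖ + ‖w‖) + b * (‖x‖ + ‖w‖) + l * (‖x‖ + ‖e‖)) := by ring
    have : 0 ≤ a * (‖e‖ + ‖w‖) + b * (‖x‖ + ‖w‖) + l * (‖x‖ + ‖e‖) := by positivity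
    linarith
  refine ⟨(1 + c) * (a + b + l), by positivity, fun x e w => ⟨(h1 x e w).trans ?_, ?_⟩⟩
  · gcongr
    nlinarith
  · refine (hc' _).trans ?_
    have := h1 x e w
    have h2 : 0 ≤ (a + b + l) * (‖x‖ + ‖e‖ + ‖w‖) := by positivity
    nlinarith

end Flow

/-! ### Transmission-lazy loops -/

/-- A closed loop in which the sensors are grouped in blocks (`σ i` is the block of sensor `i`),
each block has one timer, and block `k` may wait as long as `(x̂, e)` is in `𝒞 k` and may transmit
when `(x̂, e)` is in `𝒟 k`. -/
structure LazyLoop {n q p : ℕ} (A : Matrix (Fin n) (Fin n) ℝ) (B : Matrix (Fin n) (Fin q) ℝ)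
    (C : Matrix (Fin q) (Fin n) ℝ) (L : Matrix (Fin n) (Fin q) ℝ) (σ : Fin q → Fin p)
    (𝒞 𝒟 : Fin p → Set (Vec n × Vec q)) (Δ ρ : ℝ) (H : HybridSystem (State n q p)) : Prop where
  flowSet_iff : ∀ X, X ∈ H.flowSet ↔
    (∀ k, 0 ≤ X.τ k) ∧ ∀ k, (X.xh, X.err C) ∈ 𝒞 k ∨ X.τ k ≤ Δ
  jumpSet_iff : ∀ X, X ∈ H.jumpSet ↔
    (∀ k, 0 ≤ X.τ k) ∧ ∃ k, (X.xh, X.err C) ∈ 𝒟 k ∧ Δ ≤ X.τ k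
  flowMap_eq : ∀ X, H.flowMap X = {flowField A B C L ρ X}
  jump_nonempty : ∀ X ∈ H.jumpSet, (H.jumpMap X).Nonempty
  jump : ∀ X ∈ H.jumpSet, ∀ Y ∈ H.jumpMap X, Y.x = X.x ∧ Y.xh = X.xh ∧
    ∃ S : Set (Fin p), S.Nonempty ∧ (∀ k ∈ S, Δ ≤ X.τ k ∧ Y.τ k = 0) ∧
      (∀ k ∉ S, Y.τ k = X.τ k) ∧ (∀ i, σ i ∈ S → Y.err C i = 0) ∧
      ∀ i, σ i ∉ S → Y.err C i = X.err C i

section Trajectories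

variable {n q p : ℕ} {A : Matrix (Fin n) (Fin n) ℝ} {B : Matrix (Fin n) (Fin q) ℝ}
  {C : Matrix (Fin q) (Fin n) ℝ} {L : Matrix (Fin n) (Fin q) ℝ} {σ : Fin q → Fin p}
  {𝒞 𝒟 : Fin p → Set (Vec n × Vec q)} {Δ ρ : ℝ} {H : HybridSystem (State n q p)}
  {T : Set (ℝ × ℕ)} {φ : ℝ → ℕ → State n q p}

namespace LazyLoop

theorem hasDerivAt (hH : LazyLoop A B C L σ 𝒞 𝒟 Δ ρ H) (hs : IsSolution H T φ) {a b : ℝ} {j : ℕ}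
    (hab : a < b) (ha : (a, j) ∈ T) (hb : (b, j) ∈ T) {t : ℝ} (ht : t ∈ Ioo a b) :
    HasDerivAt (fun s => φ s j) (flowField A B C L ρ (φ t j)) t :=
  hs.hasDerivAt (continuous_flowField A B C L ρ) hH.flowMap_eq hab ha hb t ht

theorem hasDerivAt_xh (hH : LazyLoop A B C L σ 𝒞 𝒟 Δ ρ H) (hs : IsSolution H T φ) {a b : ℝ}
    {j : ℕ} (hab : a < b) (ha : (a, j) ∈ T) (hb : (b, j) ∈ T) {t : ℝ} (ht : t ∈ Ioo a b) :
    HasDerivAt (fun s => (φ s j).xh)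
      (observerRate A B C L (φ t j).xh ((φ t j).err C) (φ t j).obs) t := by
  rw [← flowField_xh A B C L ρ]
  exact State.xhL.hasFDerivAt.comp_hasDerivAt t (hH.hasDerivAt hs hab ha hb ht)

theorem hasDerivAt_obs (hH : LazyLoop A B C L σ 𝒞 𝒟 Δ ρ H) (hs : IsSolution H T φ) {a b : ℝ}
    {j : ℕ} (hab : a < b) (ha : (a, j) ∈ T) (hb : (b, j) ∈ T) {t : ℝ} (ht : t ∈ Ioo a b) :
    HasDerivAt (fun s => (φ s j).obs) (mul (A + L * C) (φ t j).obs) t := by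
  rw [← flowField_obs A B C L ρ]
  exact (State.xhL - State.xL).hasFDerivAt.comp_hasDerivAt t (hH.hasDerivAt hs hab ha hb ht)

theorem hasDerivAt_err (hH : LazyLoop A B C L σ 𝒞 𝒟 Δ ρ H) (hs : IsSolution H T φ) {a b : ℝ}
    {j : ℕ} (hab : a < b) (ha : (a, j) ∈ T) (hb : (b, j) ∈ T) {t : ℝ} (ht : t ∈ Ioo a b) :
    HasDerivAt (fun s => (φ s j).err C)
      (-mul C (observerRate A B C L (φ t j).xh ((φ t j).err C) (φ t j).obs)) t := by
  rw [← flowField_err A B C L ρ]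
  exact (State.νL.hasFDerivAt.comp_hasDerivAt t (hH.hasDerivAt hs hab ha hb ht)).sub
    (hasDerivAt_mul C (State.xhL.hasFDerivAt.comp_hasDerivAt t (hH.hasDerivAt hs hab ha hb ht)))

theorem hasDerivAt_τ (hH : LazyLoop A B C L σ 𝒞 𝒟 Δ ρ H) (hs : IsSolution H T φ) {a b : ℝ}
    {j : ℕ} (hab : a < b) (ha : (a, j) ∈ T) (hb : (b, j) ∈ T) {t : ℝ} (ht : t ∈ Ioo a b)
    (k : Fin p) :
    HasDerivAt (fun s => (φ s j).τ k) (1 - deadzone ((φ t j).τ k / ρ)) t := by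
  rw [← flowField_τ A B C L ρ]
  exact ((EuclideanSpace.proj (𝕜 := ℝ) k).comp State.τL).hasFDerivAt.comp_hasDerivAt t
    (hH.hasDerivAt hs hab ha hb ht)

theorem jump_eq (hH : LazyLoop A B C L σ 𝒞 𝒟 Δ ρ H) (hs : IsSolution H T φ) {t : ℝ} {j : ℕ}
    (h1 : (t, j) ∈ T) (h2 : (t, j + 1) ∈ T) :
    (φ t (j + 1)).x = (φ t j).x ∧ (φ t (j + 1)).xh = (φ t j).xh ∧
    ∃ S : Set (Fin p), S.Nonempty ∧ (∀ k ∈ S, Δ ≤ (φ t j).τ k ∧ (φ t (j + 1)).τ k = 0) ∧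
      (∀ k ∉ S, (φ t (j + 1)).τ k = (φ t j).τ k) ∧ (∀ i, σ i ∈ S → (φ t (j + 1)).err C i = 0) ∧
      ∀ i, σ i ∉ S → (φ t (j + 1)).err C i = (φ t j).err C i :=
  hH.jump _ (hs.jump t j h1 h2).1 _ (hs.jump t j h1 h2).2

theorem jump_obs (hH : LazyLoop A B C L σ 𝒞 𝒟 Δ ρ H) (hs : IsSolution H T φ) {t : ℝ} {j : ℕ}
    (h1 : (t, j) ∈ T) (h2 : (t, j + 1) ∈ T) : (φ t (j + 1)).obs = (φ t j).obs := by
  obtain ⟨hx, hxh, -⟩ := hH.jump_eq hs h1 h2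
  rw [State.obs, hx, hxh]; rfl

/-- The flow condition holds on closed flow intervals when the sets `𝒞 k` are closed. -/
theorem flow_closed (hH : LazyLoop A B C L σ 𝒞 𝒟 Δ ρ H) (h𝒞 : ∀ k, IsClosed (𝒞 k))
    (hs : IsSolution H T φ) {a b : ℝ} {j : ℕ} (hab : a < b) (ha : (a, j) ∈ T) (hb : (b, j) ∈ T)
    {t : ℝ} (ht : t ∈ Icc a b) :
    (∀ k, 0 ≤ (φ t j).τ k) ∧
      ∀ k, ((φ t j).xh, (φ t j).err C) ∈ 𝒞 k ∨ (φ t j).τ k ≤ Δ := by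
  let F : Set (State n q p) :=
    {X | (∀ k, 0 ≤ X.τ k) ∧ ∀ k, (X.xh, X.err C) ∈ 𝒞 k ∨ X.τ k ≤ Δ}
  have hF : IsClosed F := by
    have e : F = (⋂ k, {X | 0 ≤ X.τ k}) ∩
        ⋂ k, ((fun X : State n q p => (X.xh, X.err C)) ⁻¹' 𝒞 k ∪ {X | X.τ k ≤ Δ}) := by
      ext X; simp [F]
    rw [e]
    refine (isClosed_iInter fun k => isClosed_le continuous_const (by fun_prop)).inter
      (isClosed_iInter fun k => ((h𝒞 k).preimage (by fun_prop)).union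
        (isClosed_le (by fun_prop) continuous_const))
  -- A solution must lie in the flow set only at times with a later time in the same interval; the
  -- right end point b is reached by closure.
  have hmaps : MapsTo (fun t => φ t j) (Ico a b) F := fun s hs' => by
    have hsT : s ∈ timeSlice T j := hs.arc.1.ordConnected ha hb ⟨hs'.1, hs'.2.le⟩
    exact (hH.flowSet_iff _).1 (hs.flow_mem j s hsT ⟨b, hb, hs'.2⟩)
  have hc := hs.continuousOn hab.le ha hb
  rw [← closure_Ico hab.ne] at hc ht
  have := hmaps.closure_of_continuousOn hc
  rw [hF.closure_eq] at this
  exact this ht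

theorem τ_nonneg (hH : LazyLoop A B C L σ 𝒞 𝒟 Δ ρ H) (h𝒞 : ∀ k, IsClosed (𝒞 k))
    (hs : IsSolution H T φ) {t : ℝ} {j : ℕ} (ht : (t, j) ∈ T) : ∀ k, 0 ≤ (φ t j).τ k := by
  refine hs.arc.1.induction (P := fun t j => ∀ k, 0 ≤ (φ t j).τ k) ?_ ?_ ?_ ht
  · rcases hs.init with h | h
    · exact ((hH.flowSet_iff _).1 h).1
    · exact ((hH.jumpSet_iff _).1 h).1
  · intro t j h1 h2 ih k
    obtain ⟨-, -, S, -, hS, hS', -⟩ := hH.jump_eq hs h1 h2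
    by_cases hk : k ∈ S
    · rw [(hS k hk).2]
    · rw [hS' k hk]; exact ih k
  · intro a b j hab ha hb _
    exact (hH.flow_closed h𝒞 hs hab ha hb ⟨hab.le, le_rfl⟩).1

theorem timer_rate_nonneg {s : ℝ} (hs : 0 ≤ s) : 0 ≤ deadzone s := by
  rw [deadzone_eq, sub_nonneg]
  exact max_le (by linarith) (min_le_right _ _)

theorem τ_le_add (hH : LazyLoop A B C L σ 𝒞 𝒟 Δ ρ H) (h𝒞 : ∀ k, IsClosed (𝒞 k)) (hρ : 0 < ρ)
    (hs : IsSolution H T φ) {a b : ℝ} {j : ℕ} (hab : a < b) (ha : (a, j) ∈ T) (hb : (b, j) ∈ T)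
    (k : Fin p) : (φ b j).τ k ≤ (φ a j).τ k + (b - a) := by
  have hc := hs.continuousOn hab.le ha hb
  have := le_of_hasDerivAt_nonpos (f := fun t => (φ t j).τ k - t)
    (f' := fun t => 1 - deadzone ((φ t j).τ k / ρ) - 1) hab.le (by fun_prop)
    (fun t ht => (hH.hasDerivAt_τ hs hab ha hb ht k).sub (hasDerivAt_id t)) fun t ht => by
      have h0 := (hH.flow_closed h𝒞 hs hab ha hb (Ioo_subset_Icc_self ht)).1 k
      have := timer_rate_nonneg (div_nonneg h0 hρ.le)
      linarith
  linarith

/-- Clipping never exceeds 1, so 1 − dz(y/ρ) ≤ 2 − y/ρ: a timer is attracted from above by 2ρ at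
rate at least 1/ρ. -/
theorem τ_sub_le (hH : LazyLoop A B C L σ 𝒞 𝒟 Δ ρ H) (hρ : 0 < ρ)
    (hs : IsSolution H T φ) {a b : ℝ} {j : ℕ} (hab : a < b) (ha : (a, j) ∈ T) (hb : (b, j) ∈ T)
    (k : Fin p) : (φ b j).τ k - 2 * ρ ≤ Real.exp (-(1 / ρ) * (b - a)) * ((φ a j).τ k - 2 * ρ) := by
  have hc := hs.continuousOn hab.le ha hb
  refine le_exp_mul_of_hasDerivAt_le (f := fun t => (φ t j).τ k - 2 * ρ)
    (f' := fun t => 1 - deadzone ((φ t j).τ k / ρ)) hab.le (by fun_prop)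
    (fun t ht => (hH.hasDerivAt_τ hs hab ha hb ht k).sub_const _) fun t ht => ?_
  set y := (φ t j).τ k
  have h1 : -(1 / ρ) * (y - 2 * ρ) = 2 - y / ρ := by field_simp; ring
  rw [h1, deadzone_eq]
  have : max (-1) (min 1 (y / ρ)) ≤ 1 := max_le (by norm_num) (min_le_left _ _)
  linarith

/-- A timer runs at unit speed until it reaches ρ and cannot fall below ρ afterwards while flowing.
Hence a reading below ρ is at least the elapsed time plus the initial reading. -/
theorem min_le_τ (hH : LazyLoop A B C L σ 𝒞 𝒟 Δ ρ H) (h𝒞 : ∀ k, IsClosed (𝒞 k)) (hρ : 0 < ρ)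
    (hs : IsSolution H T φ) {a b : ℝ} {j : ℕ} (hab : a < b) (ha : (a, j) ∈ T) (hb : (b, j) ∈ T)
    (k : Fin p) : min ((φ a j).τ k + (b - a)) ρ ≤ (φ b j).τ k := by
  by_cases hex : ∃ u ∈ Icc a b, ρ ≤ (φ u j).τ k
  · obtain ⟨u, hu, hρu⟩ := hex
    have huT := hs.arc.1.ordConnected ha hb hu
    refine (min_le_right _ _).trans ?_
    rcases hu.2.eq_or_lt with rfl | hub
    · exact hρu
    have hc := hs.continuousOn hub.le huT hb
    have := le_exp_mul_of_hasDerivAt_le (f := fun t => ρ - (φ t j).τ k) (c := 1 / ρ)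
      (f' := fun t => -(1 - deadzone ((φ t j).τ k / ρ))) hub.le (by fun_prop)
      (fun t ht => (hH.hasDerivAt_τ hs hub huT hb ht k).const_sub _) fun t ht => by
        have h0 := (hH.flow_closed h𝒞 hs hub huT hb (Ioo_subset_Icc_self ht)).1 k
        set y := (φ t j).τ k
        have h1 : -(1 / ρ) * (ρ - y) = y / ρ - 1 := by field_simp; ring
        rw [h1, deadzone_eq]
        have : 0 ≤ max (-1) (min 1 (y / ρ)) :=
          le_max_of_le_right (le_min zero_le_one (div_nonneg h0 hρ.le))
        linarith
    have h2 : Real.exp (-(1 / ρ) * (b - u)) * (ρ - (φ u j).τ k) ≤ 0 :=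
      mul_nonpos_of_nonneg_of_nonpos (Real.exp_pos _).le (by linarith)
    linarith
  · push Not at hex
    refine (min_le_left _ _).trans ?_
    have hc := hs.continuousOn hab.le ha hb
    have := le_of_hasDerivAt_nonpos (f := fun t => t - (φ t j).τ k)
      (f' := fun t => 1 - (1 - deadzone ((φ t j).τ k / ρ))) hab.le (by fun_prop)
      (fun t ht => (hasDerivAt_id t).sub (hH.hasDerivAt_τ hs hab ha hb ht k)) fun t ht => by
        have h0 := (hH.flow_closed h𝒞 hs hab ha hb (Ioo_subset_Icc_self ht)).1 k
        have h1 := hex t (Ioo_subset_Icc_self ht)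
        have h2 : (φ t j).τ k / ρ ≤ 1 := by rw [div_le_one hρ]; exact h1.le
        have h3 := div_nonneg h0 hρ.le
        rw [deadzone_eq, min_eq_right h2, max_eq_right (by linarith)]
        linarith
    linarith

theorem τ_excess_le (hH : LazyLoop A B C L σ 𝒞 𝒟 Δ ρ H) (hρ : 0 < ρ)
    (hs : IsSolution H T φ) {t : ℝ} {j : ℕ} (ht : (t, j) ∈ T) (k : Fin p) :
    (φ t j).τ k - 2 * ρ ≤ Real.exp (-(1 / ρ) * t) * max 0 ((φ 0 0).τ k - 2 * ρ) := by
  have hnn : ∀ t, 0 ≤ Real.exp (-(1 / ρ) * t) * max 0 ((φ 0 0).τ k - 2 * ρ) := fun t => by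
    positivity
  refine hs.arc.1.induction (P := fun t j =>
    (φ t j).τ k - 2 * ρ ≤ Real.exp (-(1 / ρ) * t) * max 0 ((φ 0 0).τ k - 2 * ρ)) ?_ ?_ ?_ ht
  · simp
  · intro t j h1 h2 ih
    obtain ⟨-, -, S, -, hS, hS', -⟩ := hH.jump_eq hs h1 h2
    by_cases hk : k ∈ S
    · rw [(hS k hk).2]; linarith [hnn t]
    · rw [hS' k hk]; exact ih
  · intro a b j hab ha hb ih
    refine (hH.τ_sub_le hρ hs hab ha hb k).trans ?_
    refine (mul_le_mul_of_nonneg_left ih (Real.exp_pos _).le).trans_eq ?_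
    rw [← mul_assoc, ← Real.exp_add]
    ring_nf

/-- The number of jumps grows at most linearly with the ordinary time. -/
theorem jump_count_le (hH : LazyLoop A B C L σ 𝒞 𝒟 Δ ρ H) (h𝒞 : ∀ k, IsClosed (𝒞 k)) (hρ : 0 < ρ)
    (hΔ : 0 < Δ) (hs : IsSolution H T φ) {t : ℝ} {j : ℕ} (ht : (t, j) ∈ T) :
    (j : ℝ) * Δ ≤ p * Δ + p * t := by
  -- Each jump resets some timer that had reached Δ, so the sum of the timers truncated at Δ drops
  -- by at least Δ and pays for the increment of j. Flow raises the sum at rate at most p.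
  have key : (j : ℝ) * Δ + ∑ k, min ((φ t j).τ k) Δ ≤ p * Δ + p * t := by
    refine hs.arc.1.induction
      (P := fun t j => (j : ℝ) * Δ + ∑ k, min ((φ t j).τ k) Δ ≤ p * Δ + p * t) ?_ ?_ ?_ ht
    · have : ∑ k, min ((φ 0 0).τ k) Δ ≤ ∑ _k : Fin p, Δ :=
        Finset.sum_le_sum fun k _ => min_le_right _ _
      simpa using this
    · intro t j h1 h2 ih
      obtain ⟨-, -, S, ⟨l, hl⟩, hS, hS', -⟩ := hH.jump_eq hs h1 h2
      have hle : ∀ k, min ((φ t (j + 1)).τ k) Δ ≤ min ((φ t j).τ k) Δ := by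
        intro k
        by_cases hk : k ∈ S
        · rw [(hS k hk).2]
          exact min_le_min_right _ (hH.τ_nonneg h𝒞 hs h1 k)
        · rw [hS' k hk]
      have h3 : ∑ k, min ((φ t (j + 1)).τ k) Δ + Δ ≤ ∑ k, min ((φ t j).τ k) Δ := by
        rw [← Finset.add_sum_erase _ _ (Finset.mem_univ l),
          ← Finset.add_sum_erase (a := l) _ (fun k => min ((φ t j).τ k) Δ) (Finset.mem_univ l),
          (hS l hl).2, min_eq_left hΔ.le, min_eq_right (hS l hl).1]
        have := Finset.sum_le_sum (s := Finset.univ.erase l) fun k _ => hle k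
        linarith
      push_cast
      linarith
    · intro a b j hab ha hb ih
      have : ∑ k, min ((φ b j).τ k) Δ ≤ ∑ k, (min ((φ a j).τ k) Δ + (b - a)) := by
        refine Finset.sum_le_sum fun k _ => ?_
        have := hH.τ_le_add h𝒞 hρ hs hab ha hb k
        rcases min_cases ((φ a j).τ k) Δ with ⟨h, -⟩ | ⟨h, -⟩ <;> rw [h]
        · exact (min_le_left _ _).trans this
        · exact (min_le_right _ _).trans (by linarith)
      rw [Finset.sum_add_distrib, Finset.sum_const, Finset.card_univ, Fintype.card_fin,
        nsmul_eq_mul] at this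
      linarith
  have h0 : 0 ≤ ∑ k, min ((φ t j).τ k) Δ :=
    Finset.sum_nonneg fun k _ => le_min (hH.τ_nonneg h𝒞 hs ht k) hΔ.le
  linarith

/-- The transmission errors of a block are small shortly after its last transmission. -/
theorem exists_last_transmission (hH : LazyLoop A B C L σ 𝒞 𝒟 Δ ρ H) (h𝒞 : ∀ k, IsClosed (𝒞 k))
    (hρ : 0 < ρ) (hs : IsSolution H T φ) {D l T₀ : ℝ} (hD : 0 ≤ D) (hl : 0 ≤ l)
    (hbd : ∀ t j, (t, j) ∈ T → t ≤ T₀ →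
      ‖mul C (observerRate A B C L (φ t j).xh ((φ t j).err C) (φ t j).obs)‖ ≤ D * Real.exp (-l * t))
    {t : ℝ} {j : ℕ} (ht : (t, j) ∈ T) (htT : t ≤ T₀) (k : Fin p) :
    ∃ s ∈ Icc 0 t, min (t - s) ρ ≤ (φ t j).τ k ∧ ∀ i, σ i = k →
      |(φ t j).err C i| ≤ (D * (t - s) + ‖(φ 0 0).err C‖) * Real.exp (-l * s) := by
  -- The witness s is the last transmission time of block k, or 0 before the first one, when the
  -- initial error must be added. The weight is taken at s because exp(−l·) is largest there on [s,
  -- t].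
  revert htT
  refine hs.arc.1.induction (P := fun t j => t ≤ T₀ → ∃ s ∈ Icc 0 t, min (t - s) ρ ≤ (φ t j).τ k ∧
    ∀ i, σ i = k →
      |(φ t j).err C i| ≤ (D * (t - s) + ‖(φ 0 0).err C‖) * Real.exp (-l * s)) ?_ ?_ ?_ ht
  · intro _
    refine ⟨0, ⟨le_rfl, le_rfl⟩, ?_, fun i _ => ?_⟩
    · rw [sub_self]
      exact (min_le_left _ _).trans (hH.τ_nonneg h𝒞 hs hs.arc.1.zero_mem k)
    · simpa using PiLp.norm_apply_le ((φ 0 0).err C) i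
  · intro t j h1 h2 ih htT
    obtain ⟨s, hs1, hs2, hs3⟩ := ih htT
    obtain ⟨-, -, S, -, hS, hS', hS3, hS4⟩ := hH.jump_eq hs h1 h2
    by_cases hk : k ∈ S
    · refine ⟨t, ⟨hs.arc.1.nonneg h1, le_rfl⟩, ?_, fun i hi => ?_⟩
      · rw [(hS k hk).2, sub_self]; exact min_le_left _ _
      · rw [hS3 i (hi ▸ hk), abs_zero]
        have := norm_nonneg ((φ 0 0).err C)
        rw [sub_self]; positivity
    · refine ⟨s, hs1, ?_, fun i hi => ?_⟩
      · rw [hS' k hk]; exact hs2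
      · rw [hS4 i (hi ▸ hk)]; exact hs3 i hi
  · intro a b j hab ha hb ih hbT
    obtain ⟨s, hs1, hs2, hs3⟩ := ih (hab.le.trans hbT)
    refine ⟨s, ⟨hs1.1, hs1.2.trans hab.le⟩, ?_, fun i hi => ?_⟩
    · refine le_trans ?_ (hH.min_le_τ h𝒞 hρ hs hab ha hb k)
      rcases min_cases (a - s) ρ with ⟨h, -⟩ | ⟨h, -⟩ <;> rw [h] at hs2
      · exact min_le_min_right _ (by linarith)
      · exact (min_le_right _ _).trans (le_min (by linarith) le_rfl)
    · have hc := hs.continuousOn hab.le ha hb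
      have hmv : ‖(φ b j).err C - (φ a j).err C‖ ≤ D * Real.exp (-l * s) * (b - a) := by
        refine norm_sub_le_of_hasDerivAt (u := fun t => (φ t j).err C) hab (by fun_prop)
          fun t ht => ⟨_, ?_, hH.hasDerivAt_err hs hab ha hb ht⟩
        rw [norm_neg]
        refine (hbd t j (hs.arc.1.ordConnected ha hb (Ioo_subset_Icc_self ht))
          (ht.2.le.trans hbT)).trans ?_
        gcongr ?_ * Real.exp ?_
        nlinarith [hs1.2, ht.1]
      have h4 := (PiLp.norm_apply_le ((φ b j).err C - (φ a j).err C) i).trans hmv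
      rw [PiLp.sub_apply, Real.norm_eq_abs] at h4
      have h5 := abs_sub_abs_le_abs_sub ((φ b j).err C i) ((φ a j).err C i)
      have h6 := hs3 i hi
      linarith

end LazyLoop

end Trajectories

theorem norm_le_sum_abs {m : ℕ} (e : Vec m) : ‖e‖ ≤ ∑ i, |e i| := by
  have h0 : 0 ≤ ∑ i, |e i| := Finset.sum_nonneg fun i _ => abs_nonneg _
  refine le_of_sq_le_sq ?_ h0
  rw [EuclideanSpace.norm_sq_eq]
  simp only [Real.norm_eq_abs]
  rw [sq (∑ i, |e i|), Finset.sum_mul]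
  refine Finset.sum_le_sum fun i _ => ?_
  rw [sq]
  exact mul_le_mul_of_nonneg_left
    (Finset.single_le_sum (f := fun i => |e i|) (fun i _ => abs_nonneg _) (Finset.mem_univ i))
    (abs_nonneg _)

/-- If `N` vanishes on all `M ^ (k + 1) z` and `M` is injective, then `N` vanishes at `z`. -/
theorem apply_eq_zero_of_pow_succ {V V' : Type*} [AddCommGroup V] [Module ℝ V]
    [FiniteDimensional ℝ V] [AddCommGroup V'] [Module ℝ V'] {M : Module.End ℝ V} {N : V →ₗ[ℝ] V'}
    (hM : Function.Injective M) {z : V} (hz : ∀ k : ℕ, N ((M ^ (k + 1)) z) = 0) : N z = 0 := by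
  -- Z is invariant under M, and an injective endomorphism of a finite-dimensional space is onto. So
  -- z = Mw with w in Z, and the condition on w at exponent 1 is the claim.
  let Z : Submodule ℝ V := ⨅ k : ℕ, LinearMap.ker (N ∘ₗ (M ^ (k + 1)))
  have hZ : ∀ {w}, w ∈ Z ↔ ∀ k : ℕ, N ((M ^ (k + 1)) w) = 0 := by
    intro w; simp [Z]
  have hMZ : ∀ w ∈ Z, M w ∈ Z := by
    intro w hw
    rw [hZ] at hw ⊢
    intro k
    have := hw (k + 1)
    rwa [pow_succ, Module.End.mul_apply] at this
  have hinj : Function.Injective (M.restrict hMZ) := by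
    intro u v huv
    exact Subtype.ext (hM (congrArg Subtype.val huv))
  obtain ⟨⟨w, hw⟩, hwz⟩ := (LinearMap.injective_iff_surjective.1 hinj) ⟨z, hZ.2 hz⟩
  have hwz' : M w = z := congrArg Subtype.val hwz
  rw [← hwz']
  simpa using hZ.1 hw 0

/-! ### Lyapunov certificates and the small-gain decay estimate -/

section Decay

variable {n q p : ℕ}

/-- The function `½ (⟨x, P₁ x⟩ + ⟨e, P₂ e⟩)`. -/
def blockForm (P₁ : Matrix (Fin n) (Fin n) ℝ) (P₂ : Matrix (Fin q) (Fin q) ℝ) (x : Vec n)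
    (e : Vec q) : ℝ :=
  1 / 2 * (inner ℝ x (mul P₁ x) + inner ℝ e (mul P₂ e))

/-- A quadratic function of `(x̂, e)` certifying the decay of a transmission-lazy loop whose
waiting sets are `𝒞`. -/
structure LazyLyapunov (A : Matrix (Fin n) (Fin n) ℝ) (B : Matrix (Fin n) (Fin q) ℝ)
    (C : Matrix (Fin q) (Fin n) ℝ) (L : Matrix (Fin n) (Fin q) ℝ) (σ : Fin q → Fin p)
    (𝒞 : Fin p → Set (Vec n × Vec q)) (P₁ : Matrix (Fin n) (Fin n) ℝ)
    (P₂ : Matrix (Fin q) (Fin q) ℝ) (K c : ℝ) : Prop where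
  K_pos : 0 < K
  c_pos : 0 < c
  isClosed : ∀ k, IsClosed (𝒞 k)
  symm₁ : ∀ a b, inner ℝ a (mul P₁ b) = inner ℝ (mul P₁ a) b
  symm₂ : ∀ a b, inner ℝ a (mul P₂ b) = inner ℝ (mul P₂ a) b
  le_form : ∀ x e, ‖x‖ ^ 2 ≤ K * blockForm P₁ P₂ x e
  form_le : ∀ x e, blockForm P₁ P₂ x e ≤ K * (‖x‖ ^ 2 + ‖e‖ ^ 2)
  jump : ∀ x e e' (S : Set (Fin p)), S.Nonempty → (∀ i, σ i ∈ S → e' i = 0) →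
    (∀ i, σ i ∉ S → e' i = e i) → blockForm P₁ P₂ x e' ≤ blockForm P₁ P₂ x e
  -- r bounds the errors of those blocks that are not covered by their waiting condition, namely the
  -- recently sampled ones.
  decrease : ∀ x e w r, 0 ≤ r → (∀ k, (x, e) ∈ 𝒞 k ∨ ∀ i, σ i = k → |e i| ≤ r) →
    inner ℝ (mul P₁ x) (observerRate A B C L x e w) +
      inner ℝ (mul P₂ e) (-mul C (observerRate A B C L x e w)) ≤
        -c * blockForm P₁ P₂ x e + K * (r ^ 2 + ‖w‖ ^ 2)
  err_le : ∀ k x e, (x, e) ∈ 𝒞 k → x ≠ 0 → ∀ i, σ i = k → |e i| ≤ K * ‖x‖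
  -- At x = 0 the bound `err_le` is not available. Either the waiting condition still forces e = 0
  -- there, or B is injective and a dynamical argument replaces it.
  degenerate : (∀ e, mul B e = 0 → e = 0) ∨ ∀ k e, (0, e) ∈ 𝒞 k → ∀ i, σ i = k → e i = 0

variable {A : Matrix (Fin n) (Fin n) ℝ} {B : Matrix (Fin n) (Fin q) ℝ}
  {C : Matrix (Fin q) (Fin n) ℝ} {L : Matrix (Fin n) (Fin q) ℝ} {σ : Fin q → Fin p}
  {𝒞 𝒟 : Fin p → Set (Vec n × Vec q)} {Δ ρ : ℝ} {H : HybridSystem (State n q p)}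
  {T : Set (ℝ × ℕ)} {φ : ℝ → ℕ → State n q p} {P₁ : Matrix (Fin n) (Fin n) ℝ}
  {P₂ : Matrix (Fin q) (Fin q) ℝ} {K c : ℝ}

namespace LazyLoop

/-- On a flow interval, a block past its dwell time has transmission errors dominated by `x̂`. -/
theorem err_le_or (hH : LazyLoop A B C L σ 𝒞 𝒟 Δ ρ H) (hV : LazyLyapunov A B C L σ 𝒞 P₁ P₂ K c)
    (hL : IsHurwitz (A + L * C)) (hs : IsSolution H T φ) {a b : ℝ} {j : ℕ}
    (hab : a < b) (ha : (a, j) ∈ T) (hb : (b, j) ∈ T) (k : Fin p) :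
    (∀ i, σ i = k → |(φ b j).err C i| ≤ K * ‖(φ b j).xh‖) ∨ (φ b j).τ k ≤ Δ := by
  by_cases hτ : (φ b j).τ k ≤ Δ
  · exact Or.inr hτ
  refine Or.inl fun i hi => ?_
  have hbC := ((hH.flow_closed hV.isClosed hs hab ha hb ⟨hab.le, le_rfl⟩).2 k).resolve_right hτ
  by_cases hx : (φ b j).xh ≠ 0
  · exact hV.err_le k _ _ hbC hx i hi
  rw [not_not] at hx
  rcases hV.degenerate with hB | hz
  swap
  · rw [hx] at hbC
    rw [hz k _ hbC i hi, abs_zero]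
    exact mul_nonneg hV.K_pos.le (norm_nonneg _)
  -- Suppose the bound fails at b, with B injective. Both strict inequalities persist just before b,
  -- where `err_le` then forces x̂ to vanish identically.
  by_contra hlt
  rw [not_le] at hlt hτ
  have hc := hs.continuousOn hab.le ha hb
  have hcb : ContinuousWithinAt (fun t => φ t j) (Icc a b) b := hc b ⟨hab.le, le_rfl⟩
  have hev1 : ∀ᶠ t in nhdsWithin b (Icc a b), Δ < (φ t j).τ k :=
    Filter.Tendsto.eventually_const_lt hτ
      (show ContinuousWithinAt (fun t => (φ t j).τ k) (Icc a b) b by fun_prop)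
  have hev2 : ∀ᶠ t in nhdsWithin b (Icc a b), K * ‖(φ t j).xh‖ < |(φ t j).err C i| := by
    have hcw : ContinuousWithinAt (fun t => |(φ t j).err C i| - K * ‖(φ t j).xh‖) (Icc a b) b := by
      have h1 : ContinuousWithinAt (fun t => (φ t j).err C i) (Icc a b) b := by fun_prop
      have h2 : ContinuousWithinAt (fun t => ‖(φ t j).xh‖) (Icc a b) b := by fun_prop
      exact h1.abs.sub (h2.const_mul K)
    filter_upwards [Filter.Tendsto.eventually_const_lt (u := 0) (sub_pos.2 hlt) hcw] with t ht
    exact sub_pos.1 ht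
  rw [nhdsWithin_Icc_eq_nhdsLE hab] at hev1 hev2
  obtain ⟨a', ha', hev⟩ := (mem_nhdsLE_iff_exists_Ioc_subset' hab).1 (hev1.and hev2)
  have hsub : ∀ t ∈ Ioo (max a a') b, t ∈ Ioo a b ∧ t ∈ Ioc a' b := fun t ht =>
    ⟨⟨(le_max_left _ _).trans_lt ht.1, ht.2⟩, (le_max_right _ _).trans_lt ht.1, ht.2.le⟩
  have hmax : max a a' < b := max_lt hab ha'
  have hx0 : ∀ t ∈ Ioo (max a a') b, (φ t j).xh = 0 := by
    intro t ht
    obtain ⟨h1, h2⟩ := hsub t ht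
    by_contra hne
    have h3 :=
      ((hH.flow_closed hV.isClosed hs hab ha hb (Ioo_subset_Icc_self h1)).2 k).resolve_right
      (not_le.2 (hev h2).1)
    exact absurd (hV.err_le k _ _ h3 hne i hi) (not_le.2 (hev h2).2)
  have hrate : ∀ t ∈ Ioo (max a a') b,
      observerRate A B C L (φ t j).xh ((φ t j).err C) (φ t j).obs = 0 := by
    intro t ht
    have h1 := hH.hasDerivAt_xh hs hab ha hb (hsub t ht).1
    refine h1.unique ((hasDerivAt_const t (0 : Vec n)).congr_of_eventuallyEq ?_)
    filter_upwards [Ioo_mem_nhds ht.1 ht.2] with s hs using hx0 s hs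
  -- Since x̂ = 0 on an interval, its velocity Be + LCw vanishes too, and with it e' = −Cx̂'. So Be,
  -- and therefore LCw, is constant there.
  have hbal : ∀ t ∈ Ioo (max a a') b, mul B ((φ t j).err C) + mul (L * C) (φ t j).obs = 0 := by
    intro t ht
    have := hrate t ht
    rwa [observerRate, hx0 t ht, mul_zero_apply, zero_add] at this
  let M : Module.End ℝ (Vec n) := Matrix.toEuclideanLin (A + L * C)
  let N : Vec n →ₗ[ℝ] Vec n := Matrix.toEuclideanLin (L * C)
  have hderiv : ∀ k : ℕ, ∀ t ∈ Ioo (max a a') b,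
      HasDerivAt (fun s => N ((M ^ k) (φ s j).obs)) (N ((M ^ (k + 1)) (φ t j).obs)) t := by
    intro k t ht
    have h1 := (LinearMap.toContinuousLinearMap (N ∘ₗ (M ^ k))).hasFDerivAt.comp_hasDerivAt t
      (hH.hasDerivAt_obs hs hab ha hb (hsub t ht).1)
    rw [pow_succ]
    exact h1
  -- Differentiating the constant LCw repeatedly, with w' = Mw, kills LC·M^(k+1)·w for every k.
  -- Injectivity of M brings this down to LCw = 0, hence Be = 0 and e = 0, contrary to the strict
  -- inequality.
  have hpow : ∀ k : ℕ, ∀ t ∈ Ioo (max a a') b, N ((M ^ (k + 1)) (φ t j).obs) = 0 := by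
    intro k
    induction k with
    | zero =>
      intro t ht
      refine (hderiv 0 t ht).unique ?_
      have h1 := hasDerivAt_mul B (hH.hasDerivAt_err hs hab ha hb (hsub t ht).1)
      rw [hrate t ht, mul_zero_apply, neg_zero, mul_zero_apply] at h1
      have h2 := h1.neg
      rw [neg_zero] at h2
      refine h2.congr_of_eventuallyEq ?_
      filter_upwards [Ioo_mem_nhds ht.1 ht.2] with s hs
      exact eq_neg_of_add_eq_zero_right (hbal s hs)
    | succ k ih =>
      intro t ht
      refine (hderiv (k + 1) t ht).unique
        ((hasDerivAt_const t (0 : Vec n)).congr_of_eventuallyEq ?_)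
      filter_upwards [Ioo_mem_nhds ht.1 ht.2] with s hs using ih s hs
  obtain ⟨t, ht⟩ := nonempty_Ioo.2 hmax
  have hMinj : Function.Injective M :=
    (injective_iff_map_eq_zero M).2 fun z hz => hL.mul_injective hz
  have hN : N (φ t j).obs = 0 := apply_eq_zero_of_pow_succ hMinj fun k => hpow k t ht
  have hbt := hbal t ht
  have hN' : mul (L * C) (φ t j).obs = 0 := hN
  rw [hN', add_zero] at hbt
  have h3 := (hev (hsub t ht).2).2
  rw [hB _ hbt] at h3
  have : 0 ≤ K * ‖(φ t j).xh‖ := mul_nonneg hV.K_pos.le (norm_nonneg _)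
  simp at h3
  linarith

theorem norm_err_jump_le (hH : LazyLoop A B C L σ 𝒞 𝒟 Δ ρ H) (hs : IsSolution H T φ) {t : ℝ} {j : ℕ}
    (h1 : (t, j) ∈ T) (h2 : (t, j + 1) ∈ T) : ‖(φ t (j + 1)).err C‖ ≤ ‖(φ t j).err C‖ := by
  obtain ⟨-, -, S, -, -, -, hS3, hS4⟩ := hH.jump_eq hs h1 h2
  refine le_of_sq_le_sq ?_ (norm_nonneg _)
  rw [EuclideanSpace.norm_sq_eq, EuclideanSpace.norm_sq_eq]
  refine Finset.sum_le_sum fun i _ => ?_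
  by_cases hi : σ i ∈ S
  · rw [hS3 i hi, norm_zero, zero_pow two_ne_zero]; exact sq_nonneg _
  · rw [hS4 i hi]

/-- Exponential growth bound. -/
theorem exists_growth (A : Matrix (Fin n) (Fin n) ℝ) (B : Matrix (Fin n) (Fin q) ℝ)
    (C : Matrix (Fin q) (Fin n) ℝ) (L : Matrix (Fin n) (Fin q) ℝ) : ∃ Γ > 0,
    ∀ {σ : Fin q → Fin p} {𝒞 𝒟 : Fin p → Set (Vec n × Vec q)} {Δ ρ : ℝ}
      {H : HybridSystem (State n q p)} {T : Set (ℝ × ℕ)} {φ : ℝ → ℕ → State n q p},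
      LazyLoop A B C L σ 𝒞 𝒟 Δ ρ H → IsSolution H T φ → ∀ t j, (t, j) ∈ T →
      ‖(φ t j).xh‖ ^ 2 + ‖(φ t j).err C‖ ^ 2 + ‖(φ t j).obs‖ ^ 2 ≤ Real.exp (Γ * t) *
        (‖(φ 0 0).xh‖ ^ 2 + ‖(φ 0 0).err C‖ ^ 2 + ‖(φ 0 0).obs‖ ^ 2) := by
  obtain ⟨κ, hκ, hκ'⟩ := exists_observerRate_bound A B C L
  obtain ⟨μ, hμ, hμ'⟩ :=
    (LinearMap.toContinuousLinearMap (Matrix.toEuclideanLin (A + L * C))).bound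
  -- (|x| + |e|)(|x| + |e| + |w|) is at most three times the sum of squares, and the derivative of a
  -- square doubles it; μ accounts for the w-equation.
  refine ⟨6 * κ + 2 * μ, by positivity, ?_⟩
  intro σ 𝒞 𝒟 Δ ρ H T φ hH hs t j ht
  refine hs.arc.1.induction (P := fun t j =>
    ‖(φ t j).xh‖ ^ 2 + ‖(φ t j).err C‖ ^ 2 + ‖(φ t j).obs‖ ^ 2 ≤ Real.exp ((6 * κ + 2 * μ) * t) *
        (‖(φ 0 0).xh‖ ^ 2 + ‖(φ 0 0).err C‖ ^ 2 + ‖(φ 0 0).obs‖ ^ 2)) ?_ ?_ ?_ ht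
  · simp
  · intro t j h1 h2 ih
    rw [(hH.jump_eq hs h1 h2).2.1, hH.jump_obs hs h1 h2]
    have := pow_le_pow_left₀ (norm_nonneg _) (hH.norm_err_jump_le hs h1 h2) 2
    linarith
  · intro a b j hab ha hb ih
    have hc := hs.continuousOn hab.le ha hb
    have := le_exp_mul_of_hasDerivAt_le (c := -(6 * κ + 2 * μ))
      (f := fun t => ‖(φ t j).xh‖ ^ 2 + ‖(φ t j).err C‖ ^ 2 + ‖(φ t j).obs‖ ^ 2)
      (f' := fun t => 2 * inner ℝ (φ t j).xh
          (observerRate A B C L (φ t j).xh ((φ t j).err C) (φ t j).obs) +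
        2 * inner ℝ ((φ t j).err C)
          (-mul C (observerRate A B C L (φ t j).xh ((φ t j).err C) (φ t j).obs)) +
        2 * inner ℝ (φ t j).obs (mul (A + L * C) (φ t j).obs)) hab.le (by fun_prop)
      (fun t ht => ((hH.hasDerivAt_xh hs hab ha hb ht).norm_sq.add
        (hH.hasDerivAt_err hs hab ha hb ht).norm_sq).add
        (hH.hasDerivAt_obs hs hab ha hb ht).norm_sq) fun t ht => by
        set x := (φ t j).xh
        set e := (φ t j).err C
        set w := (φ t j).obs
        have h1 := (real_inner_le_norm x (observerRate A B C L x e w)).trans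
          (mul_le_mul_of_nonneg_left (hκ' x e w).1 (norm_nonneg _))
        have h2 := (real_inner_le_norm e (-mul C (observerRate A B C L x e w))).trans
          (mul_le_mul_of_nonneg_left ((norm_neg _).trans_le (hκ' x e w).2) (norm_nonneg _))
        have h3 := (real_inner_le_norm w (mul (A + L * C) w)).trans
          (mul_le_mul_of_nonneg_left (hμ' w) (norm_nonneg _))
        have h4 : (‖x‖ + ‖e‖) * (‖x‖ + ‖e‖ + ‖w‖) ≤ 3 * (‖x‖ ^ 2 + ‖e‖ ^ 2 + ‖w‖ ^ 2) := by
          nlinarith [sq_nonneg (‖x‖ - ‖e‖), sq_nonneg (‖x‖ - ‖w‖), sq_nonneg (‖e‖ - ‖w‖)]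
        have h5 := mul_le_mul_of_nonneg_left h4 hκ.le
        have h6 : 0 ≤ μ * (‖x‖ ^ 2 + ‖e‖ ^ 2) := by positivity
        linarith
    refine this.trans ((mul_le_mul_of_nonneg_left ih (Real.exp_pos _).le).trans_eq ?_)
    rw [← mul_assoc, ← Real.exp_add]
    ring_nf

/-- The observation error is an autonomous Hurwitz system that jumps leave alone. Square roots of
the quadratic Lyapunov bounds give the constants, which depend on A + LC only and not on the policy,
Δ or ρ. -/
theorem exists_obs_decay (B : Matrix (Fin n) (Fin q) ℝ) (hL : IsHurwitz (A + L * C)) :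
    ∃ K > 0, ∃ l > 0,
    ∀ {σ : Fin q → Fin p} {𝒞 𝒟 : Fin p → Set (Vec n × Vec q)} {Δ ρ : ℝ}
      {H : HybridSystem (State n q p)} {T : Set (ℝ × ℕ)} {φ : ℝ → ℕ → State n q p},
      LazyLoop A B C L σ 𝒞 𝒟 Δ ρ H → IsSolution H T φ → ∀ t j, (t, j) ∈ T →
      ‖(φ t j).obs‖ ≤ K * ‖(φ 0 0).obs‖ * Real.exp (-l * t) := by
  obtain ⟨W, K, c, hK, hc, hW, hd⟩ := hL.exists_lyapunov
  refine ⟨√K, by positivity, c / 2, by positivity, ?_⟩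
  intro σ 𝒞 𝒟 Δ ρ H T φ hH hs t j ht
  have key : W (φ t j).obs ≤ Real.exp (-c * t) * W (φ 0 0).obs := by
    refine hs.arc.1.induction (P := fun t j => W (φ t j).obs ≤ Real.exp (-c * t) * W (φ 0 0).obs)
      ?_ ?_ ?_ ht
    · simp
    · intro t j h1 h2 ih
      rwa [hH.jump_obs hs h1 h2]
    · intro a b j hab ha hb ih
      have hcont := hs.continuousOn hab.le ha hb
      refine (hd (fun t => (φ t j).obs) a b hab.le (by fun_prop)
        fun t ht => hH.hasDerivAt_obs hs hab ha hb ht).trans ?_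
      refine (mul_le_mul_of_nonneg_left ih (Real.exp_pos _).le).trans_eq ?_
      rw [← mul_assoc, ← Real.exp_add]
      ring_nf
  refine le_of_sq_le_sq ?_ (by positivity)
  have e : (√K * ‖(φ 0 0).obs‖ * Real.exp (-(c / 2) * t)) ^ 2 =
      Real.exp (-c * t) * (K * ‖(φ 0 0).obs‖ ^ 2) := by
    rw [mul_pow, mul_pow, Real.sq_sqrt hK.le, ← Real.exp_nat_mul]
    push_cast
    ring_nf
  rw [e]
  exact ((hW _).1.trans key).trans (mul_le_mul_of_nonneg_left (hW _).2 (Real.exp_pos _).le)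

/-- A decay bound on `(x̂, e)` implies another one, whose dependence on the given bound is
proportional to `Δ`. -/
theorem decay_bound_improve (hH : LazyLoop A B C L σ 𝒞 𝒟 Δ ρ H)
    (hV : LazyLyapunov A B C L σ 𝒞 P₁ P₂ K c) (hL : IsHurwitz (A + L * C)) (hs : IsSolution H T φ)
    (hΔ : 0 < Δ) (hΔρ : Δ < ρ) {κ l Y h T₀ K₁ : ℝ} (hκ : 0 < κ)
    (hκ' : ∀ x e w, ‖mul C (observerRate A B C L x e w)‖ ≤ κ * (‖x‖ + ‖e‖ + ‖w‖))
    (hl : 0 < l) (hlc : 4 * l ≤ c) (hY : 0 ≤ Y) (hh : 0 ≤ h) (hK₁ : 0 ≤ K₁)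
    (hKK₁ : K ^ 2 * (1 + 2 / c) ≤ K₁ ^ 2)
    (hobs : ∀ t j, (t, j) ∈ T → ‖(φ t j).obs‖ ≤ h * Real.exp (-l * t))
    (hbd : ∀ t j, (t, j) ∈ T → t ≤ T₀ →
      ‖(φ t j).xh‖ + ‖(φ t j).err C‖ ≤ Y * Real.exp (-l * t))
    {R : ℝ} (hR : R = (κ * (Y + h) * Δ + ‖(φ 0 0).err C‖) * Real.exp (l * Δ))
    {t : ℝ} {j : ℕ} (ht : (t, j) ∈ T) (htT : t ≤ T₀) :
    ‖(φ t j).xh‖ + ‖(φ t j).err C‖ ≤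
      (q * R + (1 + q * K) * (K₁ * (‖(φ 0 0).xh‖ + ‖(φ 0 0).err C‖ + R + h))) *
        Real.exp (-l * t) := by
  have hρ : 0 < ρ := hΔ.trans hΔρ
  have hK := hV.K_pos
  set x₀ := ‖(φ 0 0).xh‖ with hx₀
  set e₀ := ‖(φ 0 0).err C‖ with he₀
  have hx₀' : 0 ≤ x₀ := norm_nonneg _
  have he₀' : 0 ≤ e₀ := norm_nonneg _
  have hR0 : 0 ≤ R := by rw [hR]; positivity
  -- A timer at most Δ, and Δ < ρ, place the last transmission within Δ of t. Shifting the weight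
  -- from s to t costs the factor exp(lΔ) in R.
  have hsmall : ∀ t j, (t, j) ∈ T → t ≤ T₀ → ∀ k, (φ t j).τ k ≤ Δ → ∀ i, σ i = k →
      |(φ t j).err C i| ≤ R * Real.exp (-l * t) := by
    intro t j ht htT k hk i hi
    obtain ⟨s, hs1, hs2, hs3⟩ := hH.exists_last_transmission hV.isClosed hρ hs
      (D := κ * (Y + h)) (by positivity) hl.le (fun t j ht htT => by
        refine (hκ' _ _ _).trans ?_
        have h1 := hobs t j ht
        have h2 := hbd t j ht htT
        rw [mul_assoc]
        exact mul_le_mul_of_nonneg_left (by linarith) hκ.le) ht htT k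
    have hts : t - s ≤ Δ := by
      by_contra hlt
      exact absurd (hs2.trans hk) (not_le.2 (lt_min (not_le.1 hlt) hΔρ))
    refine (hs3 i hi).trans ?_
    rw [hR, mul_assoc _ (Real.exp _), ← Real.exp_add]
    gcongr
    nlinarith
  -- The form does not control e when P₂ = 0, so e is bounded separately: at the end of a flow
  -- interval either x̂ dominates or the sample is recent, a jump only resets entries, and initially
  -- e₀ ≤ R.
  have herr : ∀ t j, (t, j) ∈ T → t ≤ T₀ → ∀ i,
      |(φ t j).err C i| ≤ K * ‖(φ t j).xh‖ + R * Real.exp (-l * t) := by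
    intro t j ht
    refine hs.arc.1.induction (P := fun t j => t ≤ T₀ → ∀ i,
      |(φ t j).err C i| ≤ K * ‖(φ t j).xh‖ + R * Real.exp (-l * t)) ?_ ?_ ?_ ht
    · intro _ i
      have h1 := PiLp.norm_apply_le ((φ 0 0).err C) i
      rw [Real.norm_eq_abs] at h1
      have h2 : e₀ ≤ R := by
        have h3 : 1 ≤ Real.exp (l * Δ) := Real.one_le_exp (by positivity)
        have h4 : 0 ≤ κ * (Y + h) * Δ := by positivity
        rw [hR]
        nlinarith
      have h3 : 0 ≤ K * ‖(φ 0 0).xh‖ := by positivity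
      simp only [mul_zero, Real.exp_zero, mul_one]
      linarith
    · intro t j h1 h2 ih htT i
      obtain ⟨-, hx, S, -, -, -, hS3, hS4⟩ := hH.jump_eq hs h1 h2
      rw [hx]
      by_cases hi : σ i ∈ S
      · rw [hS3 i hi, abs_zero]; positivity
      · rw [hS4 i hi]; exact ih htT i
    · intro a b j hab ha hb _ hbT i
      rcases hH.err_le_or hV hL hs hab ha hb (σ i) with h1 | h1
      · have : 0 ≤ R * Real.exp (-l * b) := by positivity
        linarith [h1 i rfl]
      · have : 0 ≤ K * ‖(φ b j).xh‖ := by positivity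
        linarith [hsmall b j hb hbT _ h1 i rfl]
  -- The form is quadratic, so it is compared at rate 2l; the stronger 4l ≤ c later gives c − 2l ≥
  -- c/2 and a constant free of l.
  have hc2 : 2 * l < c := by linarith
  set v₀ := K * (x₀ ^ 2 + e₀ ^ 2) with hv₀
  set K' := K * (R ^ 2 + h ^ 2) with hK'
  have hQ : 0 ≤ K' / (c - 2 * l) := div_nonneg (by positivity) (by linarith)
  have hform : blockForm P₁ P₂ (φ t j).xh ((φ t j).err C) ≤
      (v₀ + K' / (c - 2 * l)) * Real.exp (-(2 * l) * t) := by
    revert htT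
    refine hs.arc.1.induction (P := fun t j => t ≤ T₀ →
      blockForm P₁ P₂ (φ t j).xh ((φ t j).err C) ≤
        (v₀ + K' / (c - 2 * l)) * Real.exp (-(2 * l) * t)) ?_ ?_ ?_ ht
    · intro _
      have := hV.form_le (φ 0 0).xh ((φ 0 0).err C)
      simp only [mul_zero, Real.exp_zero, mul_one]
      linarith
    · intro t j h1 h2 ih htT
      obtain ⟨-, hx, S, hSn, -, -, hS3, hS4⟩ := hH.jump_eq hs h1 h2
      rw [hx]
      exact (hV.jump _ _ _ S hSn hS3 hS4).trans (ih htT)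
    · intro a b j hab ha hb ih hbT
      have hcont := hs.continuousOn hab.le ha hb
      refine le_exp_mul_add_of_hasDerivAt_le
        (f := fun t => blockForm P₁ P₂ (φ t j).xh ((φ t j).err C))
        (f' := fun t => inner ℝ (mul P₁ (φ t j).xh)
            (observerRate A B C L (φ t j).xh ((φ t j).err C) (φ t j).obs) +
          inner ℝ (mul P₂ ((φ t j).err C))
            (-mul C (observerRate A B C L (φ t j).xh ((φ t j).err C) (φ t j).obs)))
        hab.le (by unfold blockForm; fun_prop) (fun t ht => ?_) hc2 (fun t ht => ?_)
        (by positivity) (ih (hab.le.trans hbT))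
      · have d1 := hH.hasDerivAt_xh hs hab ha hb ht
        have d2 := hH.hasDerivAt_err hs hab ha hb ht
        have d3 := ((d1.inner ℝ (hasDerivAt_mul P₁ d1)).add
          (d2.inner ℝ (hasDerivAt_mul P₂ d2))).const_mul (1 / 2)
        refine d3.congr_deriv ?_
        rw [hV.symm₁, hV.symm₂, real_inner_comm (mul P₁ (φ t j).xh),
          real_inner_comm (mul P₂ ((φ t j).err C))]
        ring
      · have htm := hs.arc.1.ordConnected ha hb (Ioo_subset_Icc_self ht)
        have hcl := (hH.flow_closed hV.isClosed hs hab ha hb (Ioo_subset_Icc_self ht)).2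
        refine (hV.decrease _ _ _ (R * Real.exp (-l * t)) (by positivity) fun k =>
          (hcl k).imp_right fun hk => hsmall t j htm (ht.2.le.trans hbT) k hk).trans ?_
        have h1 := pow_le_pow_left₀ (norm_nonneg _) (hobs t j htm) 2
        have h2 : Real.exp (-(2 * l) * t) = Real.exp (-l * t) ^ 2 := by
          rw [← Real.exp_nat_mul]; push_cast; ring_nf
        rw [hK', h2]
        have h3 := mul_le_mul_of_nonneg_left h1 hK.le
        linarith
  have hxh : ‖(φ t j).xh‖ ≤ K₁ * (x₀ + e₀ + R + h) * Real.exp (-l * t) := by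
    refine le_of_sq_le_sq ?_ (by positivity)
    have h1 := (hV.le_form (φ t j).xh ((φ t j).err C)).trans
      (mul_le_mul_of_nonneg_left hform hK.le)
    refine h1.trans ?_
    have h2 : Real.exp (-(2 * l) * t) = Real.exp (-l * t) ^ 2 := by
      rw [← Real.exp_nat_mul]; push_cast; ring_nf
    rw [h2, mul_pow, ← mul_assoc]
    refine mul_le_mul_of_nonneg_right ?_ (sq_nonneg _)
    have h3 : K' / (c - 2 * l) ≤ K' * (2 / c) := by
      rw [div_eq_mul_inv]
      refine mul_le_mul_of_nonneg_left ?_ (by positivity)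
      rw [inv_le_comm₀ (by linarith) (by have := hV.c_pos; positivity), inv_div]
      linarith
    have hc0 := hV.c_pos
    have h4 : K * (v₀ + K' / (c - 2 * l)) ≤
        K ^ 2 * (1 + 2 / c) * (x₀ ^ 2 + e₀ ^ 2 + R ^ 2 + h ^ 2) := by
      have h5 := mul_le_mul_of_nonneg_left h3 hK.le
      have h6 : 0 ≤ K ^ 2 * (2 / c) * (x₀ ^ 2 + e₀ ^ 2) := by positivity
      have h7 : 0 ≤ K ^ 2 * (R ^ 2 + h ^ 2) := by positivity
      rw [hv₀, mul_add]
      rw [hK'] at h5 ⊢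
      linarith
    refine h4.trans ?_
    rw [mul_pow]
    refine mul_le_mul hKK₁ ?_ (by positivity) (by positivity)
    have : 0 ≤ x₀ * e₀ + x₀ * R + x₀ * h + e₀ * R + e₀ * h + R * h := by positivity
    linarith
  have hsum : ‖(φ t j).err C‖ ≤ q * (K * ‖(φ t j).xh‖ + R * Real.exp (-l * t)) := by
    refine (norm_le_sum_abs _).trans ((Finset.sum_le_sum fun i _ => herr t j ht htT i).trans_eq ?_)
    rw [Finset.sum_const, Finset.card_univ, Fintype.card_fin, nsmul_eq_mul]
  have h1 := mul_le_mul_of_nonneg_left hxh (show 0 ≤ 1 + q * K by positivity)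
  linarith

/-- Small gain: inserting R into the bound for Y gives Y the coefficient GEκΔ ≤ 1/2 on the right,
which moves to the left at the price of the factor 2. -/
theorem bound_of_self_bound {G E κ h x₀ e₀ Y R Δ : ℝ} (hG : 0 ≤ G) (hE : 0 ≤ E) (hκ : 0 ≤ κ)
    (hh : 0 ≤ h) (hx₀ : 0 ≤ x₀) (hY : 0 ≤ Y) (hΔ : Δ ≤ 1)
    (hΔ' : G * E * κ * Δ ≤ 1 / 2) (hR : R ≤ (κ * (Y + h) * Δ + e₀) * E)
    (hYG : Y ≤ G * (x₀ + e₀ + R + h)) :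
    Y ≤ 2 * G * (1 + E) * (x₀ + e₀) + 2 * G * (E * κ + 1) * h := by
  have h1 := mul_le_mul_of_nonneg_left hR hG
  have h2 := mul_le_mul_of_nonneg_right hΔ' hY
  have h3 : G * E * κ * h * Δ ≤ G * E * κ * h := mul_le_of_le_one_right (by positivity) hΔ
  have h4 : 0 ≤ G * E * x₀ := by positivity
  linarith

theorem assemble_decay {G E κ k x₀ e₀ w₀ Y X a b : ℝ} (hG : 0 ≤ G) (hE : 0 ≤ E) (hκ : 0 ≤ κ)
    (hk : 0 ≤ k) (hx₀ : 0 ≤ x₀) (he₀ : 0 ≤ e₀) (hw₀ : 0 ≤ w₀) (hX : 0 ≤ X)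
    (hY : Y ≤ 2 * G * (1 + E) * (x₀ + e₀) + 2 * G * (E * κ + 1) * (k * w₀)) (ha : a ≤ Y * X)
    (hb : b ≤ k * w₀ * X) :
    a + b ≤ (2 * G * (1 + E) + 2 * G * (E * κ + 1) * k + k) * X * (x₀ + e₀ + w₀) := by
  have h3 := mul_le_mul_of_nonneg_right hY hX
  have h4 : 0 ≤ 2 * G * (1 + E) * w₀ * X := by positivity
  have h5 : 0 ≤ (2 * G * (E * κ + 1) * k + k) * (x₀ + e₀) * X := by positivity
  linarith

set_option maxHeartbeats 1000000 in
/-- Exponential decay, with respect to ordinary time, of `x̂`, of the transmission error and of the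
observation error. -/
theorem exists_decay (hV : LazyLyapunov A B C L σ 𝒞 P₁ P₂ K c) (hL : IsHurwitz (A + L * C)) :
    ∃ ρ₀ > 0, ∃ l > 0, ∃ G > 0, ∀ {𝒟 : Fin p → Set (Vec n × Vec q)} {Δ ρ : ℝ}
      {H : HybridSystem (State n q p)} {T : Set (ℝ × ℕ)} {φ : ℝ → ℕ → State n q p},
      0 < Δ → Δ < ρ → ρ ≤ ρ₀ → LazyLoop A B C L σ 𝒞 𝒟 Δ ρ H → IsSolution H T φ →
      ∀ t j, (t, j) ∈ T → ‖(φ t j).xh‖ + ‖(φ t j).err C‖ + ‖(φ t j).obs‖ ≤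
        G * Real.exp (-l * t) * (‖(φ 0 0).xh‖ + ‖(φ 0 0).err C‖ + ‖(φ 0 0).obs‖) := by
  obtain ⟨κ, hκ, hκ'⟩ := exists_observerRate_bound A B C L
  obtain ⟨Kη, hKη, lη, hlη, hη⟩ := exists_obs_decay (p := p) B hL
  obtain ⟨Γ, hΓ, hgrow⟩ := exists_growth (p := p) A B C L
  have hc := hV.c_pos
  have hK := hV.K_pos
  -- The slower of the observer rate and a quarter of the Lyapunov rate.
  set l := min lη (c / 4) with hl
  have hl0 : 0 < l := lt_min hlη (by positivity)
  have hlc : 4 * l ≤ c := by linarith [min_le_right lη (c / 4)]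
  set K₁ := K * (1 + 2 / c) with hK₁
  have hK₁0 : 0 ≤ K₁ := by positivity
  have hKK₁ : K ^ 2 * (1 + 2 / c) ≤ K₁ ^ 2 := by
    rw [hK₁, mul_pow, sq (1 + 2 / c)]
    have : 1 ≤ 1 + 2 / c := by linarith [div_pos two_pos hc]
    refine mul_le_mul_of_nonneg_left ?_ (sq_nonneg K)
    nlinarith
  set G := (q : ℝ) + (1 + q * K) * K₁ with hG
  have hG0 : 0 ≤ G := by positivity
  set E := Real.exp l with hE
  have hE0 : 0 < E := Real.exp_pos _
  -- This ρ₀ forces Δ ≤ 1, so that exp(lΔ) ≤ E, and loop gain GEκΔ ≤ 1/2.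
  refine ⟨min 1 (1 / (2 * (G * E * κ + 1))), lt_min one_pos (by positivity), l, hl0,
    2 * G * (1 + E) + 2 * G * (E * κ + 1) * Kη + Kη, by positivity, ?_⟩
  intro 𝒟 Δ ρ H T φ hΔ hΔρ hρ hH hs t₀ j₀ ht₀
  have hΔ1 : Δ ≤ 1 := (hΔρ.le.trans hρ).trans (min_le_left _ _)
  have hΔ2 : G * E * κ * Δ ≤ 1 / 2 := by
    have h1 : Δ ≤ 1 / (2 * (G * E * κ + 1)) := (hΔρ.le.trans hρ).trans (min_le_right _ _)
    rw [le_div_iff₀ (by positivity)] at h1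
    linarith
  set x₀ := ‖(φ 0 0).xh‖ with hx₀
  set e₀ := ‖(φ 0 0).err C‖ with he₀
  set w₀ := ‖(φ 0 0).obs‖ with hw₀
  have hx₀' : 0 ≤ x₀ := norm_nonneg _
  have he₀' : 0 ≤ e₀ := norm_nonneg _
  have hw₀' : 0 ≤ w₀ := norm_nonneg _
  set h := Kη * w₀ with hh
  have hh0 : 0 ≤ h := by positivity
  have hobs : ∀ t j, (t, j) ∈ T → ‖(φ t j).obs‖ ≤ h * Real.exp (-l * t) := by
    intro t j ht
    refine (hη hH hs t j ht).trans ?_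
    have := hs.arc.1.nonneg ht
    have := min_le_left lη (c / 4)
    gcongr
  -- Y is the supremum up to t₀ of |x̂| + |e| weighted by exp(lt). It must be known to be finite
  -- before it can be absorbed, which is the role of `exists_growth`.
  let 𝒮 : Set ℝ := {y | ∃ t j, (t, j) ∈ T ∧ t ≤ t₀ ∧
    y = (‖(φ t j).xh‖ + ‖(φ t j).err C‖) * Real.exp (l * t)}
  have hexp : ∀ t, Real.exp (l * t) * Real.exp (-l * t) = 1 := fun t => by
    rw [← Real.exp_add]; simp
  have hbdd : BddAbove 𝒮 := by
    set g := Real.exp (Γ * t₀) * (x₀ ^ 2 + e₀ ^ 2 + w₀ ^ 2) with hg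
    have hg0 : 0 ≤ g := by positivity
    refine ⟨2 * √g * Real.exp (l * t₀), ?_⟩
    rintro _ ⟨t, j, ht, htt, rfl⟩
    have h1 := hgrow hH hs t j ht
    have h2 : Real.exp (Γ * t) * (x₀ ^ 2 + e₀ ^ 2 + w₀ ^ 2) ≤ g := by
      rw [hg]; gcongr
    have h3 : ‖(φ t j).xh‖ ≤ √g :=
      Real.le_sqrt_of_sq_le (by nlinarith [sq_nonneg ‖(φ t j).err C‖, sq_nonneg ‖(φ t j).obs‖])
    have h4 : ‖(φ t j).err C‖ ≤ √g :=
      Real.le_sqrt_of_sq_le (by nlinarith [sq_nonneg ‖(φ t j).xh‖, sq_nonneg ‖(φ t j).obs‖])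
    gcongr
    linarith
  have hne : 𝒮.Nonempty := ⟨_, t₀, j₀, ht₀, le_rfl, rfl⟩
  set Y := sSup 𝒮 with hY
  have hYle : ∀ t j, (t, j) ∈ T → t ≤ t₀ →
      ‖(φ t j).xh‖ + ‖(φ t j).err C‖ ≤ Y * Real.exp (-l * t) := by
    intro t j ht htt
    have h1 := le_csSup hbdd (show _ ∈ 𝒮 from ⟨t, j, ht, htt, rfl⟩)
    have h2 := mul_le_mul_of_nonneg_right h1 (Real.exp_pos (-l * t)).le
    rwa [mul_assoc, hexp, mul_one] at h2
  have hY0 : 0 ≤ Y := by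
    have := le_csSup hbdd (show _ ∈ 𝒮 from ⟨t₀, j₀, ht₀, le_rfl, rfl⟩)
    exact le_trans (by positivity) this
  set R := (κ * (Y + h) * Δ + e₀) * Real.exp (l * Δ) with hR
  have hRE : R ≤ (κ * (Y + h) * Δ + e₀) * E := by
    rw [hR, hE]
    exact mul_le_mul_of_nonneg_left
      (Real.exp_le_exp.2 (mul_le_of_le_one_right hl0.le hΔ1)) (by positivity)
  have hR0 : 0 ≤ R := by positivity
  set M := (q : ℝ) * R + (1 + q * K) * (K₁ * (x₀ + e₀ + R + h)) with hM
  -- The improved bound holds at every time up to t₀, hence for the supremum itself.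
  have hYM : Y ≤ M := by
    refine csSup_le hne ?_
    rintro _ ⟨t, j, ht, htt, rfl⟩
    have h1 := hH.decay_bound_improve hV hL hs hΔ hΔρ hκ (fun x e w => (hκ' x e w).2) hl0 hlc hY0
      hh0 hK₁0 hKK₁ hobs hYle hR ht htt
    have h2 := mul_le_mul_of_nonneg_right h1 (Real.exp_pos (l * t)).le
    rwa [mul_assoc, mul_comm (Real.exp (-l * t)), hexp, mul_one] at h2
  have hMG : M ≤ G * (x₀ + e₀ + R + h) := by
    have : 0 ≤ (q : ℝ) * (x₀ + e₀ + h) := by positivity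
    rw [hM, hG]
    linarith
  have hfin := bound_of_self_bound hG0 hE0.le hκ.le hh0 hx₀' hY0 hΔ1 hΔ2 hRE (hYM.trans hMG)
  exact assemble_decay hG0 hE0.le hκ.le hKη.le hx₀' he₀' hw₀' (Real.exp_pos _).le hfin
    (hYle t₀ j₀ ht₀ le_rfl) (hobs t₀ j₀ ht₀)

end LazyLoop

end Decay

/-! ### Extension of solutions -/

theorem lipschitzOnWith_Icc_glue {X : Type*} [PseudoMetricSpace X] {u v : ℝ → X} {a b d : ℝ}
    {K : NNReal} (hab : a ≤ b) (hbd : b ≤ d)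
    (hu : LipschitzOnWith K u (Icc a b)) (hv : LipschitzOnWith K v (Icc b d)) (huv : u b = v b) :
    LipschitzOnWith K (fun t => if t ≤ b then u t else v t) (Icc a d) := by
  set g := fun t => if t ≤ b then u t else v t with hg
  have hgu : ∀ t, t ≤ b → g t = u t := fun t ht => if_pos ht
  have hgv : ∀ t, b ≤ t → g t = v t := by
    intro t ht
    rcases ht.eq_or_lt with rfl | h
    · rw [hgu _ le_rfl, huv]
    · exact if_neg (not_le.2 h)
  have key : ∀ x y, x ∈ Icc a d → y ∈ Icc a d → x ≤ y → dist (g x) (g y) ≤ K * dist x y := by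
    intro x y hx hy hxy
    rcases le_total y b with hyb | hyb
    · rw [hgu x (hxy.trans hyb), hgu y hyb]
      exact hu.dist_le_mul x ⟨hx.1, hxy.trans hyb⟩ y ⟨hy.1, hyb⟩
    rcases le_total x b with hxb | hxb
    · refine (dist_triangle _ (g b) _).trans ?_
      rw [hgu x hxb, hgu b le_rfl, hgv y hyb]
      nth_rw 2 [huv]
      have h1 := hu.dist_le_mul x ⟨hx.1, hxb⟩ b ⟨hab, le_rfl⟩
      have h2 := hv.dist_le_mul b ⟨le_rfl, hbd⟩ y ⟨hyb, hy.2⟩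
      rw [Real.dist_eq, abs_of_nonpos (by linarith)] at h1 h2 ⊢
      linarith
    · rw [hgv x hxb, hgv y hyb]
      exact hv.dist_le_mul x ⟨hxb, hx.2⟩ y ⟨hyb, hy.2⟩
  refine LipschitzOnWith.of_dist_le_mul fun x hx y hy => ?_
  rcases le_total x y with h | h
  · exact key x y hx hy h
  · rw [dist_comm, dist_comm x]; exact key y x hy hx h

section Extension

variable {E : Type*} [NormedAddCommGroup E] [NormedSpace ℝ E]

/-- The hybrid time domain with jump times `t 1 ≤ … ≤ t J` and last interval `I`. -/
def finiteDomain (t : ℕ → ℝ) (J : ℕ) (I : Set ℝ) : Set (ℝ × ℕ) :=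
  (⋃ j ∈ Set.Iio J, Icc (t j) (t (j + 1)) ×ˢ {j}) ∪ I ×ˢ {J}

theorem mem_finiteDomain {t : ℕ → ℝ} {J : ℕ} {I : Set ℝ} {s : ℝ} {j : ℕ} :
    (s, j) ∈ finiteDomain t J I ↔ (j < J ∧ s ∈ Icc (t j) (t (j + 1))) ∨ (j = J ∧ s ∈ I) := by
  simp only [finiteDomain, mem_union, mem_iUnion, mem_prod, mem_singleton_iff, mem_Iio]
  constructor
  · rintro (⟨i, hi, h, rfl⟩ | ⟨h, rfl⟩)
    · exact Or.inl ⟨hi, h⟩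
    · exact Or.inr ⟨rfl, h⟩
  · rintro (⟨hi, h⟩ | ⟨rfl, h⟩)
    · exact Or.inl ⟨j, hi, h, rfl⟩
    · exact Or.inr ⟨h, rfl⟩

/-- A solution whose last flow interval can be prolonged is not maximal. -/
theorem not_isMaximalSolution_of_flow {H : HybridSystem E} {t : ℕ → ℝ} (ht0 : t 0 = 0)
    (htm : Monotone t) {J : ℕ} {I : Set ℝ} {φ : ℝ → ℕ → E}
    (hs : IsSolution H (finiteDomain t J I) φ) (hJ : t J ∈ I) {b : ℝ} (hI : I ⊂ Icc (t J) b)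
    {g : ℝ → E} (hg : ∀ s ∈ I, g s = φ s J) {K : NNReal} (hgL : LipschitzOnWith K g (Icc (t J) b))
    (hgd : ∀ᵐ s ∂(volume.restrict (Icc (t J) b)), ∃ v ∈ H.flowMap (g s), HasDerivAt g v s)
    (hgf : ∀ s ∈ Ico (t J) b, g s ∈ H.flowSet) :
    ¬ IsMaximalSolution H (finiteDomain t J I) φ := by
  rintro ⟨-, hmax⟩
  have hb : t J ≤ b := (hI.1 hJ).2
  -- Only the last flow interval is replaced; all earlier slices are kept.
  let φ' : ℝ → ℕ → E := fun s j => if j = J then g s else φ s j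
  have hφ' : ∀ s j, (s, j) ∈ finiteDomain t J I → φ' s j = φ s j := by
    intro s j h
    simp only [φ']
    split_ifs with hj
    · subst hj
      rcases mem_finiteDomain.1 h with h | h
      · exact absurd h.1 (lt_irrefl _)
      · exact hg s h.2
    · rfl
  have hsub : finiteDomain t J I ⊆ finiteDomain t J (Icc (t J) b) := by
    rintro ⟨s, j⟩ h
    rw [mem_finiteDomain] at h ⊢
    exact h.imp_right fun h => ⟨h.1, hI.1 h.2⟩
  have hslice : ∀ j, j ≠ J → timeSlice (finiteDomain t J (Icc (t J) b)) j =
      timeSlice (finiteDomain t J I) j := by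
    intro j hj
    ext s
    simp only [timeSlice, mem_ofPred_eq, mem_finiteDomain, hj, false_and, or_false]
  have hsliceJ : timeSlice (finiteDomain t J (Icc (t J) b)) J = Icc (t J) b := by
    ext s
    simp [timeSlice, mem_finiteDomain]
  have hφJ : (fun s => φ' s J) = g := by ext s; simp [φ']
  have hφj : ∀ j, j ≠ J → (fun s => φ' s j) = fun s => φ s j := by
    intro j hj; ext s; simp [φ', hj]
  refine hmax ⟨finiteDomain t J (Icc (t J) b), φ', ?_, ⟨hsub, fun h => ?_⟩, hφ'⟩
  · refine ⟨⟨?_, ?_⟩, ?_, ?_, ?_, ?_⟩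
    · refine ⟨fun m => if m ≤ J then t m else b, by simp [ht0], ?_, Or.inr ⟨J, Icc (t J) b, ?_, ?_⟩⟩
      · intro m k hmk
        dsimp only
        split_ifs with h1 h2 h2
        · exact htm hmk
        · exact (htm h1).trans hb
        · omega
        · exact le_rfl
      · simp
      · ext ⟨s, j⟩
        rw [mem_finiteDomain]
        have := mem_finiteDomain (t := fun m => if m ≤ J then t m else b) (J := J)
          (I := Icc (t J) b) (s := s) (j := j)
        rw [finiteDomain] at this
        rw [this]
        refine or_congr_left (and_congr_right fun hj => ?_)
        simp [hj.le, Nat.succ_le_of_lt hj]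
    · intro j x hx y hy
      rcases eq_or_ne j J with rfl | hj
      · rw [hsliceJ] at hx hy
        rw [hφJ]
        exact (hgL.mono (uIcc_subset_Icc hx hy)).absolutelyContinuousOnInterval
      · rw [hslice j hj] at hx hy
        rw [hφj j hj]
        exact hs.arc.2 j x hx y hy
    · rw [hφ' _ _ hs.arc.1.zero_mem]; exact hs.init
    · intro j s hsj hlater
      rcases eq_or_ne j J with rfl | hj
      · rw [hsliceJ] at hsj hlater
        obtain ⟨r, hr, hsr⟩ := hlater
        have := hgf s ⟨hsj.1, hsr.trans_le hr.2⟩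
        simpa [φ'] using this
      · rw [hslice j hj] at hsj hlater
        rw [hφ' _ _ hsj]
        exact hs.flow_mem j s hsj hlater
    · intro j
      rcases eq_or_ne j J with rfl | hj
      · rw [hsliceJ, hφJ]
        simpa [φ'] using hgd
      · rw [hslice j hj, hφj j hj]
        simpa [φ', hj] using hs.flow j
    · intro s j h1 h2
      -- Lengthening the last interval creates no new jump: a jump into index J can occur only at s
      -- = t J.
      have h1' : (s, j) ∈ finiteDomain t J I ∧ (s, j + 1) ∈ finiteDomain t J I := by
        rw [mem_finiteDomain] at h1 h2 ⊢
        rw [mem_finiteDomain]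
        rcases h2 with ⟨h2, h2'⟩ | ⟨h2, h2'⟩
        · refine ⟨Or.inl ⟨by omega, ?_⟩, Or.inl ⟨h2, h2'⟩⟩
          rcases h1 with h1 | h1
          · exact h1.2
          · omega
        · rcases h1 with h1 | h1
          · have : s = t J := le_antisymm (h2 ▸ h1.2.2) h2'.1
            exact ⟨Or.inl h1, Or.inr ⟨h2, this ▸ hJ⟩⟩
          · omega
      rw [hφ' _ _ h1'.1, hφ' _ _ h1'.2]
      exact hs.jump s j h1'.1 h1'.2
  · refine hI.2 fun s hsI => ?_
    have := h (show (s, J) ∈ _ from mem_finiteDomain.2 (Or.inr ⟨rfl, hsI⟩))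
    simpa [mem_finiteDomain] using this

/-- A solution which ends in the jump set is not maximal. -/
theorem not_isMaximalSolution_of_jump {H : HybridSystem E} {t : ℕ → ℝ} (ht0 : t 0 = 0)
    (htm : Monotone t) {J : ℕ} {φ : ℝ → ℕ → E}
    (hs : IsSolution H (finiteDomain t J (Icc (t J) (t (J + 1)))) φ)
    (hD : φ (t (J + 1)) J ∈ H.jumpSet) (hne : (H.jumpMap (φ (t (J + 1)) J)).Nonempty) :
    ¬ IsMaximalSolution H (finiteDomain t J (Icc (t J) (t (J + 1)))) φ := by
  rintro ⟨-, hmax⟩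
  obtain ⟨Y, hY⟩ := hne
  set b := t (J + 1) with hb
  set T := finiteDomain t J (Icc (t J) b) with hT
  let φ' : ℝ → ℕ → E := fun s j => if j = J + 1 then Y else φ s j
  have hmem : ∀ {s j}, (s, j) ∈ T → j ≤ J := by
    intro s j h
    rcases mem_finiteDomain.1 h with h | h <;> omega
  have hφ' : ∀ s j, (s, j) ∈ T → φ' s j = φ s j := by
    intro s j h
    have := hmem h
    simp only [φ', if_neg (show j ≠ J + 1 by omega)]
  -- The extension is one jump followed by the one-point interval {b}. There the flow and absolute
  -- continuity conditions are void, since {b} is a null set with no later time.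
  let T' := finiteDomain t (J + 1) {b}
  have hT' : ∀ {s j}, (s, j) ∈ T' ↔ (s, j) ∈ T ∨ (j = J + 1 ∧ s = b) := by
    intro s j
    simp only [T', hT, mem_finiteDomain, mem_singleton_iff]
    constructor
    · rintro (⟨h1, h2⟩ | h)
      · rcases Nat.lt_succ_iff_lt_or_eq.1 h1 with h | rfl
        · exact Or.inl (Or.inl ⟨h, h2⟩)
        · exact Or.inl (Or.inr ⟨rfl, h2⟩)
      · exact Or.inr h
    · rintro ((⟨h1, h2⟩ | ⟨rfl, h2⟩) | h)
      · exact Or.inl ⟨by omega, h2⟩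
      · exact Or.inl ⟨by omega, h2⟩
      · exact Or.inr h
  have hslice : ∀ j, j ≠ J + 1 → timeSlice T' j = timeSlice T j := by
    intro j hj
    ext s
    simp [timeSlice, hT', hj]
  have hsliceJ : timeSlice T' (J + 1) = {b} := by
    ext s
    simp only [timeSlice, mem_ofPred_eq, hT', mem_singleton_iff, true_and, or_iff_right_iff_imp]
    intro h
    have := hmem h
    omega
  have hφj : ∀ j, j ≠ J + 1 → (fun s => φ' s j) = fun s => φ s j := by
    intro j hj; ext s; simp [φ', hj]
  refine hmax ⟨T', φ', ?_, ⟨fun x hx => hT'.2 (Or.inl hx), fun h => ?_⟩, hφ'⟩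
  · refine ⟨⟨?_, ?_⟩, ?_, ?_, ?_, ?_⟩
    · refine ⟨fun m => if m ≤ J + 1 then t m else b, by simp [ht0], ?_,
        Or.inr ⟨J + 1, {b}, Or.inl ?_, ?_⟩⟩
      · intro m k hmk
        dsimp only
        split_ifs with h1 h2 h2
        · exact htm hmk
        · exact htm h1
        · omega
        · exact le_rfl
      · simp [hb]
      · ext ⟨s, j⟩
        have := mem_finiteDomain (t := fun m => if m ≤ J + 1 then t m else b) (J := J + 1)
          (I := {b}) (s := s) (j := j)
        rw [finiteDomain] at this
        rw [this]
        simp only [T', mem_finiteDomain]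
        refine or_congr_left (and_congr_right fun hj => ?_)
        simp [hj.le, Nat.le_of_lt_succ hj]
    · intro j x hx y hy
      rcases eq_or_ne j (J + 1) with rfl | hj
      · rw [hsliceJ, mem_singleton_iff] at hx hy
        subst hx hy
        refine LipschitzOnWith.absolutelyContinuousOnInterval (K := 0) ?_
        intro u hu v hv
        rw [uIcc_self, mem_singleton_iff] at hu hv
        simp [hu, hv]
      · rw [hslice j hj] at hx hy
        rw [hφj j hj]
        exact hs.arc.2 j x hx y hy
    · rw [hφ' _ _ hs.arc.1.zero_mem]; exact hs.init
    · intro j s hsj hlater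
      rcases eq_or_ne j (J + 1) with rfl | hj
      · rw [hsliceJ, mem_singleton_iff] at hsj
        obtain ⟨r, hr, hsr⟩ := hlater
        rw [hsliceJ, mem_singleton_iff] at hr
        exact absurd hsr (by rw [hsj, hr]; exact lt_irrefl _)
      · rw [hslice j hj] at hsj hlater
        rw [hφ' _ _ hsj]
        exact hs.flow_mem j s hsj hlater
    · intro j
      rcases eq_or_ne j (J + 1) with rfl | hj
      · rw [hsliceJ, Measure.restrict_singleton, Real.volume_singleton, zero_smul]
        exact ae_zero.symm ▸ Filter.eventually_bot
      · rw [hslice j hj, hφj j hj]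
        simpa [φ', hj] using hs.flow j
    · intro s j h1 h2
      rcases hT'.1 h2 with h2 | ⟨h2, rfl⟩
      · rcases hT'.1 h1 with h1 | ⟨h1, -⟩
        · rw [hφ' _ _ h1, hφ' _ _ h2]
          exact hs.jump s j h1 h2
        · have := hmem h2; omega
      · obtain rfl : j = J := by omega
        rcases hT'.1 h1 with h1 | ⟨h1, -⟩
        · rw [hφ' _ _ h1]
          refine ⟨hD, ?_⟩
          simpa [φ'] using hY
        · omega
  · have h1 := h (show (b, J + 1) ∈ T' from hT'.2 (Or.inr ⟨rfl, rfl⟩))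
    have := hmem h1
    omega

/-- A bounded-time solution of a Lipschitz differential equation extends to the right end of its
interval of definition. -/
theorem exists_lipschitz_extension [FiniteDimensional ℝ E] {f : E → E} {K : NNReal}
    (hf : LipschitzWith K f) {u : ℝ → E} {a b : ℝ} (hab : a < b) (hc : ContinuousOn u (Ico a b))
    (hd : ∀ t ∈ Ioo a b, HasDerivAt u (f (u t)) t) :
    ∃ (g : ℝ → E) (K' : NNReal), LipschitzWith K' g ∧ EqOn u g (Ico a b) := by
  set m := (a + b) / 2 with hm
  have ham : a < m := by rw [hm]; linarith
  have hmb : m < b := by rw [hm]; linarith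
  have hfn : ∀ x, ‖f x‖ ≤ K * ‖x‖ + ‖f 0‖ := by
    intro x
    have h1 := hf.norm_sub_le x 0
    rw [sub_zero] at h1
    have h2 := norm_sub_norm_le (f x) (f 0)
    linarith
  -- Compactness bounds the speed up to the midpoint and Grönwall's inequality beyond it. The split
  -- is needed because u is differentiable only inside the interval.
  have hbound : ∃ V, ∀ t ∈ Ioo a b, ‖f (u t)‖ ≤ V := by
    obtain ⟨V₁, hV₁⟩ := isCompact_Icc.exists_bound_of_continuousOn
      (hf.continuous.comp_continuousOn (hc.mono (Icc_subset_Ico_right hmb)))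
    set V₂ := gronwallBound ‖u m‖ K ‖f 0‖ (b - m) with hV₂
    have h2 : ∀ t ∈ Ico m b, ‖u t‖ ≤ V₂ := by
      intro t ht
      have h3 := norm_le_gronwallBound_of_norm_deriv_right_le (f := u) (f' := fun s => f (u s))
        (δ := ‖u m‖) (K := K) (ε := ‖f 0‖) (a := m) (b := t)
        (hc.mono fun s hs => ⟨ham.le.trans hs.1, hs.2.trans_lt ht.2⟩)
        (fun s hs => (hd s ⟨ham.trans_le hs.1, hs.2.trans ht.2⟩).hasDerivWithinAt) le_rfl
        (fun s _ => hfn (u s)) t ⟨ht.1, le_rfl⟩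
      refine h3.trans (gronwallBound_mono (norm_nonneg _) (norm_nonneg _) K.2 ?_)
      linarith [ht.2]
    refine ⟨max V₁ (K * V₂ + ‖f 0‖), fun t ht => ?_⟩
    rcases le_total t m with htm | htm
    · exact (hV₁ t ⟨ht.1.le, htm⟩).trans (le_max_left _ _)
    · refine ((hfn _).trans ?_).trans (le_max_right _ _)
      have := h2 t ⟨htm, ht.2⟩
      gcongr
  obtain ⟨V, hV⟩ := hbound
  have hL : LipschitzOnWith V.toNNReal u (Ico a b) := by
    intro x hx y hy
    set r := (max (max x y) a + b) / 2 with hr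
    have h1 : max (max x y) a < b := max_lt (max_lt hx.2 hy.2) hab
    have h2 : x ≤ max (max x y) a := (le_max_left _ _).trans (le_max_left _ _)
    have h3 : y ≤ max (max x y) a := (le_max_right _ _).trans (le_max_left _ _)
    have h4 : a ≤ max (max x y) a := le_max_right _ _
    have hrb : r < b := by rw [hr]; linarith
    have har : a < r := by rw [hr]; linarith
    exact lipschitzOnWith_Icc_of_hasDerivAt har (hc.mono (Icc_subset_Ico_right hrb))
      (fun t ht => ⟨_, hV t ⟨ht.1, ht.2.trans hrb⟩, hd t ⟨ht.1, ht.2.trans hrb⟩⟩)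
      (show x ∈ Icc a r from ⟨hx.1, by rw [hr]; linarith⟩)
      (show y ∈ Icc a r from ⟨hy.1, by rw [hr]; linarith⟩)
  obtain ⟨g, hg, he⟩ := hL.extend_finite_dimension
  exact ⟨g, _, hg, he⟩

/-- Local existence for a Lipschitz differential equation. -/
theorem exists_local_flow [CompleteSpace E] {f : E → E} {K : NNReal} (hf : LipschitzWith K f)
    (z : E) (b : ℝ) : ∃ (d : ℝ) (ψ : ℝ → E) (K' : NNReal), b < d ∧ ψ b = z ∧
      LipschitzOnWith K' ψ (Icc b d) ∧ ∀ t ∈ Ioo b d, HasDerivAt ψ (f (ψ t)) t := by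
  set V : NNReal := ‖f z‖₊ + K with hV
  have hball : ∀ x ∈ Metric.closedBall z (1 : NNReal), ‖f x‖ ≤ V := by
    intro x hx
    rw [Metric.mem_closedBall, dist_eq_norm] at hx
    have h1 := hf.norm_sub_le x z
    have h2 := norm_sub_norm_le (f x) (f z)
    have h3 : (K : ℝ) * ‖x - z‖ ≤ K * 1 := mul_le_mul_of_nonneg_left hx K.2
    rw [hV]; push_cast
    linarith
  -- V bounds the speed on the unit ball around z, so the solution stays in that ball for time ε.
  set ε : ℝ := 1 / (V + 1) with hε
  have hε0 : 0 < ε := by positivity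
  have hpl : IsPicardLindelof (fun _ => f) (tmin := b) (tmax := b + ε)
      ⟨b, le_rfl, by linarith⟩ z 1 0 V K := by
    refine IsPicardLindelof.of_time_independent hball hf.lipschitzOnWith ?_
    have : max (b + ε - b) (b - b) = ε := by rw [add_sub_cancel_left, sub_self, max_eq_left hε0.le]
    simp only [this, NNReal.coe_one, NNReal.coe_zero, sub_zero]
    rw [hε, mul_one_div, div_le_one (by positivity)]
    linarith
  obtain ⟨ψ, hψ0, hψ⟩ := hpl.exists_eq_forall_mem_Icc_hasDerivWithinAt₀
  have hψc : ContinuousOn ψ (Icc b (b + ε)) := fun t ht => (hψ t ht).continuousWithinAt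
  have hψd : ∀ t ∈ Ioo b (b + ε), HasDerivAt ψ (f (ψ t)) t := fun t ht =>
    (hψ t (Ioo_subset_Icc_self ht)).hasDerivAt (Icc_mem_nhds ht.1 ht.2)
  obtain ⟨W, hW⟩ := isCompact_Icc.exists_bound_of_continuousOn (hf.continuous.comp_continuousOn hψc)
  exact ⟨b + ε, ψ, _, by linarith, hψ0, lipschitzOnWith_Icc_of_hasDerivAt (by linarith) hψc
    fun t ht => ⟨_, hW t (Ioo_subset_Icc_self ht), hψd t ht⟩, hψd⟩

end Extension

theorem lipschitzWith_deadzone : LipschitzWith 2 deadzone := by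
  have h : LipschitzWith (1 + 1) fun s : ℝ => s - max (-1) (min 1 s) :=
    LipschitzWith.id.sub ((LipschitzWith.id.const_min 1).const_max (-1))
  rw [funext deadzone_eq]
  exact h.weaken (by norm_num)

theorem exists_lipschitzWith_toLp {X : Type*} [PseudoMetricSpace X] {ι : Type} [Fintype ι]
    {F : X → ι → ℝ} (h : ∀ i, ∃ K, LipschitzWith K fun x => F x i) :
    ∃ K, LipschitzWith K fun x => (WithLp.toLp 2 (F x) : EuclideanSpace ℝ ι) := by
  choose K hK using h
  have h1 : LipschitzWith (∑ i, K i) F := by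
    refine LipschitzWith.of_dist_le_mul fun x y => ?_
    refine (dist_pi_le_iff (by positivity)).2 fun i => ((hK i).dist_le_mul x y).trans ?_
    gcongr
    exact Finset.single_le_sum (f := K) (fun i _ => zero_le) (Finset.mem_univ i)
  exact ⟨_, (PiLp.lipschitzWith_toLp 2 fun _ : ι => ℝ).comp h1⟩

theorem exists_lipschitzWith_flowField {n q p : ℕ} (A : Matrix (Fin n) (Fin n) ℝ)
    (B : Matrix (Fin n) (Fin q) ℝ) (C : Matrix (Fin q) (Fin n) ℝ) (L : Matrix (Fin n) (Fin q) ℝ)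
    (ρ : ℝ) : ∃ K, LipschitzWith K (flowField A B C L ρ : State n q p → _) := by
  have hlin : ∀ {m : ℕ} (M : State n q p →ₗ[ℝ] Vec m) (i : Fin m),
      ∃ K, LipschitzWith K fun X => M X i := fun M i =>
    ⟨_, ((EuclideanSpace.proj (𝕜 := ℝ) i).comp (LinearMap.toContinuousLinearMap M)).lipschitz⟩
  refine exists_lipschitzWith_toLp fun i => ?_
  rcases i with i | i | i | i
  · exact hlin (Matrix.toEuclideanLin A ∘ₗ State.xL.toLinearMap +
      Matrix.toEuclideanLin B ∘ₗ State.νL.toLinearMap) i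
  · exact hlin (Matrix.toEuclideanLin A ∘ₗ State.xhL.toLinearMap +
      Matrix.toEuclideanLin B ∘ₗ State.νL.toLinearMap +
      Matrix.toEuclideanLin L ∘ₗ (Matrix.toEuclideanLin C ∘ₗ State.xhL.toLinearMap -
        Matrix.toEuclideanLin C ∘ₗ State.xL.toLinearMap)) i
  · exact ⟨0, LipschitzWith.const 0⟩
  · obtain ⟨K, hK⟩ := hlin (ρ⁻¹ • State.τL.toLinearMap) i
    refine ⟨0 + 2 * K, ?_⟩
    have h := (LipschitzWith.const (α := State n q p) (1 : ℝ)).sub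
      (lipschitzWith_deadzone.comp hK)
    change LipschitzWith _ fun X : State n q p => 1 - deadzone (X.τ i / ρ)
    simp only [div_eq_inv_mul]
    exact h

/-! ### Completeness of maximal solutions -/

section Completeness

variable {n q p : ℕ} {A : Matrix (Fin n) (Fin n) ℝ} {B : Matrix (Fin n) (Fin q) ℝ}
  {C : Matrix (Fin q) (Fin n) ℝ} {L : Matrix (Fin n) (Fin q) ℝ} {σ : Fin q → Fin p}
  {𝒞 𝒟 : Fin p → Set (Vec n × Vec q)} {Δ ρ : ℝ} {H : HybridSystem (State n q p)}
  {T : Set (ℝ × ℕ)} {φ : ℝ → ℕ → State n q p}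

namespace LazyLoop

/-- Flow is possible from each state at which no block may transmit. -/
theorem exists_flow (hH : LazyLoop A B C L σ 𝒞 𝒟 Δ ρ H) (hρ : 0 < ρ)
    (h𝒟 : ∀ k, IsClosed (𝒟 k)) (hcov : ∀ k z, z ∉ 𝒟 k → z ∈ 𝒞 k) {z : State n q p}
    (hτ : ∀ k, 0 ≤ z.τ k) (hz : ∀ k, (z.xh, z.err C) ∉ 𝒟 k ∨ z.τ k < Δ) (b : ℝ) :
    ∃ (d : ℝ) (ψ : ℝ → State n q p) (K : NNReal), b < d ∧ ψ b = z ∧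
      LipschitzOnWith K ψ (Icc b d) ∧ (∀ t ∈ Ioo b d, HasDerivAt ψ (flowField A B C L ρ (ψ t)) t) ∧
      ∀ t ∈ Ico b d, ψ t ∈ H.flowSet := by
  obtain ⟨K, hK⟩ := exists_lipschitzWith_flowField (p := p) A B C L ρ
  obtain ⟨d, ψ, K', hbd, hψ0, hψL, hψd⟩ := exists_local_flow hK z b
  have hψc := hψL.continuousOn
  have hcb : Filter.Tendsto ψ (nhdsWithin b (Ici b)) (nhds z) := by
    have := hψc b ⟨le_rfl, hbd.le⟩
    rwa [ContinuousWithinAt, nhdsWithin_Icc_eq_nhdsGE hbd, hψ0] at this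
  -- Being unable to transmit is an open condition, and by `hcov` it puts the state where waiting is
  -- allowed. Timers that vanish at z need their own argument to stay non-negative.
  have hopen : ∀ k, ∀ᶠ X in nhds z, ((X.xh, X.err C) ∉ 𝒟 k ∨ X.τ k < Δ) ∧
      ((z.τ k = 0 → |X.τ k| < ρ) ∧ (z.τ k ≠ 0 → 0 < X.τ k)) := by
    intro k
    refine Filter.Eventually.and ?_ ?_
    · have hO : IsOpen ((fun X : State n q p => (X.xh, X.err C)) ⁻¹' (𝒟 k)ᶜ ∪ {X | X.τ k < Δ}) :=
        ((h𝒟 k).isOpen_compl.preimage (by fun_prop)).union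
          (isOpen_lt (by fun_prop) continuous_const)
      exact hO.mem_nhds (hz k)
    · rcases (hτ k).eq_or_lt with h | h
      · have hO : IsOpen {X : State n q p | |X.τ k| < ρ} :=
          isOpen_lt (continuous_abs.comp (by fun_prop)) continuous_const
        filter_upwards [hO.mem_nhds (show |z.τ k| < ρ by rwa [← h, abs_zero])] with X hX
        exact ⟨fun _ => hX, fun h' => absurd h.symm h'⟩
      · have hO : IsOpen {X : State n q p | 0 < X.τ k} := isOpen_lt continuous_const (by fun_prop)
        filter_upwards [hO.mem_nhds h] with X hX using ⟨fun h' => absurd h' h.ne', fun _ => hX⟩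
  have hev := hcb.eventually (Filter.eventually_all.2 hopen)
  obtain ⟨d', hd', hsub⟩ := (mem_nhdsGE_iff_exists_Ico_subset' hbd).1 hev
  have hbd' : b < min d d' := lt_min hbd hd'
  have hgood : ∀ t ∈ Ico b (min d d'), ∀ k, (((ψ t).xh, (ψ t).err C) ∉ 𝒟 k ∨ (ψ t).τ k < Δ) ∧
      ((z.τ k = 0 → |(ψ t).τ k| < ρ) ∧ (z.τ k ≠ 0 → 0 < (ψ t).τ k)) := fun t ht =>
    hsub ⟨ht.1, ht.2.trans_le (min_le_right _ _)⟩
  refine ⟨min d d', ψ, K', hbd', hψ0, hψL.mono (Icc_subset_Icc_right (min_le_left _ _)),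
    fun t ht => hψd t ⟨ht.1, ht.2.trans_le (min_le_left _ _)⟩, fun t ht => ?_⟩
  refine (hH.flowSet_iff _).2 ⟨fun k => ?_, fun k => ?_⟩
  · by_cases hz0 : z.τ k = 0
    -- A timer starting from 0 stays in |τ| < ρ for a while; there the dead zone is zero, so it
    -- cannot decrease.
    · have hder : ∀ s ∈ Ioo b t, HasDerivAt (fun s => (ψ s).τ k)
          (1 - deadzone ((ψ s).τ k / ρ)) s := by
        intro s hs
        rw [← flowField_τ A B C L ρ]
        exact ((EuclideanSpace.proj (𝕜 := ℝ) k).comp State.τL).hasFDerivAt.comp_hasDerivAt s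
          (hψd s ⟨hs.1, (hs.2.trans ht.2).trans_le (min_le_left _ _)⟩)
      have hct : ContinuousOn ψ (Icc b t) :=
        hψc.mono (Icc_subset_Icc_right (ht.2.le.trans (min_le_left _ _)))
      have h1 := le_of_hasDerivAt_nonpos (f := fun s => -(ψ s).τ k)
        (f' := fun s => -(1 - deadzone ((ψ s).τ k / ρ))) ht.1 (by fun_prop)
        (fun s hs => (hder s hs).neg) fun s hs => by
          have h2 : deadzone ((ψ s).τ k / ρ) ≤ 1 := by
            have h3 := (hgood s ⟨hs.1.le, hs.2.trans ht.2⟩ k).2.1 hz0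
            rw [deadzone, if_pos]
            · exact zero_le_one
            · rw [abs_div, abs_of_pos hρ, div_le_one hρ]
              exact h3.le
          linarith
      rw [hψ0, hz0] at h1
      linarith
    · exact ((hgood t ht k).2.2 hz0).le
  · exact (hgood t ht k).1.imp (hcov k _) le_of_lt

/-- A domain with infinitely many jumps or an unbounded last interval is complete. If the last
interval is closed, either a jump is available at its end or no block may transmit there and flow
continues. If it is half-open, the Lipschitz flow field lets the solution extend to the missing end
point. -/
theorem complete (hH : LazyLoop A B C L σ 𝒞 𝒟 Δ ρ H) (hρ : 0 < ρ)
    (h𝒞 : ∀ k, IsClosed (𝒞 k)) (h𝒟 : ∀ k, IsClosed (𝒟 k)) (hcov : ∀ k z, z ∉ 𝒟 k → z ∈ 𝒞 k)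
    (hmax : IsMaximalSolution H T φ) : IsCompleteDomain T := by
  have hs := hmax.1
  have hfc := continuous_flowField (p := p) A B C L ρ
  obtain ⟨t, ht0, htm, rfl | ⟨J, I, hI, rfl⟩⟩ := hs.arc.1
  · intro M
    obtain ⟨j, hj⟩ := exists_nat_gt M
    refine ⟨t j, j, ?_, ?_⟩
    · simp only [mem_iUnion]
      exact ⟨j, ⟨le_rfl, htm (Nat.le_succ j)⟩, rfl⟩
    · have := htm (Nat.zero_le j)
      rw [ht0] at this
      linarith
  change IsMaximalSolution H (finiteDomain t J I) φ at hmax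
  change IsSolution H (finiteDomain t J I) φ at hs
  change IsCompleteDomain (finiteDomain t J I)
  rcases hI with rfl | ⟨hlt, rfl⟩ | rfl
  · exfalso
    set b := t (J + 1) with hb
    have hJb : t J ≤ b := htm (Nat.le_succ J)
    have hbT : (b, J) ∈ finiteDomain t J (Icc (t J) b) := mem_finiteDomain.2 (Or.inr ⟨rfl, hJb,
      le_rfl⟩)
    have hJT : (t J, J) ∈ finiteDomain t J (Icc (t J) b) :=
      mem_finiteDomain.2 (Or.inr ⟨rfl, le_rfl, hJb⟩)
    have hτ := hH.τ_nonneg h𝒞 hs hbT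
    by_cases hD : φ b J ∈ H.jumpSet
    · exact not_isMaximalSolution_of_jump ht0 htm hs hD (hH.jump_nonempty _ hD) hmax
    have hz : ∀ k, ((φ b J).xh, (φ b J).err C) ∉ 𝒟 k ∨ (φ b J).τ k < Δ := by
      intro k
      by_contra hcon
      push Not at hcon
      exact hD ((hH.jumpSet_iff _).2 ⟨hτ, k, hcon.1, hcon.2⟩)
    obtain ⟨d, ψ, K₁, hbd, hψ0, hψL, hψd, hψf⟩ := hH.exists_flow hρ h𝒟 hcov hτ hz b
    have hφL : ∃ K₂, LipschitzOnWith K₂ (fun s => φ s J) (Icc (t J) b) := by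
      rcases hJb.eq_or_lt with h | h
      · refine ⟨0, ?_⟩
        rw [← h, Icc_self]
        intro x hx y hy
        rw [mem_singleton_iff] at hx hy
        simp [hx, hy]
      · have hcont := hs.continuousOn h.le hJT hbT
        obtain ⟨V, hV⟩ := isCompact_Icc.exists_bound_of_continuousOn (hfc.comp_continuousOn hcont)
        exact ⟨_, lipschitzOnWith_Icc_of_hasDerivAt h hcont fun s hs' =>
          ⟨_, hV s (Ioo_subset_Icc_self hs'), hH.hasDerivAt hs h hJT hbT hs'⟩⟩
    obtain ⟨K₂, hφL⟩ := hφL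
    -- The old last piece glued to the new flow. The junction b is a null set, so the derivative
    -- there is not needed.
    set g : ℝ → State n q p := fun s => if s ≤ b then φ s J else ψ s with hg
    have hgL : LipschitzOnWith (max K₁ K₂) g (Icc (t J) d) :=
      lipschitzOnWith_Icc_glue hJb hbd.le (hφL.weaken (le_max_right _ _))
        (hψL.weaken (le_max_left _ _)) hψ0.symm
    have hg1 : ∀ s, s < b → g =ᶠ[nhds s] fun s => φ s J := fun s hsb => by
      filter_upwards [Iio_mem_nhds hsb] with r hr using if_pos (le_of_lt hr)
    have hg2 : ∀ s, b < s → g =ᶠ[nhds s] ψ := fun s hsb => by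
      filter_upwards [Ioi_mem_nhds hsb] with r hr using if_neg (not_le.2 hr)
    refine not_isMaximalSolution_of_flow ht0 htm hs ⟨le_rfl, hJb⟩
      (b := d) ⟨Icc_subset_Icc_right hbd.le, fun h => ?_⟩ (g := g) (fun s hsI => if_pos hsI.2)
      hgL ?_ ?_ hmax
    · exact absurd (h ⟨hJb.trans hbd.le, le_rfl⟩).2 (not_le.2 hbd)
    · rw [ae_restrict_iff' measurableSet_Icc]
      have hne : ∀ r : ℝ, ∀ᵐ s : ℝ, s ≠ r := fun r =>
        (Set.countable_singleton r).ae_notMem (volume : Measure ℝ)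
      filter_upwards [hne (t J), hne b, hne d] with s h1 h2 h3 hsI
      simp only [hH.flowMap_eq, mem_singleton_iff, exists_eq_left]
      rcases lt_or_gt_of_ne h2 with h | h
      · have h4 := hH.hasDerivAt hs ((lt_of_le_of_ne hsI.1 (Ne.symm h1)).trans h) hJT hbT
          ⟨lt_of_le_of_ne hsI.1 (Ne.symm h1), h⟩
        rw [(hg1 s h).self_of_nhds]
        exact h4.congr_of_eventuallyEq (hg1 s h)
      · rw [(hg2 s h).self_of_nhds]
        exact (hψd s ⟨h, lt_of_le_of_ne hsI.2 h3⟩).congr_of_eventuallyEq (hg2 s h)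
    · intro s hsI
      rcases lt_or_ge s b with h | h
      · rw [(hg1 s h).self_of_nhds]
        exact hs.flow_mem J s (hs.arc.1.ordConnected hJT hbT ⟨hsI.1, h.le⟩) ⟨b, hbT, h⟩
      · have : g s = ψ s := by
          rcases h.eq_or_lt with rfl | h
          · rw [hψ0]; exact if_pos le_rfl
          · exact (hg2 s h).self_of_nhds
        rw [this]
        exact hψf s ⟨h, hsI.2⟩
  · exfalso
    set b := t (J + 1) with hb
    have hmem : ∀ s ∈ Ico (t J) b, (s, J) ∈ finiteDomain t J (Ico (t J) b) := fun s hs' =>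
      mem_finiteDomain.2 (Or.inr ⟨rfl, hs'⟩)
    have hJT := hmem (t J) ⟨le_rfl, hlt⟩
    have hder : ∀ s ∈ Ioo (t J) b, HasDerivAt (fun s => φ s J)
        (flowField A B C L ρ (φ s J)) s := by
      intro s hs'
      obtain ⟨r, hr1, hr2⟩ := exists_between hs'.2
      exact hH.hasDerivAt hs (hs'.1.trans hr1) hJT (hmem r ⟨(hs'.1.trans hr1).le, hr2⟩) ⟨hs'.1, hr1⟩
    have hcont : ContinuousOn (fun s => φ s J) (Ico (t J) b) := by
      intro s hs'
      obtain ⟨r, hr1, hr2⟩ := exists_between hs'.2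
      have h1 := hs.continuousOn (hs'.1.trans hr1.le) hJT (hmem r ⟨hs'.1.trans hr1.le, hr2⟩) s
        ⟨hs'.1, hr1.le⟩
      refine h1.mono_of_mem_nhdsWithin ?_
      rw [mem_nhdsWithin]
      exact ⟨Iio r, isOpen_Iio, hr1, fun x hx => ⟨hx.2.1, le_of_lt hx.1⟩⟩
    obtain ⟨K, hK⟩ := exists_lipschitzWith_flowField (p := p) A B C L ρ
    obtain ⟨g, K', hgL, hgeq⟩ := exists_lipschitz_extension hK hlt hcont hder
    refine not_isMaximalSolution_of_flow ht0 htm hs ⟨le_rfl, hlt⟩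
      (b := b) ⟨Ico_subset_Icc_self, fun h => ?_⟩ (g := g) (fun s hsI => (hgeq hsI).symm)
      hgL.lipschitzOnWith ?_ ?_ hmax
    · exact absurd (h ⟨hlt.le, le_rfl⟩).2 (lt_irrefl _)
    · rw [ae_restrict_iff' measurableSet_Icc]
      have hne : ∀ r : ℝ, ∀ᵐ s : ℝ, s ≠ r := fun r =>
        (Set.countable_singleton r).ae_notMem (volume : Measure ℝ)
      filter_upwards [hne (t J), hne b] with s h1 h2 hsI
      simp only [hH.flowMap_eq, mem_singleton_iff, exists_eq_left]
      have hsO : s ∈ Ioo (t J) b := ⟨lt_of_le_of_ne hsI.1 (Ne.symm h1), lt_of_le_of_ne hsI.2 h2⟩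
      rw [← hgeq ⟨hsI.1, hsO.2⟩]
      refine (hder s hsO).congr_of_eventuallyEq ?_
      filter_upwards [Ioo_mem_nhds hsO.1 hsO.2] with r hr using (hgeq (Ioo_subset_Ico_self hr)).symm
    · intro s hsI
      rw [← hgeq hsI]
      obtain ⟨r, hr1, hr2⟩ := exists_between hsI.2
      exact hs.flow_mem J s (hmem s hsI) ⟨r, hmem r ⟨hsI.1.trans hr1.le, hr2⟩, hr1⟩
  · intro M
    refine ⟨max (t J) (M + 1), J, mem_finiteDomain.2 (Or.inr ⟨rfl, mem_Ici.2 (le_max_left _ _)⟩),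
      ?_⟩
    have := le_max_right (t J) (M + 1)
    have : (0 : ℝ) ≤ J := Nat.cast_nonneg J
    linarith

end LazyLoop

end Completeness

/-! ### From exponential bounds to stability notions -/

section Stability

variable {E : Type*} [NormedAddCommGroup E] [NormedSpace ℝ E]

/-- An exponential bound on all solutions gives both stability notions. -/
theorem isGAS_and_isGES_of_exponential {H : HybridSystem E} {K : Set E}
    (hexp : IsExponentiallyStableSet H K) (hbd : ∀ T φ, IsSolution H T φ → BoundedArc T φ)
    (hmax : ∀ T φ, IsMaximalSolution H T φ → IsCompleteDomain T) : IsGAS H K ∧ IsGES H K := by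
  obtain ⟨γ, hγ, k, hk, h⟩ := id hexp
  have hconv : ∀ T φ, IsSolution H T φ → ConvergesTo K T φ := by
    intro T φ hs ε hε
    have hlim : Filter.Tendsto (fun r : ℝ => k * Real.exp (-γ * r) * Metric.infDist (φ 0 0) K)
        Filter.atTop (nhds (k * 0 * Metric.infDist (φ 0 0) K)) := by
      refine (Filter.Tendsto.const_mul k ?_).mul_const _
      exact Real.tendsto_exp_atBot.comp
        ((Filter.tendsto_const_mul_atBot_of_neg (neg_lt_zero.2 hγ)).2 Filter.tendsto_id)
    rw [mul_zero, zero_mul] at hlim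
    obtain ⟨M, hM⟩ := Filter.eventually_atTop.1 (hlim.eventually_lt_const hε)
    exact ⟨M, fun t j htj hle => (h T φ hs t j htj).trans_lt (hM _ hle)⟩
  have hbasin : basin H K = univ :=
    eq_univ_of_forall fun z T φ hs _ => ⟨hbd T φ hs, fun _ => hconv T φ hs⟩
  refine ⟨⟨⟨?_, hmax, 1, one_pos, fun T φ hs _ => ⟨hbd T φ hs, fun _ => hconv T φ hs⟩⟩, hbasin⟩,
    hexp, hbasin⟩
  intro ε hε
  refine ⟨ε / k, by positivity, fun T φ hs h0 t j ht => ?_⟩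
  have ht0 := hs.arc.1.nonneg ht
  refine (h T φ hs t j ht).trans ?_
  have h1 : Real.exp (-γ * (t + j)) ≤ 1 := by
    rw [Real.exp_le_one_iff]
    have : 0 ≤ γ * (t + j) := by positivity
    linarith
  have h2 : 0 ≤ Metric.infDist (φ 0 0) K := Metric.infDist_nonneg
  calc k * Real.exp (-γ * (t + j)) * Metric.infDist (φ 0 0) K ≤ k * 1 * (ε / k) := by gcongr
    _ = ε := by field_simp

end Stability

/-! ### Distance to the attractor in coordinates -/

section Attractor

variable {n q p : ℕ} {ρ : ℝ}

theorem infDist_attractor_le (hρ : 0 ≤ ρ) {X : State n q p} (hX : ∀ k, 0 ≤ X.τ k) :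
    Metric.infDist X (attractor n q p ρ) ≤
      ‖X.x‖ + ‖X.xh‖ + ‖X.ν‖ + ∑ k, max 0 (X.τ k - 2 * ρ) := by
  -- The comparison point in the attractor truncates each timer at 2ρ and sets everything else to
  -- zero.
  let Z : State n q p := State.mk 0 0 0 (WithLp.toLp 2 fun k => min (X.τ k) (2 * ρ))
  have hZ : Z ∈ attractor n q p ρ :=
    ⟨rfl, rfl, rfl, fun k => ⟨le_min (hX k) (by positivity), min_le_right _ _⟩⟩
  refine (Metric.infDist_le_dist_of_mem hZ).trans ?_
  rw [dist_eq_norm]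
  have hx : (X - Z).x = X.x := sub_zero X.x
  have hxh : (X - Z).xh = X.xh := sub_zero X.xh
  have hν : (X - Z).ν = X.ν := sub_zero X.ν
  have hτ : ‖(X - Z).τ‖ ≤ ∑ k, max 0 (X.τ k - 2 * ρ) := by
    refine (norm_le_sum_abs _).trans (Finset.sum_le_sum fun k _ => ?_)
    change |X.τ k - min (X.τ k) (2 * ρ)| ≤ _
    rcases le_total (X.τ k) (2 * ρ) with h | h
    · rw [min_eq_left h, sub_self, abs_zero]; exact le_max_left _ _
    · rw [min_eq_right h, abs_of_nonneg (by linarith)]; exact le_max_right _ _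
  have h0 : 0 ≤ ∑ k, max 0 (X.τ k - 2 * ρ) := Finset.sum_nonneg fun k _ => le_max_left _ _
  refine le_of_sq_le_sq ?_ (by positivity)
  rw [State.norm_sq_eq, hx, hxh, hν]
  have h1 := pow_le_pow_left₀ (norm_nonneg _) hτ 2
  have : 0 ≤ ‖X.x‖ * ‖X.xh‖ + ‖X.x‖ * ‖X.ν‖ + ‖X.xh‖ * ‖X.ν‖ +
    (‖X.x‖ + ‖X.xh‖ + ‖X.ν‖) * ∑ k, max 0 (X.τ k - 2 * ρ) := by positivity
  linarith

theorem le_infDist_attractor (hρ : 0 ≤ ρ) (X : State n q p) :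
    ‖X.x‖ ≤ Metric.infDist X (attractor n q p ρ) ∧ ‖X.xh‖ ≤ Metric.infDist X (attractor n q p ρ) ∧
    ‖X.ν‖ ≤ Metric.infDist X (attractor n q p ρ) ∧
    ∀ k, max 0 (X.τ k - 2 * ρ) ≤ Metric.infDist X (attractor n q p ρ) := by
  have hne : (attractor n q p ρ).Nonempty :=
    ⟨State.mk 0 0 0 0, rfl, rfl, rfl, fun k => ⟨le_rfl, by
      change (0 : ℝ) ≤ 2 * ρ
      positivity⟩⟩
  have key : ∀ Z ∈ attractor n q p ρ, ‖X.x‖ ^ 2 + (‖X.xh‖ ^ 2 + (‖X.ν‖ ^ 2 + ‖X.τ - Z.τ‖ ^ 2)) =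
      dist X Z ^ 2 := by
    rintro Z ⟨h1, h2, h3, -⟩
    rw [dist_eq_norm, State.norm_sq_eq]
    change _ = ‖X.x - Z.x‖ ^ 2 + (‖X.xh - Z.xh‖ ^ 2 + (‖X.ν - Z.ν‖ ^ 2 + ‖X.τ - Z.τ‖ ^ 2))
    rw [h1, h2, h3, sub_zero, sub_zero, sub_zero]
  refine ⟨?_, ?_, ?_, fun k => max_le Metric.infDist_nonneg ?_⟩ <;>
    refine (Metric.le_infDist hne).2 fun {Z} hZ => ?_ <;> have hk := key Z hZ
  · exact le_of_sq_le_sq (by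
      linarith [sq_nonneg ‖X.xh‖, sq_nonneg ‖X.ν‖, sq_nonneg ‖X.τ - Z.τ‖]) dist_nonneg
  · exact le_of_sq_le_sq (by
      linarith [sq_nonneg ‖X.x‖, sq_nonneg ‖X.ν‖, sq_nonneg ‖X.τ - Z.τ‖]) dist_nonneg
  · exact le_of_sq_le_sq (by
      linarith [sq_nonneg ‖X.x‖, sq_nonneg ‖X.xh‖, sq_nonneg ‖X.τ - Z.τ‖]) dist_nonneg
  · have h1 : ‖X.τ - Z.τ‖ ≤ dist X Z := le_of_sq_le_sq (by
      linarith [sq_nonneg ‖X.x‖, sq_nonneg ‖X.xh‖, sq_nonneg ‖X.ν‖]) dist_nonneg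
    have h2 := (PiLp.norm_apply_le (X.τ - Z.τ) k).trans h1
    have h3 := (le_abs_self (X.τ k - Z.τ k)).trans h2
    linarith [(hZ.2.2.2 k).2]

end Attractor

/-! ### Stability of certified loops -/

section Main

variable {n q p : ℕ} {A : Matrix (Fin n) (Fin n) ℝ} {B : Matrix (Fin n) (Fin q) ℝ}
  {C : Matrix (Fin q) (Fin n) ℝ} {L : Matrix (Fin n) (Fin q) ℝ} {σ : Fin q → Fin p}
  {𝒞 𝒟 : Fin p → Set (Vec n × Vec q)} {P₁ : Matrix (Fin n) (Fin n) ℝ}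
  {P₂ : Matrix (Fin q) (Fin q) ℝ} {K c : ℝ}

/-- A transmission-lazy loop certified by a quadratic function is stable for short dwell times. -/
theorem LazyLyapunov.exists_stable (hV : LazyLyapunov A B C L σ 𝒞 P₁ P₂ K c)
    (hL : IsHurwitz (A + L * C)) (h𝒟 : ∀ k, IsClosed (𝒟 k)) (hcov : ∀ k z, z ∉ 𝒟 k → z ∈ 𝒞 k) :
    ∃ ρ₀ > 0, ∀ Δ ρ : ℝ, 0 < Δ → Δ < ρ → ρ ≤ ρ₀ → ∀ H, LazyLoop A B C L σ 𝒞 𝒟 Δ ρ H →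
      IsGAS H (attractor n q p ρ) ∧ IsGES H (attractor n q p ρ) := by
  obtain ⟨ρ₀, hρ₀, l, hl, G, hG, hdecay⟩ := LazyLoop.exists_decay hV hL
  obtain ⟨γ, hγ, hγ'⟩ := (LinearMap.toContinuousLinearMap (Matrix.toEuclideanLin C)).bound
  refine ⟨ρ₀, hρ₀, fun Δ ρ hΔ hΔρ hρρ₀ H hH => ?_⟩
  have hρ : 0 < ρ := hΔ.trans hΔρ
  have hCle : ∀ z, ‖mul C z‖ ≤ γ * ‖z‖ := hγ'
  -- The timers approach [0, 2ρ] at rate 1/ρ, so the common rate is the slower of the two.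
  set l' := min l (1 / ρ) with hl'
  have hl'0 : 0 < l' := lt_min hl (by positivity)
  -- 4 + γ bounds the initial |x̂| + |e| + |w| by the distance d, 2 + γ returns from these
  -- coordinates to x, x̂, ν, and p counts the timers.
  set k₁ := (2 + γ) * G * (4 + γ) + p with hk₁
  have hbound : ∀ T φ, IsSolution H T φ → ∀ t j, (t, j) ∈ T →
      Metric.infDist (φ t j) (attractor n q p ρ) ≤
        k₁ * Real.exp (-l' * t) * Metric.infDist (φ 0 0) (attractor n q p ρ) := by
    intro T φ hs t j ht
    have ht0 := hs.arc.1.nonneg ht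
    set d := Metric.infDist (φ 0 0) (attractor n q p ρ) with hd
    have hd0 : 0 ≤ d := Metric.infDist_nonneg
    obtain ⟨h1, h2, h3, h4⟩ := le_infDist_attractor hρ.le (φ 0 0)
    rw [← hd] at h1 h2 h3
    have he₀ : ‖(φ 0 0).err C‖ ≤ (1 + γ) * d := by
      refine (norm_sub_le _ _).trans ?_
      have := (hCle (φ 0 0).xh).trans (mul_le_mul_of_nonneg_left h2 hγ.le)
      linarith
    have hw₀ : ‖(φ 0 0).obs‖ ≤ 2 * d := (norm_sub_le _ _).trans (by linarith)
    have hdec := hdecay hΔ hΔρ hρρ₀ hH hs t j ht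
    set y := ‖(φ t j).xh‖ + ‖(φ t j).err C‖ + ‖(φ t j).obs‖ with hy
    have hexp1 : Real.exp (-l * t) ≤ Real.exp (-l' * t) := by
      have := min_le_left l (1 / ρ)
      gcongr
    have hexp2 : Real.exp (-(1 / ρ) * t) ≤ Real.exp (-l' * t) := by
      have := min_le_right l (1 / ρ)
      gcongr
    have hy1 : y ≤ G * Real.exp (-l' * t) * ((4 + γ) * d) :=
      hdec.trans (by gcongr; linarith)
    have hx : ‖(φ t j).x‖ ≤ ‖(φ t j).xh‖ + ‖(φ t j).obs‖ := by
      have : (φ t j).x = (φ t j).xh - (φ t j).obs := by rw [State.obs]; abel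
      rw [this]; exact norm_sub_le _ _
    have hν : ‖(φ t j).ν‖ ≤ ‖(φ t j).err C‖ + γ * ‖(φ t j).xh‖ := by
      have : (φ t j).ν = (φ t j).err C + mul C (φ t j).xh := by rw [State.err]; abel
      rw [this]
      exact (norm_add_le _ _).trans (by linarith [hCle (φ t j).xh])
    have hsum : ‖(φ t j).x‖ + ‖(φ t j).xh‖ + ‖(φ t j).ν‖ ≤ (2 + γ) * y := by
      have h5 : 0 ≤ (1 + γ) * ‖(φ t j).err C‖ := by positivity
      have h6 : 0 ≤ (1 + γ) * ‖(φ t j).obs‖ := by positivity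
      rw [hy]
      linarith
    have hτ : ∑ k, max 0 ((φ t j).τ k - 2 * ρ) ≤ p * (Real.exp (-l' * t) * d) := by
      have h5 : ∀ k ∈ Finset.univ, max 0 ((φ t j).τ k - 2 * ρ) ≤ Real.exp (-l' * t) * d := by
        intro k _
        refine max_le (by positivity) ((hH.τ_excess_le hρ hs ht k).trans ?_)
        exact mul_le_mul hexp2 (h4 k) (le_max_left _ _) (Real.exp_pos _).le
      refine (Finset.sum_le_sum h5).trans_eq ?_
      rw [Finset.sum_const, Finset.card_univ, Fintype.card_fin, nsmul_eq_mul]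
    refine (infDist_attractor_le hρ.le (hH.τ_nonneg hV.isClosed hs ht)).trans ?_
    have h7 := mul_le_mul_of_nonneg_left hy1 (show 0 ≤ 2 + γ by positivity)
    rw [hk₁]
    linarith
  -- The jump count jΔ ≤ pΔ + pt gives (t + j)Δ/(Δ + p) ≤ t + p: this is the hybrid rate, and
  -- exp(l'p) pays for the jumps possible at time zero.
  refine isGAS_and_isGES_of_exponential ⟨l' * Δ / (Δ + p), by positivity,
    k₁ * Real.exp (l' * p), by positivity, ?_⟩ ?_
    fun T φ hmax => hH.complete hρ hV.isClosed h𝒟 hcov hmax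
  · intro T φ hs t j ht
    refine (hbound T φ hs t j ht).trans ?_
    refine mul_le_mul_of_nonneg_right ?_ Metric.infDist_nonneg
    rw [mul_assoc, ← Real.exp_add]
    refine mul_le_mul_of_nonneg_left (Real.exp_le_exp.2 ?_) (by positivity)
    have h1 := hH.jump_count_le hV.isClosed hρ hΔ hs ht
    have h2 : l' * Δ / (Δ + p) * (t + j) ≤ l' * t + l' * p := by
      rw [div_mul_eq_mul_div, div_le_iff₀ (by positivity)]
      have h3 : l' * (j * Δ) ≤ l' * (p * Δ + p * t) := mul_le_mul_of_nonneg_left h1 hl'0.le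
      have h4 : 0 ≤ l' * p * p := by positivity
      linarith
    linarith
  · intro T φ hs
    set d := Metric.infDist (φ 0 0) (attractor n q p ρ) with hd
    have hd0 : 0 ≤ d := Metric.infDist_nonneg
    -- The attractor is bounded, its timers being at most 2ρ, so a bound on the distance bounds the
    -- state.
    refine ⟨3 * (k₁ * d) + ∑ _k : Fin p, (k₁ * d + 2 * ρ), fun t j ht => ?_⟩
    have h0 : Metric.infDist (φ t j) (attractor n q p ρ) ≤ k₁ * d := by
      refine (hbound T φ hs t j ht).trans ?_
      have h1 : Real.exp (-l' * t) ≤ 1 := by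
        rw [Real.exp_le_one_iff]
        have := mul_nonneg hl'0.le (hs.arc.1.nonneg ht)
        linarith
      refine mul_le_mul_of_nonneg_right ?_ hd0
      exact mul_le_of_le_one_right (by positivity) h1
    obtain ⟨h1, h2, h3, h4⟩ := le_infDist_attractor hρ.le (φ t j)
    have hτ : ‖(φ t j).τ‖ ≤ ∑ _k : Fin p, (k₁ * d + 2 * ρ) := by
      refine (norm_le_sum_abs _).trans (Finset.sum_le_sum fun k _ => ?_)
      rw [abs_of_nonneg (hH.τ_nonneg hV.isClosed hs ht k)]
      have := ((le_max_right _ _).trans (h4 k)).trans h0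
      linarith
    have h5 : 0 ≤ k₁ * d := by positivity
    refine le_of_sq_le_sq ?_ (add_nonneg (by positivity) ((norm_nonneg _).trans hτ))
    set S := ∑ _k : Fin p, (k₁ * d + 2 * ρ) with hS
    have hS0 : 0 ≤ S := (norm_nonneg _).trans hτ
    rw [State.norm_sq_eq]
    have e1 := pow_le_pow_left₀ (norm_nonneg _) (h1.trans h0) 2
    have e2 := pow_le_pow_left₀ (norm_nonneg _) (h2.trans h0) 2
    have e3 := pow_le_pow_left₀ (norm_nonneg _) (h3.trans h0) 2
    have e4 := pow_le_pow_left₀ (norm_nonneg _) hτ 2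
    have e5 : 0 ≤ k₁ * d * S := by positivity
    have e6 : 0 ≤ (k₁ * d) ^ 2 := sq_nonneg _
    linarith

end Main

/-! ### Quadratic forms, norms and rank of matrices -/

section Matrices

variable {ι κ μ : Type} [Fintype ι] [Fintype κ] [Fintype μ] [DecidableEq κ]
  [DecidableEq μ]

theorem inner_eq_dotProduct (x y : EuclideanSpace ℝ ι) :
    inner ℝ x y = dotProduct x.ofLp y.ofLp := by
  rw [EuclideanSpace.inner_eq_star_dotProduct, star_trivial, dotProduct_comm]

theorem mul_ofLp (M : Matrix ι κ ℝ) (x : EuclideanSpace ℝ κ) :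
    (mul M x).ofLp = M.mulVec x.ofLp := rfl

theorem mul_apply_add (M : Matrix ι κ ℝ) (x y : EuclideanSpace ℝ κ) :
    mul M (x + y) = mul M x + mul M y :=
  (Matrix.toEuclideanLin M).map_add x y

@[simp]
theorem zero_mul_apply (x : EuclideanSpace ℝ κ) : mul (0 : Matrix ι κ ℝ) x = 0 := by
  simp [mul]

theorem inner_mul_transpose [DecidableEq ι] (M : Matrix ι κ ℝ) (x : EuclideanSpace ℝ κ)
    (y : EuclideanSpace ℝ ι) :
    inner ℝ x (mul M.transpose y) = inner ℝ (mul M x) y := by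
  rw [inner_eq_dotProduct, inner_eq_dotProduct, mul_ofLp, mul_ofLp, Matrix.dotProduct_mulVec,
    Matrix.vecMul_transpose]

theorem inner_mul_of_isHermitian [DecidableEq ι] {M : Matrix ι ι ℝ} (hM : M.IsHermitian)
    (x y : EuclideanSpace ℝ ι) : inner ℝ x (mul M y) = inner ℝ (mul M x) y := by
  have h : M.transpose = M := by
    rw [← Matrix.conjTranspose_eq_transpose_of_trivial]
    exact hM
  rw [← inner_mul_transpose, h]

theorem inner_mul_nonneg [DecidableEq ι] {M : Matrix ι ι ℝ} (hM : M.PosSemidef)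
    (x : EuclideanSpace ℝ ι) :
    0 ≤ inner ℝ x (mul M x) := by
  rw [inner_eq_dotProduct, mul_ofLp]
  simpa using hM.dotProduct_mulVec_nonneg x.ofLp

/-- The constant is the minimum of the form on the unit sphere, extended by homogeneity; the sphere
is empty only in the zero space. -/
theorem exists_le_inner_mul [DecidableEq ι] {M : Matrix ι ι ℝ} (hM : M.PosDef) :
    ∃ k > 0, ∀ x : EuclideanSpace ℝ ι, k * ‖x‖ ^ 2 ≤ inner ℝ x (mul M x) := by
  have hpos : ∀ x : EuclideanSpace ℝ ι, x ≠ 0 → 0 < inner ℝ x (mul M x) := by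
    intro x hx
    rw [inner_eq_dotProduct, mul_ofLp]
    simpa using hM.dotProduct_mulVec_pos (x := x.ofLp) (by simpa using hx)
  have hcont : Continuous fun x : EuclideanSpace ℝ ι => (inner ℝ x (mul M x) : ℝ) := by fun_prop
  rcases (Metric.sphere (0 : EuclideanSpace ℝ ι) 1).eq_empty_or_nonempty with he | hne
  · refine ⟨1, one_pos, fun x => ?_⟩
    have hx : x = 0 := by
      by_contra hx
      have : ‖x‖⁻¹ • x ∈ Metric.sphere (0 : EuclideanSpace ℝ ι) 1 := by
        rw [mem_sphere_zero_iff_norm, norm_smul, norm_inv, norm_norm,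
          inv_mul_cancel₀ (norm_ne_zero_iff.2 hx)]
      rw [he] at this
      exact this
    simp [hx]
  · obtain ⟨y, hy, hmin⟩ := (isCompact_sphere (0 : EuclideanSpace ℝ ι) 1).exists_isMinOn hne
      hcont.continuousOn
    have hy0 : y ≠ 0 := by
      rintro rfl
      simp at hy
    refine ⟨_, hpos y hy0, fun x => ?_⟩
    rcases eq_or_ne x 0 with rfl | hx
    · simp
    have hxn : ‖x‖ ≠ 0 := norm_ne_zero_iff.2 hx
    have hmem : ‖x‖⁻¹ • x ∈ Metric.sphere (0 : EuclideanSpace ℝ ι) 1 := by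
      rw [mem_sphere_zero_iff_norm, norm_smul, norm_inv, norm_norm, inv_mul_cancel₀ hxn]
    have h1 := hmin hmem
    simp only [mem_ofPred_eq] at h1
    have h2 : (inner ℝ (‖x‖⁻¹ • x) (mul M (‖x‖⁻¹ • x)) : ℝ) = (‖x‖ ^ 2)⁻¹ * inner ℝ x (mul M x) :=
      by
      rw [mul, map_smul, inner_smul_left, inner_smul_right]
      simp
      field_simp
    rw [h2, inv_mul_eq_div, le_div_iff₀ (by positivity)] at h1
    exact h1

theorem exists_mul_bound (M : Matrix ι κ ℝ) :
    ∃ k > 0, ∀ x : EuclideanSpace ℝ κ, ‖mul M x‖ ≤ k * ‖x‖ :=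
  (LinearMap.toContinuousLinearMap (Matrix.toEuclideanLin M)).bound

theorem exists_inner_mul_bound (M : Matrix ι κ ℝ) (N : Matrix ι μ ℝ) :
    ∃ k > 0, ∀ (x : EuclideanSpace ℝ κ) (y : EuclideanSpace ℝ μ),
      |(inner ℝ (mul M x) (mul N y) : ℝ)| ≤ k * ‖x‖ * ‖y‖ := by
  obtain ⟨k, hk, hM⟩ := exists_mul_bound M
  obtain ⟨l, hl, hN⟩ := exists_mul_bound N
  refine ⟨k * l, by positivity, fun x y => (abs_real_inner_le_norm _ _).trans ?_⟩
  calc ‖mul M x‖ * ‖mul N y‖ ≤ (k * ‖x‖) * (l * ‖y‖) :=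
        mul_le_mul (hM x) (hN y) (norm_nonneg _) (by positivity)
    _ = k * l * ‖x‖ * ‖y‖ := by ring

theorem norm_mul_le_inducedNorm {m k : ℕ} (M : Matrix (Fin m) (Fin k) ℝ) (x : Vec k) :
    ‖mul M x‖ ≤ inducedNorm M * ‖x‖ :=
  (LinearMap.toContinuousLinearMap (Matrix.toEuclideanLin M)).le_opNorm x

theorem inducedNorm_nonneg {m k : ℕ} (M : Matrix (Fin m) (Fin k) ℝ) : 0 ≤ inducedNorm M :=
  norm_nonneg _

theorem inducedNorm_pos {m k : ℕ} {M : Matrix (Fin m) (Fin k) ℝ} (hM : M ≠ 0) :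
    0 < inducedNorm M := by
  refine norm_pos_iff.2 fun h => hM ?_
  have h1 : Matrix.toEuclideanLin M = 0 := by
    ext x : 1
    exact congrArg (fun f : Vec k →L[ℝ] Vec m => f x) h
  exact Matrix.toEuclideanLin.injective (by rw [h1, map_zero])

/-- Rank–nullity: full column rank leaves no kernel. -/
theorem mul_eq_zero_of_rank_eq {n q : ℕ} {B : Matrix (Fin n) (Fin q) ℝ} (hB : B.rank = q)
    {e : Vec q}
    (he : mul B e = 0) : e = 0 := by
  have h1 := LinearMap.finrank_range_add_finrank_ker B.mulVecLin
  have h2 : Module.finrank ℝ (LinearMap.range B.mulVecLin) = q := hB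
  rw [h2, Module.finrank_fin_fun, Nat.add_eq_left, Submodule.finrank_eq_zero] at h1
  have h3 : e.ofLp ∈ LinearMap.ker B.mulVecLin := by
    rw [LinearMap.mem_ker, Matrix.mulVecLin_apply, ← mul_ofLp, he]
    rfl
  rw [h1, Submodule.mem_bot] at h3
  ext i
  exact congrFun h3 i

end Matrices

/-! ### Block quadratic forms and the Lyapunov rate -/

section Pairs

variable {n q : ℕ}

theorem inner_pair (x x' : Vec n) (e e' : Vec q) :
    inner ℝ (pair x e) (pair x' e') = inner ℝ x x' + inner ℝ e e' := by
  simp only [inner_eq_dotProduct, pair, dotProduct, Fintype.sum_sum_type, Sum.elim_inl,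
    Sum.elim_inr]

theorem norm_pair_sq (x : Vec n) (e : Vec q) : ‖pair x e‖ ^ 2 = ‖x‖ ^ 2 + ‖e‖ ^ 2 := by
  rw [← real_inner_self_eq_norm_sq, inner_pair, real_inner_self_eq_norm_sq,
    real_inner_self_eq_norm_sq]

theorem mul_fromBlocks_pair (M₁₁ : Matrix (Fin n) (Fin n) ℝ) (M₁₂ : Matrix (Fin n) (Fin q) ℝ)
    (M₂₁ : Matrix (Fin q) (Fin n) ℝ) (M₂₂ : Matrix (Fin q) (Fin q) ℝ) (x : Vec n) (e : Vec q) :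
    mul (Matrix.fromBlocks M₁₁ M₁₂ M₂₁ M₂₂) (pair x e) =
      pair (mul M₁₁ x + mul M₁₂ e) (mul M₂₁ x + mul M₂₂ e) := by
  apply WithLp.ofLp_injective
  rw [mul_ofLp, Matrix.fromBlocks_mulVec]
  rfl

theorem gradient_lyapV {P₁ : Matrix (Fin n) (Fin n) ℝ} {P₂ : Matrix (Fin q) (Fin q) ℝ}
    (hP : (Matrix.fromBlocks P₁ 0 0 P₂).IsHermitian) (z : EuclideanSpace ℝ (Fin n ⊕ Fin q)) :
    gradient (lyapV P₁ P₂) z = mul (Matrix.fromBlocks P₁ 0 0 P₂) z := by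
  refine HasGradientAt.gradient ?_
  rw [hasGradientAt_iff_hasFDerivAt]
  set M := LinearMap.toContinuousLinearMap
    (Matrix.toEuclideanLin (Matrix.fromBlocks P₁ 0 0 P₂)) with hM
  have h := ((hasFDerivAt_id z).inner ℝ (M.hasFDerivAt (x := z))).const_mul (1 / 2 : ℝ)
  refine h.congr_fderiv ?_
  ext y
  have h1 : inner ℝ z (M y) = inner ℝ (M z) y := inner_mul_of_isHermitian hP z y
  have h2 : inner ℝ y (M z) = inner ℝ (M z) y := real_inner_comm _ _
  simp only [smul_apply, ContinuousLinearMap.comp_apply,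
    ContinuousLinearMap.prod_apply, fderivInnerCLM_apply, smul_eq_mul,
      InnerProductSpace.toDual_apply_apply,
    ContinuousLinearMap.id_apply, id_eq]
  rw [h1, h2]
  change _ = inner ℝ (M z) y
  ring

variable (A : Matrix (Fin n) (Fin n) ℝ) (B : Matrix (Fin n) (Fin q) ℝ)
  (C : Matrix (Fin q) (Fin n) ℝ) (L : Matrix (Fin n) (Fin q) ℝ)

/-- The second block row of F is −C times the first, reflecting e' = −Cx̂'. So the abstract rate is
the derivative of the block form along the flow with w = 0. -/
theorem lyapRate_eq {P₁ : Matrix (Fin n) (Fin n) ℝ} {P₂ : Matrix (Fin q) (Fin q) ℝ}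
    (hP : (Matrix.fromBlocks P₁ 0 0 P₂).IsHermitian) (x : Vec n) (e : Vec q) :
    lyapRate A B C P₁ P₂ x e = inner ℝ (mul P₁ x) (mul (F11 A B C) x + mul B e) +
      inner ℝ (mul P₂ e) (-mul C (mul (F11 A B C) x + mul B e)) := by
  have h : mul (F21 A B C) x + mul (F22 B C) e = -mul C (mul (F11 A B C) x + mul B e) := by
    have h1 : mul (F21 A B C) x = -mul C (mul (F11 A B C) x) := by
      rw [← mul_mul_apply, F21, F11]; simp [mul]
    have h2 : mul (F22 B C) e = -mul C (mul B e) := by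
      rw [← mul_mul_apply, F22]; simp [mul]
    rw [h1, h2, mul_apply_add]
    abel
  rw [lyapRate, gradient_lyapV hP, errorMatrix, mul_fromBlocks_pair, mul_fromBlocks_pair,
    inner_pair, h]
  simp [mul, F12]

theorem inner_lyapunov_le {P₁ Q : Matrix (Fin n) (Fin n) ℝ} (hP : P₁.IsHermitian)
    (h : (-Q - ((F11 A B C).transpose * P₁ + P₁ * F11 A B C)).PosSemidef) (x : Vec n) :
    2 * inner ℝ (mul P₁ x) (mul (F11 A B C) x) ≤ -inner ℝ x (mul Q x) := by
  have h1 := inner_mul_nonneg h x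
  have e : mul (-Q - ((F11 A B C).transpose * P₁ + P₁ * F11 A B C)) x =
      -mul Q x - (mul (F11 A B C).transpose (mul P₁ x) + mul P₁ (mul (F11 A B C) x)) := by
    rw [← mul_mul_apply, ← mul_mul_apply, ← mul_add_apply]
    simp [mul]
  rw [e, inner_sub_right, inner_add_right, inner_neg_right, inner_mul_transpose,
    inner_mul_of_isHermitian hP x (mul (F11 A B C) x),
    real_inner_comm (mul P₁ x) (mul (F11 A B C) x)] at h1
  linarith

theorem inner_gap {Q : Matrix (Fin n) (Fin n) ℝ} {γ : ℝ}
    (h : (Q - γ • (1 : Matrix (Fin n) (Fin n) ℝ)).PosDef) (x : Vec n) :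
    γ * ‖x‖ ^ 2 ≤ inner ℝ x (mul Q x) := by
  have h1 := inner_mul_nonneg h.posSemidef x
  have e : mul (Q - γ • (1 : Matrix (Fin n) (Fin n) ℝ)) x = mul Q x - γ • x := by
    simp [mul]
  rw [e, inner_sub_right, inner_smul_right, real_inner_self_eq_norm_sq] at h1
  linarith

end Pairs

/-! ### Building Lyapunov certificates -/

section Certificates

variable {n q p : ℕ} {A : Matrix (Fin n) (Fin n) ℝ} {B : Matrix (Fin n) (Fin q) ℝ}
  {C : Matrix (Fin q) (Fin n) ℝ} {L : Matrix (Fin n) (Fin q) ℝ} {σ : Fin q → Fin p}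
  {𝒞 : Fin p → Set (Vec n × Vec q)} {P₁ : Matrix (Fin n) (Fin n) ℝ}
  {P₂ : Matrix (Fin q) (Fin q) ℝ}

/-- Young's inequality by completing the square. The share γ/8 is such that two cross terms still
leave γ/4 out of γ/2. -/
theorem mul_mul_le_sq_add_sq {γ : ℝ} (hγ : 0 < γ) (a x y : ℝ) :
    a * x * y ≤ γ / 8 * x ^ 2 + 2 * a ^ 2 / γ * y ^ 2 := by
  have h : γ / 8 * x ^ 2 + 2 * a ^ 2 / γ * y ^ 2 - a * x * y =
      γ / 8 * (x - 4 * a / γ * y) ^ 2 := by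
    field_simp
    ring
  have h0 : 0 ≤ γ / 8 * (x - 4 * a / γ * y) ^ 2 := by positivity
  linarith

/-- A Lyapunov certificate from estimates with separate constants. -/
theorem exists_lazyLyapunov {m N g M Γ : ℝ} (hm : 0 < m) (hN : 0 < N) (hg : 0 < g) (hM : 0 ≤ M)
    (hΓ : 0 ≤ Γ) (isClosed : ∀ k, IsClosed (𝒞 k))
    (symm₁ : ∀ a b, inner ℝ a (mul P₁ b) = inner ℝ (mul P₁ a) b)
    (symm₂ : ∀ a b, inner ℝ a (mul P₂ b) = inner ℝ (mul P₂ a) b)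
    (le_form : ∀ x e, m * ‖x‖ ^ 2 ≤ blockForm P₁ P₂ x e)
    (form_le : ∀ x e, blockForm P₁ P₂ x e ≤ N * (‖x‖ ^ 2 + ‖e‖ ^ 2))
    (jump : ∀ x e e' (S : Set (Fin p)), S.Nonempty → (∀ i, σ i ∈ S → e' i = 0) →
      (∀ i, σ i ∉ S → e' i = e i) → blockForm P₁ P₂ x e' ≤ blockForm P₁ P₂ x e)
    (decrease : ∀ x e w r, 0 ≤ r → (∀ k, (x, e) ∈ 𝒞 k ∨ ∀ i, σ i = k → |e i| ≤ r) →
      inner ℝ (mul P₁ x) (observerRate A B C L x e w) +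
        inner ℝ (mul P₂ e) (-mul C (observerRate A B C L x e w)) ≤
          -g * ‖x‖ ^ 2 + M * (r ^ 2 + ‖w‖ ^ 2) ∧
        blockForm P₁ P₂ x e ≤ N * (‖x‖ ^ 2 + r ^ 2))
    (err_le : ∀ k x e, (x, e) ∈ 𝒞 k → x ≠ 0 → ∀ i, σ i = k → |e i| ≤ Γ * ‖x‖)
    (degenerate : (∀ e, mul B e = 0 → e = 0) ∨
      ∀ k e, (0, e) ∈ 𝒞 k → ∀ i, σ i = k → e i = 0) :
    ∃ K c, LazyLyapunov A B C L σ 𝒞 P₁ P₂ K c := by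
  have hm' : 0 < m⁻¹ := inv_pos.2 hm
  -- K is the sum of everything it must dominate. The rate is g/N because V ≤ N(|x|² + r²) turns
  -- −g|x|² into −(g/N)V + gr².
  refine ⟨m⁻¹ + N + (M + g) + Γ, g / N, by positivity, by positivity, isClosed, symm₁, symm₂,
    fun x e => ?_, fun x e => ?_, jump, fun x e w r hr h => ?_, fun k x e hk hx i hi => ?_,
    degenerate⟩
  · have h1 := le_form x e
    have h0 : 0 ≤ blockForm P₁ P₂ x e := le_trans (by positivity) h1
    calc ‖x‖ ^ 2 = m⁻¹ * (m * ‖x‖ ^ 2) := by field_simp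
      _ ≤ m⁻¹ * blockForm P₁ P₂ x e := by gcongr
      _ ≤ _ := mul_le_mul_of_nonneg_right (by linarith) h0
  · exact (form_le x e).trans (mul_le_mul_of_nonneg_right (by linarith) (by positivity))
  · obtain ⟨h1, h2⟩ := decrease x e w r hr h
    have h3 : g / N * blockForm P₁ P₂ x e ≤ g / N * (N * (‖x‖ ^ 2 + r ^ 2)) := by gcongr
    have h4 : g / N * (N * (‖x‖ ^ 2 + r ^ 2)) = g * ‖x‖ ^ 2 + g * r ^ 2 := by field_simp
    have h5 : (M + g) * (r ^ 2 + ‖w‖ ^ 2) ≤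
        (m⁻¹ + N + (M + g) + Γ) * (r ^ 2 + ‖w‖ ^ 2) :=
      mul_le_mul_of_nonneg_right (by linarith) (by positivity)
    have h6 : 0 ≤ g * ‖w‖ ^ 2 := by positivity
    nlinarith
  · exact (err_le k x e hk hx i hi).trans
      (mul_le_mul_of_nonneg_right (by linarith) (norm_nonneg _))

theorem blockForm_le {k₁ k₂ : ℝ} (h₁ : ∀ x, ‖mul P₁ x‖ ≤ k₁ * ‖x‖) (h₂ : ∀ e, ‖mul P₂ e‖ ≤ k₂ * ‖e‖)
    (x : Vec n) (e : Vec q) : blockForm P₁ P₂ x e ≤ 1 / 2 * (k₁ * ‖x‖ ^ 2 + k₂ * ‖e‖ ^ 2) := by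
  have h3 : inner ℝ x (mul P₁ x) ≤ k₁ * ‖x‖ ^ 2 := by
    calc inner ℝ x (mul P₁ x) ≤ ‖x‖ * ‖mul P₁ x‖ := real_inner_le_norm _ _
      _ ≤ ‖x‖ * (k₁ * ‖x‖) := by gcongr; exact h₁ x
      _ = k₁ * ‖x‖ ^ 2 := by ring
  have h4 : inner ℝ e (mul P₂ e) ≤ k₂ * ‖e‖ ^ 2 := by
    calc inner ℝ e (mul P₂ e) ≤ ‖e‖ * ‖mul P₂ e‖ := real_inner_le_norm _ _
      _ ≤ ‖e‖ * (k₂ * ‖e‖) := by gcongr; exact h₂ e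
      _ = k₂ * ‖e‖ ^ 2 := by ring
  rw [blockForm]
  linarith

end Certificates

/-! ### Certificate for the synchronous policy -/

section Synchronous

variable {n q : ℕ} {A : Matrix (Fin n) (Fin n) ℝ} {B : Matrix (Fin n) (Fin q) ℝ}
  {C : Matrix (Fin q) (Fin n) ℝ} {γx γe : ℝ} {Q P₁ : Matrix (Fin n) (Fin n) ℝ}
  {P₂ : Matrix (Fin q) (Fin q) ℝ}

theorem continuous_lyapRate (hP : (Matrix.fromBlocks P₁ 0 0 P₂).IsHermitian) :
    Continuous fun w : Vec n × Vec q => lyapRate A B C P₁ P₂ w.1 w.2 := by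
  simp only [lyapRate_eq A B C hP]
  fun_prop

theorem isClosed_syncC (hP : (Matrix.fromBlocks P₁ 0 0 P₂).IsHermitian) :
    IsClosed (syncC A B C γx γe P₁ P₂) :=
  (isClosed_le (continuous_lyapRate hP) (continuous_const.mul (continuous_fst.norm.pow 2))).inter
    (isClosed_le continuous_snd.norm (continuous_const.mul continuous_fst.norm))

theorem isClosed_syncD (hP : (Matrix.fromBlocks P₁ 0 0 P₂).IsHermitian) :
    IsClosed (syncD A B C γx γe P₁ P₂) :=
  (isClosed_le (continuous_const.mul (continuous_fst.norm.pow 2)) (continuous_lyapRate hP)).union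
    (isClosed_le (continuous_const.mul continuous_fst.norm) continuous_snd.norm)

theorem mem_syncC_of_notMem_syncD {w : Vec n × Vec q} (h : w ∉ syncD A B C γx γe P₁ P₂) :
    w ∈ syncC A B C γx γe P₁ P₂ := by
  simp only [syncD, mem_ofPred_eq, not_or, not_le, ge_iff_le] at h
  exact ⟨h.1.le, h.2.le⟩

theorem inner_observerRate (hP : (Matrix.fromBlocks P₁ 0 0 P₂).IsHermitian)
    (L : Matrix (Fin n) (Fin q) ℝ) (x : Vec n) (e : Vec q) (w : Vec n) :
    inner ℝ (mul P₁ x) (observerRate A B C L x e w) +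
      inner ℝ (mul P₂ e) (-mul C (observerRate A B C L x e w)) =
      lyapRate A B C P₁ P₂ x e + inner ℝ (mul P₁ x) (mul (L * C) w) -
        inner ℝ (mul P₂ e) (mul (C * (L * C)) w) := by
  have h : mul C (mul (F11 A B C) x + mul B e + mul (L * C) w) =
      mul C (mul (F11 A B C) x + mul B e) + mul (C * (L * C)) w := by
    rw [mul_apply_add, mul_mul_apply C]
  rw [lyapRate_eq A B C hP, observerRate, h, inner_add_right, neg_add,
    inner_add_right (mul P₂ e), inner_neg_right (mul P₂ e) (mul (C * (L * C)) w)]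
  ring

/-- While waiting, the policy itself guarantees the decrease −γₓ|x|² and |e| ≤ γₑ|x|. Just after a
sample |e| ≤ qr, so the Lyapunov inequality for F₁₁ dominates and all terms in e are of order r².
The observation error enters only through cross terms split by Young's inequality. -/
theorem SyncParams.exists_lazyLyapunov (h : SyncParams A B C γx γe Q P₁ P₂)
    (L : Matrix (Fin n) (Fin q) ℝ) : ∃ K c, LazyLyapunov A B C L (fun _ => (0 : Fin 1))
      (fun _ => syncC A B C γx γe P₁ P₂) P₁ P₂ K c := by
  have hP := h.P_pos.isHermitian
  have hP₁ : P₁.IsHermitian := (Matrix.isHermitian_fromBlocks_iff.1 hP).1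
  have hP₂ : P₂.IsHermitian := (Matrix.isHermitian_fromBlocks_iff.1 hP).2.2.2
  have hγx := h.γx_pos
  have hγe := h.γe_pos
  obtain ⟨m, hm, hmP⟩ := exists_le_inner_mul h.P_pos
  have hcoer : ∀ x e, m * (‖x‖ ^ 2 + ‖e‖ ^ 2) ≤ inner ℝ x (mul P₁ x) + inner ℝ e (mul P₂ e) := by
    intro x e
    have h1 := hmP (pair x e)
    rw [norm_pair_sq, mul_fromBlocks_pair, inner_pair] at h1
    simpa [mul] using h1
  have hP₂nonneg : ∀ e, 0 ≤ inner ℝ e (mul P₂ e) := by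
    intro e
    have h1 := hcoer 0 e
    have h2 : 0 ≤ m * (‖(0 : Vec n)‖ ^ 2 + ‖e‖ ^ 2) := by positivity
    simp only [inner_zero_left, zero_add] at h1
    linarith
  obtain ⟨n₁, hn₁, hn₁P⟩ := exists_mul_bound P₁
  obtain ⟨n₂, hn₂, hn₂P⟩ := exists_mul_bound P₂
  obtain ⟨a₁, ha₁, hPB⟩ := exists_inner_mul_bound P₁ B
  obtain ⟨a₂, ha₂, hPF⟩ := exists_inner_mul_bound P₂ (C * F11 A B C)
  obtain ⟨a₃, ha₃, hPCB⟩ := exists_inner_mul_bound P₂ (C * B)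
  obtain ⟨b₁, hb₁, hPL⟩ := exists_inner_mul_bound P₁ (L * C)
  obtain ⟨b₂, hb₂, hPCL⟩ := exists_inner_mul_bound P₂ (C * (L * C))
  set N := n₁ + n₂ * (1 + γe ^ 2 + (q : ℝ) ^ 2) with hN
  set M := 2 * (b₁ + b₂ * γe) ^ 2 / γx + (2 * (a₁ + a₂) ^ 2 / γx + a₃ + b₂) * (q : ℝ) ^ 2 +
    2 * b₁ ^ 2 / γx + b₂ with hMdef
  have hN0 : 0 < N := by positivity
  refine TLazy.exists_lazyLyapunov (m := m / 2) (N := N) (g := γx / 4) (M := M) (Γ := γe)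
    (by positivity) hN0 (by positivity) (by positivity) hγe.le (fun _ => isClosed_syncC hP)
    (inner_mul_of_isHermitian hP₁) (inner_mul_of_isHermitian hP₂)
    (fun x e => ?_) (fun x e => ?_) ?_ ?_ ?_ ?_
  · have h1 := hcoer x e
    have h2 : 0 ≤ m * ‖e‖ ^ 2 := by positivity
    rw [blockForm]
    linarith
  · refine (blockForm_le hn₁P hn₂P x e).trans ?_
    have h1 : 0 ≤ n₂ * ‖x‖ ^ 2 * (1 + γe ^ 2 + (q : ℝ) ^ 2) := by positivity
    have h2 : 0 ≤ n₂ * ‖e‖ ^ 2 * (γe ^ 2 + (q : ℝ) ^ 2) := by positivity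
    have h3 : 0 ≤ n₁ * ‖e‖ ^ 2 := by positivity
    have h4 : 0 ≤ n₁ * ‖x‖ ^ 2 := by positivity
    have h5 : 0 ≤ n₂ * ‖e‖ ^ 2 := by positivity
    rw [hN]
    nlinarith
  · intro x e e' S ⟨k, hk⟩ h0 _
    -- There is one block, so a non-empty transmission resets the whole error.
    have he : e' = 0 := by
      ext i
      exact h0 i (by rwa [Subsingleton.elim 0 k])
    rw [he, blockForm, blockForm, inner_zero_left]
    linarith [hP₂nonneg e]
  · intro x e w r hr hk
    have hw1 := (le_abs_self _).trans (hPL x w)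
    have hw2 := (neg_le_abs _).trans (hPCL e w)
    have hform := blockForm_le hn₁P hn₂P x e
    have hwn := norm_nonneg w
    have hxn := norm_nonneg x
    have hen := norm_nonneg e
    rw [inner_observerRate hP]
    rcases hk 0 with hC | hr'
    · obtain ⟨h1, h2⟩ := hC
      simp only at h1 h2
      have h3 : b₂ * ‖e‖ * ‖w‖ ≤ b₂ * (γe * ‖x‖) * ‖w‖ := by gcongr
      have h4 := mul_mul_le_sq_add_sq hγx (b₁ + b₂ * γe) ‖x‖ ‖w‖
      have h5 : ‖e‖ ^ 2 ≤ γe ^ 2 * ‖x‖ ^ 2 := by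
        rw [← mul_pow]; gcongr
      constructor
      · have h6 : 2 * (b₁ + b₂ * γe) ^ 2 / γx * ‖w‖ ^ 2 ≤ M * (r ^ 2 + ‖w‖ ^ 2) := by
          have : 2 * (b₁ + b₂ * γe) ^ 2 / γx ≤ M := by
            have : 0 ≤ (2 * (a₁ + a₂) ^ 2 / γx + a₃ + b₂) * (q : ℝ) ^ 2 +
              2 * b₁ ^ 2 / γx + b₂ := by positivity
            linarith
          gcongr
          linarith [sq_nonneg r]
        have h7 : 0 ≤ γx * ‖x‖ ^ 2 := by positivity
        linarith
      · have h8 : n₂ * ‖e‖ ^ 2 ≤ n₂ * (γe ^ 2 * ‖x‖ ^ 2) := by gcongr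
        have h9 : 0 ≤ n₁ * ‖x‖ ^ 2 := by positivity
        have h10 : 0 ≤ n₂ * (γe ^ 2 * ‖x‖ ^ 2) := by positivity
        have h11 : 0 ≤ n₂ * (1 + (q : ℝ) ^ 2) * ‖x‖ ^ 2 := by positivity
        have h12 : 0 ≤ N * r ^ 2 := by positivity
        calc blockForm P₁ P₂ x e ≤ n₁ * ‖x‖ ^ 2 + n₂ * (γe ^ 2 * ‖x‖ ^ 2) +
              n₂ * (1 + (q : ℝ) ^ 2) * ‖x‖ ^ 2 + N * r ^ 2 := by linarith
          _ = N * (‖x‖ ^ 2 + r ^ 2) := by rw [hN]; ring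
    · have he : ‖e‖ ≤ q * r := by
        refine (norm_le_sum_abs e).trans ((Finset.sum_le_sum fun i _ => hr' i rfl).trans ?_)
        simp
      have he2 : ‖e‖ ^ 2 ≤ (q : ℝ) ^ 2 * r ^ 2 := by
        rw [← mul_pow]; gcongr
      constructor
      · rw [lyapRate_eq A B C hP, inner_add_right]
        have h1 := inner_lyapunov_le A B C hP₁ h.lyap x
        have h2 := inner_gap h.Q_gt x
        have h3 := (le_abs_self _).trans (hPB x e)
        have h4 := (neg_le_abs _).trans (hPF e x)
        have h5 := (neg_le_abs _).trans (hPCB e e)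
        have h6 : mul C (mul (F11 A B C) x + mul B e) = mul (C * F11 A B C) x + mul (C * B) e := by
          rw [mul_apply_add, mul_mul_apply, mul_mul_apply]
        rw [h6, inner_neg_right, inner_add_right]
        have h7 := mul_mul_le_sq_add_sq hγx (a₁ + a₂) ‖x‖ ‖e‖
        have h8 := mul_mul_le_sq_add_sq hγx b₁ ‖x‖ ‖w‖
        have h9 : b₂ * ‖e‖ * ‖w‖ ≤ b₂ * ‖e‖ ^ 2 + b₂ * ‖w‖ ^ 2 := by
          have : 0 ≤ b₂ * ((‖e‖ - ‖w‖) ^ 2 + ‖e‖ * ‖w‖) := by positivity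
          linarith
        have h10 : (2 * (a₁ + a₂) ^ 2 / γx + a₃ + b₂) * ‖e‖ ^ 2 ≤
            (2 * (a₁ + a₂) ^ 2 / γx + a₃ + b₂) * ((q : ℝ) ^ 2 * r ^ 2) := by gcongr
        have h11 : (2 * (a₁ + a₂) ^ 2 / γx + a₃ + b₂) * (q : ℝ) ^ 2 * r ^ 2 ≤ M * r ^ 2 := by
          gcongr
          have : 0 ≤ 2 * (b₁ + b₂ * γe) ^ 2 / γx + 2 * b₁ ^ 2 / γx + b₂ := by positivity
          linarith
        have h12 : (2 * b₁ ^ 2 / γx + b₂) * ‖w‖ ^ 2 ≤ M * ‖w‖ ^ 2 := by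
          gcongr
          have : 0 ≤ 2 * (b₁ + b₂ * γe) ^ 2 / γx +
            (2 * (a₁ + a₂) ^ 2 / γx + a₃ + b₂) * (q : ℝ) ^ 2 := by positivity
          linarith
        linarith
      · have h8 : n₂ * ‖e‖ ^ 2 ≤ n₂ * ((q : ℝ) ^ 2 * r ^ 2) := by gcongr
        have h9 : 0 ≤ n₁ * ‖x‖ ^ 2 := by positivity
        have h10 : 0 ≤ n₂ * ((q : ℝ) ^ 2 * r ^ 2) := by positivity
        have h11 : 0 ≤ (n₁ + n₂ * (1 + γe ^ 2)) * r ^ 2 := by positivity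
        have h12 : 0 ≤ n₂ * (1 + γe ^ 2 + (q : ℝ) ^ 2) * ‖x‖ ^ 2 := by positivity
        calc blockForm P₁ P₂ x e ≤ n₁ * ‖x‖ ^ 2 + n₂ * ((q : ℝ) ^ 2 * r ^ 2) +
              (n₁ + n₂ * (1 + γe ^ 2)) * r ^ 2 +
              n₂ * (1 + γe ^ 2 + (q : ℝ) ^ 2) * ‖x‖ ^ 2 := by linarith
          _ = N * (‖x‖ ^ 2 + r ^ 2) := by rw [hN]; ring
  · intro k x e hk _ i _
    exact (PiLp.norm_apply_le e i).trans hk.2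
  · refine Or.inr fun k e hk i _ => ?_
    have h1 : ‖e‖ ≤ γe * ‖(0 : Vec n)‖ := hk.2
    rw [norm_zero, mul_zero] at h1
    rw [norm_le_zero_iff.1 h1]
    rfl

theorem lazyLoop_syncSystem (L : Matrix (Fin n) (Fin q) ℝ) (Δ ρ : ℝ) :
    LazyLoop A B C L (fun _ => (0 : Fin 1)) (fun _ => syncC A B C γx γe P₁ P₂)
      (fun _ => syncD A B C γx γe P₁ P₂) Δ ρ (syncSystem A B C L γx γe P₁ P₂ Δ ρ) where
  flowSet_iff X := by
    simp only [Fin.forall_fin_one]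
    change (∀ k, 0 ≤ X.τ k) ∧ _ ↔ _
    simp only [Fin.forall_fin_one]
    rfl
  jumpSet_iff X := by
    simp only [Fin.exists_fin_one]
    rfl
  flowMap_eq X := rfl
  jump_nonempty X _ := ⟨_, _, rfl, rfl⟩
  jump X hX Y hY := by
    obtain ⟨w, rfl, rfl⟩ := hY
    refine ⟨by simp, by simp, univ, univ_nonempty, fun k _ => ⟨?_, by simp⟩, by simp, ?_, by simp⟩
    · rw [Subsingleton.elim k 0]
      exact hX.2.2
    · intro i _
      simp [State.err]

end Synchronous

/-! ### Certificate for the asynchronous policy -/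

section Asynchronous

variable {n q : ℕ} {A : Matrix (Fin n) (Fin n) ℝ} {B : Matrix (Fin n) (Fin q) ℝ}
  {C : Matrix (Fin q) (Fin n) ℝ} {γx ε : ℝ} {Q P₁ : Matrix (Fin n) (Fin n) ℝ} {p α : Fin q → ℝ}

variable (A B C) in
theorem continuous_sensorRate (Q P₁ : Matrix (Fin n) (Fin n) ℝ) (pi αi : ℝ) (i : Fin q) :
    Continuous fun z : Vec n × Vec q => sensorRate A B C Q P₁ pi αi z.1 (z.2 i) := by
  unfold sensorRate
  fun_prop

/-- The states at which sensor `i` is allowed to wait. -/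
def waitSet (A : Matrix (Fin n) (Fin n) ℝ) (B : Matrix (Fin n) (Fin q) ℝ)
    (C : Matrix (Fin q) (Fin n) ℝ) (γx : ℝ) (Q P₁ : Matrix (Fin n) (Fin n) ℝ) (p α : Fin q → ℝ)
    (i : Fin q) : Set (Vec n × Vec q) :=
  {z | (z.1, z.2 i) ∈ sensorC A B C γx Q P₁ (p i) (α i)}

/-- The states at which sensor `i` is allowed to transmit once its dwell time has elapsed. -/
def sendSet (A : Matrix (Fin n) (Fin n) ℝ) (B : Matrix (Fin n) (Fin q) ℝ)
    (C : Matrix (Fin q) (Fin n) ℝ) (γx : ℝ) (Q P₁ : Matrix (Fin n) (Fin n) ℝ) (p α : Fin q → ℝ)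
    (i : Fin q) : Set (Vec n × Vec q) :=
  {z | (z.1, z.2 i) ∈ sensorD A B C γx Q P₁ (p i) (α i)}

theorem isClosed_waitSet (i : Fin q) : IsClosed (waitSet A B C γx Q P₁ p α i) :=
  isClosed_le (continuous_sensorRate A B C Q P₁ (p i) (α i) i)
    (continuous_const.mul (continuous_fst.norm.pow 2))

theorem isClosed_sendSet (i : Fin q) : IsClosed (sendSet A B C γx Q P₁ p α i) :=
  isClosed_le (continuous_const.mul (continuous_fst.norm.pow 2))
    (continuous_sensorRate A B C Q P₁ (p i) (α i) i)

theorem mem_waitSet_of_notMem_sendSet (i : Fin q) {z : Vec n × Vec q}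
    (h : z ∉ sendSet A B C γx Q P₁ p α i) : z ∈ waitSet A B C γx Q P₁ p α i := by
  simp only [sendSet, sensorD, mem_ofPred_eq, not_le, ge_iff_le] at h
  exact h.le

/-- P₁B = 0 would make ⟨Be, P₁Be⟩ vanish for all e, so B = 0 by definiteness, against injectivity
since q > 0. -/
theorem mul_posDef_ne_zero [NeZero q] (hP : P₁.PosDef) (hB : B.rank = q) : P₁ * B ≠ 0 := by
  intro h
  obtain ⟨k, hk, hkP⟩ := exists_le_inner_mul hP
  have hB0 : ∀ e, mul B e = 0 := by
    intro e
    have h1 := hkP (mul B e)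
    rw [← mul_mul_apply, h] at h1
    have h2 : inner ℝ (mul B e) (mul (0 : Matrix (Fin n) (Fin q) ℝ) e) = 0 := by simp [mul]
    rw [h2] at h1
    have h3 : ‖mul B e‖ ^ 2 ≤ 0 := by nlinarith [sq_nonneg ‖mul B e‖]
    simpa using h3
  have h4 := mul_eq_zero_of_rank_eq hB (hB0 (EuclideanSpace.single 0 1))
  simpa using congrArg (fun v : Vec q => v 0) h4

theorem AsyncParams.neZero (h : AsyncParams A B C γx ε Q P₁ p α) : NeZero q := by
  refine ⟨?_⟩
  rintro rfl
  simpa using h.α_sum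

theorem AsyncParams.alpha_pos (h : AsyncParams A B C γx ε Q P₁ p α) (i : Fin q) : 0 < α i :=
  h.ε_pos.trans (h.α_gt i)

theorem AsyncParams.alpha_le_one (h : AsyncParams A B C γx ε Q P₁ p α) (i : Fin q) : α i ≤ 1 := by
  rw [← h.α_sum]
  exact Finset.single_le_sum (fun j _ => (h.alpha_pos j).le) (Finset.mem_univ i)

/-- A sensor with zero error meets its waiting condition: its share α_i > ε of Q already exceeds γₓ,
because Q exceeds γₓ/ε. -/
theorem AsyncParams.gap (h : AsyncParams A B C γx ε Q P₁ p α) (i : Fin q) (x : Vec n) :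
    γx * ‖x‖ ^ 2 ≤ α i * inner ℝ x (mul Q x) := by
  have h1 := inner_gap h.Q_gt x
  have hε := h.ε_pos
  have hγx := h.γx_pos
  have h0 : 0 ≤ γx / ε * ‖x‖ ^ 2 := by positivity
  calc γx * ‖x‖ ^ 2 = ε * (γx / ε * ‖x‖ ^ 2) := by field_simp
    _ ≤ ε * inner ℝ x (mul Q x) := by gcongr
    _ ≤ α i * inner ℝ x (mul Q x) :=
      mul_le_mul_of_nonneg_right (h.α_gt i).le (h0.trans h1)

/-- On the waiting set of a sensor, its error is dominated by `x̂`. -/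
theorem AsyncParams.exists_err_le (h : AsyncParams A B C γx ε Q P₁ p α)
    (hB : C * B ≠ 0 ∨ B.rank = q) : ∃ Γ, 0 ≤ Γ ∧ ∀ k x e,
      (x, e) ∈ waitSet A B C γx Q P₁ p α k → x ≠ 0 → ∀ i, id i = k → |e i| ≤ Γ * ‖x‖ := by
  obtain ⟨κ, hκ, hκQ⟩ := exists_mul_bound Q
  have hQ : ∀ x, inner ℝ x (mul Q x) ≤ κ * ‖x‖ ^ 2 := fun x => by
    calc inner ℝ x (mul Q x) ≤ ‖x‖ * ‖mul Q x‖ := real_inner_le_norm _ _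
      _ ≤ ‖x‖ * (κ * ‖x‖) := by gcongr; exact hκQ x
      _ = κ * ‖x‖ ^ 2 := by ring
  have hγx := h.γx_pos
  -- The F₂₁ term and γₓ|x|² have a favourable sign and are dropped; α_k ≤ 1 removes the weight.
  have key : ∀ k x e, (x, e) ∈ waitSet A B C γx Q P₁ p α k →
      2 * inducedNorm (P₁ * F12 B) * ‖x‖ * |e k| + 2 * inducedNorm (F22 B C) * p k * e k ^ 2 ≤
        κ * ‖x‖ ^ 2 := by
    intro k x e hk
    have h1 : sensorRate A B C Q P₁ (p k) (α k) x (e k) ≤ -γx * ‖x‖ ^ 2 := hk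
    rw [sensorRate] at h1
    have h2 : 0 ≤ 2 * inducedNorm (F21 A B C) * p k * ‖x‖ * |e k| := by
      have := inducedNorm_nonneg (F21 A B C)
      have := h.p_pos k
      positivity
    have h3 : 0 ≤ γx * ‖x‖ ^ 2 := by positivity
    have h4 : α k * inner ℝ x (mul Q x) ≤ inner ℝ x (mul Q x) := by
      have h5 : 0 ≤ inner ℝ x (mul Q x) := inner_mul_nonneg h.Q_pos.posSemidef x
      nlinarith [h.alpha_le_one k]
    linarith [hQ x]
  rcases hB with hCB | hrank
  -- The term in e_i² survives and gives e_i² ≤ t|x|²; since t ≤ (1 + t)², no square root is needed.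
  · have hc : 0 < inducedNorm (F22 B C) := inducedNorm_pos (by simpa [F22] using hCB)
    have hcp : ∀ k, 0 < 2 * inducedNorm (F22 B C) * p k := fun k => by
      have := h.p_pos k
      positivity
    have ht : ∀ k, 0 ≤ κ / (2 * inducedNorm (F22 B C) * p k) := fun k => by
      have := hcp k
      positivity
    refine ⟨∑ k, (1 + κ / (2 * inducedNorm (F22 B C) * p k)),
      Finset.sum_nonneg fun k _ => by linarith [ht k], ?_⟩
    rintro k x e hk - i rfl
    have h1 := key i x e hk
    have h2 : 0 ≤ 2 * inducedNorm (P₁ * F12 B) * ‖x‖ * |e i| := by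
      have := inducedNorm_nonneg (P₁ * F12 B)
      positivity
    set t := κ / (2 * inducedNorm (F22 B C) * p i) with htdef
    have h3 : e i ^ 2 ≤ t * ‖x‖ ^ 2 := by
      rw [htdef, div_mul_eq_mul_div, le_div_iff₀ (hcp i)]
      linarith
    have h4 : |e i| ≤ (1 + t) * ‖x‖ := by
      have h0 : 0 ≤ (1 + t) * ‖x‖ := mul_nonneg (by linarith [ht i]) (norm_nonneg x)
      refine abs_le_of_sq_le_sq ?_ h0
      have : 0 ≤ (1 + t + t ^ 2) * ‖x‖ ^ 2 :=
        mul_nonneg (by linarith [ht i, sq_nonneg t]) (sq_nonneg _)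
      linarith
    refine h4.trans (mul_le_mul_of_nonneg_right ?_ (norm_nonneg x))
    exact Finset.single_le_sum (f := fun k => 1 + κ / (2 * inducedNorm (F22 B C) * p k))
      (fun k _ => by linarith [ht k]) (Finset.mem_univ i)
  -- Here only the cross term |x||e_i| is sure to survive. Dividing by |x| is what requires x ≠ 0.
  · have := h.neZero
    have ha : 0 < 2 * inducedNorm (P₁ * F12 B) := by
      have := inducedNorm_pos (mul_posDef_ne_zero (B := B) h.P₁_pos hrank)
      rw [F12]
      positivity
    refine ⟨κ / (2 * inducedNorm (P₁ * F12 B)), by positivity, ?_⟩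
    rintro k x e hk hx i rfl
    have h1 := key i x e hk
    have h2 : 0 ≤ 2 * inducedNorm (F22 B C) * p i * e i ^ 2 := by
      have := inducedNorm_nonneg (F22 B C)
      have := h.p_pos i
      positivity
    have hxn : 0 < ‖x‖ := norm_pos_iff.2 hx
    rw [div_mul_eq_mul_div, le_div_iff₀ ha]
    refine le_of_mul_le_mul_left ?_ hxn
    linarith

/-- If CB ≠ 0 the quadratic term in e_i remains at x = 0 and forces e_i = 0; otherwise full rank
makes B injective. -/
theorem AsyncParams.degenerate (h : AsyncParams A B C γx ε Q P₁ p α)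
    (hB : C * B ≠ 0 ∨ B.rank = q) : (∀ e, mul B e = 0 → e = 0) ∨
      ∀ k e, (0, e) ∈ waitSet A B C γx Q P₁ p α k → ∀ i, id i = k → e i = 0 := by
  rcases hB with hCB | hrank
  · refine Or.inr ?_
    rintro k e hk i rfl
    have hc : 0 < inducedNorm (F22 B C) := inducedNorm_pos (by simpa [F22] using hCB)
    have h1 : sensorRate A B C Q P₁ (p i) (α i) 0 (e i) ≤ -γx * ‖(0 : Vec n)‖ ^ 2 := hk
    rw [sensorRate, inner_zero_left, norm_zero] at h1
    have h2 : 0 < 2 * inducedNorm (F22 B C) * p i := by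
      have := h.p_pos i
      positivity
    have h3 : e i ^ 2 ≤ 0 := by
      refine le_of_mul_le_mul_left ?_ h2
      linarith
    simpa using h3
  · exact Or.inl fun e => mul_eq_zero_of_rank_eq hrank

/-- Each sensor bounds its own cross term by its share α_k of xᵀQx. As the shares add up to 1, the
sum is paid for by the decrease −xᵀQx of x̂ᵀP₁x̂. With P₂ = 0 jumps leave the form unchanged. -/
theorem AsyncParams.exists_lazyLyapunov (h : AsyncParams A B C γx ε Q P₁ p α)
    (hB : C * B ≠ 0 ∨ B.rank = q) (L : Matrix (Fin n) (Fin q) ℝ) :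
    ∃ K c, LazyLyapunov A B C L id (waitSet A B C γx Q P₁ p α) P₁ 0 K c := by
  have hγx := h.γx_pos
  have hq := h.neZero
  have hq1 : (1 : ℝ) ≤ q := by exact_mod_cast NeZero.one_le
  obtain ⟨m, hm, hmP⟩ := exists_le_inner_mul h.P₁_pos
  obtain ⟨n₁, hn₁, hn₁P⟩ := exists_mul_bound P₁
  obtain ⟨b, hb, hPL⟩ := exists_inner_mul_bound P₁ (L * C)
  obtain ⟨Γ, hΓ, herr⟩ := h.exists_err_le hB
  set a := inducedNorm (P₁ * F12 B) with ha
  have ha0 : 0 ≤ a := inducedNorm_nonneg _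
  have hform : ∀ x (e : Vec q), blockForm P₁ 0 x e = 1 / 2 * inner ℝ x (mul P₁ x) := fun x e => by
    simp [blockForm]
  have hform_le : ∀ x (e : Vec q), blockForm P₁ 0 x e ≤ n₁ * ‖x‖ ^ 2 := fun x e => by
    have h1 := blockForm_le hn₁P (P₂ := (0 : Matrix (Fin q) (Fin q) ℝ)) (k₂ := 0)
      (fun e => by simp) x e
    have h2 : 0 ≤ n₁ * ‖x‖ ^ 2 := by positivity
    linarith
  set M := 2 * (q * a) ^ 2 / γx + 2 * b ^ 2 / γx with hM
  refine TLazy.exists_lazyLyapunov (m := m / 2) (N := n₁) (g := γx / 4) (M := M) (Γ := Γ)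
    (by positivity) hn₁ (by positivity) (by positivity) hΓ isClosed_waitSet
    (inner_mul_of_isHermitian h.P₁_pos.isHermitian)
    (fun a b => by rw [zero_mul_apply, zero_mul_apply, inner_zero_left, inner_zero_right])
    (fun x e => ?_) (fun x e => ?_) ?_ ?_ herr (h.degenerate hB)
  · rw [hform]
    linarith [hmP x]
  · exact (hform_le x e).trans (by gcongr; linarith [sq_nonneg ‖e‖])
  · intro x e e' S _ _ _
    rw [hform, hform]
  · intro x e w r hr hk
    constructor
    -- For a waiting sensor this is the policy inequality without its non-negative F₂₁ and F₂₂
    -- terms; for a recent sample it is `gap` together with |e_k| ≤ r.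
    · have hsensor : ∀ k, 2 * a * ‖x‖ * |e k| ≤
          α k * inner ℝ x (mul Q x) - γx * ‖x‖ ^ 2 + 2 * a * ‖x‖ * r := by
        intro k
        have h0 : 0 ≤ 2 * a * ‖x‖ * r := by positivity
        rcases hk k with hC | hr'
        · have h1 : sensorRate A B C Q P₁ (p k) (α k) x (e k) ≤ -γx * ‖x‖ ^ 2 := hC
          rw [sensorRate] at h1
          have h2 : 0 ≤ 2 * inducedNorm (F21 A B C) * p k * ‖x‖ * |e k| := by
            have := inducedNorm_nonneg (F21 A B C)
            have := h.p_pos k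
            positivity
          have h3 : 0 ≤ 2 * inducedNorm (F22 B C) * p k * e k ^ 2 := by
            have := inducedNorm_nonneg (F22 B C)
            have := h.p_pos k
            positivity
          linarith
        · have h1 : 2 * a * ‖x‖ * |e k| ≤ 2 * a * ‖x‖ * r := by
            gcongr
            exact hr' k rfl
          linarith [h.gap k x]
      have hsum : 2 * a * ‖x‖ * ∑ k, |e k| ≤
          inner ℝ x (mul Q x) - q * (γx * ‖x‖ ^ 2) + q * (2 * a * ‖x‖ * r) := by
        rw [Finset.mul_sum]
        refine (Finset.sum_le_sum fun k _ => hsensor k).trans (le_of_eq ?_)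
        rw [Finset.sum_add_distrib, Finset.sum_sub_distrib, ← Finset.sum_mul, h.α_sum]
        simp
      have h1 := inner_lyapunov_le A B C h.P₁_pos.isHermitian h.lyap x
      have h2 : inner ℝ (mul P₁ x) (mul B e) ≤ a * ‖x‖ * ∑ k, |e k| := by
        rw [← inner_mul_of_isHermitian h.P₁_pos.isHermitian, ← mul_mul_apply]
        calc inner ℝ x (mul (P₁ * B) e) ≤ ‖x‖ * ‖mul (P₁ * B) e‖ := real_inner_le_norm _ _
          _ ≤ ‖x‖ * (a * ‖e‖) := by gcongr; exact norm_mul_le_inducedNorm (P₁ * B) e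
          _ ≤ ‖x‖ * (a * ∑ k, |e k|) := by gcongr; exact norm_le_sum_abs e
          _ = a * ‖x‖ * ∑ k, |e k| := by ring
      have h3 := (le_abs_self _).trans (hPL x w)
      have h4 := mul_mul_le_sq_add_sq hγx (q * a) ‖x‖ r
      have h5 := mul_mul_le_sq_add_sq hγx b ‖x‖ ‖w‖
      have h6 : γx * ‖x‖ ^ 2 ≤ q * (γx * ‖x‖ ^ 2) := by
        have : 0 ≤ γx * ‖x‖ ^ 2 := by positivity
        nlinarith
      have h7 : 0 ≤ 2 * (q * a) ^ 2 / γx * ‖w‖ ^ 2 := by positivity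
      have h8 : 0 ≤ 2 * b ^ 2 / γx * r ^ 2 := by positivity
      rw [zero_mul_apply, inner_zero_left, observerRate, inner_add_right, inner_add_right, hM]
      linarith
    · exact (hform_le x e).trans (by gcongr; linarith [sq_nonneg r])

/-- Both variants are covered at once: all that matters is that a non-empty set of enabled sensors
transmits. -/
theorem lazyLoop_asyncSystemOf {R : Set (Fin q) → Set (Set (Fin q))}
    (hR : ∀ S, ∀ U ∈ R S, S.Nonempty → U.Nonempty ∧ U ⊆ S)
    (hR' : ∀ S, S.Nonempty → (R S).Nonempty) (L : Matrix (Fin n) (Fin q) ℝ) (Δ ρ : ℝ) :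
    LazyLoop A B C L id (waitSet A B C γx Q P₁ p α) (sendSet A B C γx Q P₁ p α) Δ ρ
      (asyncSystemOf A B C L R γx Q P₁ p α Δ ρ) where
  flowSet_iff X := Iff.rfl
  jumpSet_iff X := Iff.rfl
  flowMap_eq X := rfl
  jump_nonempty X hX := by
    obtain ⟨S, hS⟩ := hR' _ hX.2
    exact ⟨_, _, ⟨S, hS, rfl⟩, rfl⟩
  jump X hX Y hY := by
    obtain ⟨w, ⟨U, hU, rfl⟩, rfl⟩ := hY
    obtain ⟨hne, hsub⟩ := hR _ U hU hX.2
    refine ⟨State.mk_x _ _ _ _, State.mk_xh _ _ _ _, U, hne, fun k hk => ⟨(hsub hk).2, ?_⟩,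
      fun k hk => ?_, fun i hi => ?_, fun i hi => ?_⟩
    · simp [transmit, hk]
    · simp [transmit, hk]
    · have hi' : i ∈ U := hi
      simp [transmit, State.err, hi']
    · have hi' : i ∉ U := hi
      simp [transmit, State.err, hi']

theorem AsyncParams.exists_stable (h : AsyncParams A B C γx ε Q P₁ p α)
    (hB : C * B ≠ 0 ∨ B.rank = q) {L : Matrix (Fin n) (Fin q) ℝ} (hL : IsHurwitz (A + L * C)) :
    ∃ ρ₀ > 0, ∀ Δ ρ : ℝ, 0 < Δ → Δ < ρ → ρ ≤ ρ₀ →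
      (IsGAS (asyncSystem A B C L γx Q P₁ p α Δ ρ) (attractor n q q ρ) ∧
        IsGES (asyncSystem A B C L γx Q P₁ p α Δ ρ) (attractor n q q ρ)) ∧
      IsGAS (asyncSystemSeq A B C L γx Q P₁ p α Δ ρ) (attractor n q q ρ) ∧
        IsGES (asyncSystemSeq A B C L γx Q P₁ p α Δ ρ) (attractor n q q ρ) := by
  obtain ⟨K, c, hV⟩ := h.exists_lazyLyapunov hB L
  obtain ⟨ρ₀, hρ₀, H⟩ := hV.exists_stable hL (isClosed_sendSet (p := p) (α := α))
    fun k _ => mem_waitSet_of_notMem_sendSet k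
  refine ⟨ρ₀, hρ₀, fun Δ ρ hΔ hΔρ hρ => ⟨H Δ ρ hΔ hΔρ hρ _ (lazyLoop_asyncSystemOf ?_ ?_ L Δ ρ),
    H Δ ρ hΔ hΔρ hρ _ (lazyLoop_asyncSystemOf ?_ ?_ L Δ ρ)⟩⟩
  · rintro S U rfl hS
    exact ⟨hS, subset_rfl⟩
  · exact fun S _ => singleton_nonempty S
  · rintro S U ⟨i, hi, rfl⟩ -
    exact ⟨singleton_nonempty i, singleton_subset_iff.2 hi⟩
  · rintro S ⟨i, hi⟩
    exact ⟨{i}, i, hi, rfl⟩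

end Asynchronous

theorem SyncParams.exists_stable {n q : ℕ} {A : Matrix (Fin n) (Fin n) ℝ}
    {B : Matrix (Fin n) (Fin q) ℝ} {C : Matrix (Fin q) (Fin n) ℝ} {γx γe : ℝ}
    {Q P₁ : Matrix (Fin n) (Fin n) ℝ} {P₂ : Matrix (Fin q) (Fin q) ℝ}
    (h : SyncParams A B C γx γe Q P₁ P₂) {L : Matrix (Fin n) (Fin q) ℝ}
    (hL : IsHurwitz (A + L * C)) :
    ∃ ρ₀ > 0, ∀ Δ ρ : ℝ, 0 < Δ → Δ < ρ → ρ ≤ ρ₀ →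
      IsGAS (syncSystem A B C L γx γe P₁ P₂ Δ ρ) (attractor n q 1 ρ) ∧
        IsGES (syncSystem A B C L γx γe P₁ P₂ Δ ρ) (attractor n q 1 ρ) := by
  obtain ⟨K, c, hV⟩ := h.exists_lazyLyapunov L
  obtain ⟨ρ₀, hρ₀, H⟩ := hV.exists_stable hL (fun _ => isClosed_syncD h.P_pos.isHermitian)
    fun _ _ => mem_syncC_of_notMem_syncD
  exact ⟨ρ₀, hρ₀, fun Δ ρ hΔ hΔρ hρ => H Δ ρ hΔ hΔρ hρ _ (lazyLoop_syncSystem L Δ ρ)⟩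

end TLazy

end

theorem theorem3 {n q : ℕ} (A : Matrix (Fin n) (Fin n) ℝ) (B : Matrix (Fin n) (Fin q) ℝ)
    (C : Matrix (Fin q) (Fin n) ℝ) (L : Matrix (Fin n) (Fin q) ℝ)
    (hnom : TLazy.IsExpStableLinear (A + B * C))
    (hdet : TLazy.IsDetectable A C)
    (hL : TLazy.IsHurwitz (A + L * C)) :
    (∀ (γx γe : ℝ) (Q P₁ : Matrix (Fin n) (Fin n) ℝ) (P₂ : Matrix (Fin q) (Fin q) ℝ),
      TLazy.SyncParams A B C γx γe Q P₁ P₂ →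
      ∃ ρ₀ > 0, ∀ Δ ρ : ℝ, 0 < Δ → Δ < ρ → ρ ≤ ρ₀ →
        TLazy.IsGAS (TLazy.syncSystem A B C L γx γe P₁ P₂ Δ ρ) (TLazy.attractor n q 1 ρ) ∧
        (B.rank = q →
          TLazy.IsGES (TLazy.syncSystem A B C L γx γe P₁ P₂ Δ ρ) (TLazy.attractor n q 1 ρ))) ∧
    (∀ (γx ε : ℝ) (Q P₁ : Matrix (Fin n) (Fin n) ℝ) (p α : Fin q → ℝ),
      TLazy.AsyncParams A B C γx ε Q P₁ p α →
      ∃ ρ₀ > 0, ∀ Δ ρ : ℝ, 0 < Δ → Δ < ρ → ρ ≤ ρ₀ →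
        (C * B ≠ 0 ∨ B.rank = q →
          TLazy.IsGAS (TLazy.asyncSystem A B C L γx Q P₁ p α Δ ρ) (TLazy.attractor n q q ρ) ∧
          TLazy.IsGAS (TLazy.asyncSystemSeq A B C L γx Q P₁ p α Δ ρ) (TLazy.attractor n q q ρ)) ∧
        (B.rank = q →
          TLazy.IsGES (TLazy.asyncSystem A B C L γx Q P₁ p α Δ ρ) (TLazy.attractor n q q ρ) ∧
          TLazy.IsGES (TLazy.asyncSystemSeq A B C L γx Q P₁ p α Δ ρ)
            (TLazy.attractor n q q ρ))) := by
  refine ⟨fun γx γe Q P₁ P₂ h => ?_, fun γx ε Q P₁ p α h => ?_⟩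
  · obtain ⟨ρ₀, hρ₀, H⟩ := h.exists_stable hL
    exact ⟨ρ₀, hρ₀, fun Δ ρ hΔ hΔρ hρ =>
      ⟨(H Δ ρ hΔ hΔρ hρ).1, fun _ => (H Δ ρ hΔ hΔρ hρ).2⟩⟩
  -- The conditions on B come after the choice of ρ₀, so the disjunction is decided first. If it
  -- fails, both implications are vacuous and any ρ₀ will do.
  · by_cases hB : C * B ≠ 0 ∨ B.rank = q
    · obtain ⟨ρ₀, hρ₀, H⟩ := h.exists_stable hB hL
      refine ⟨ρ₀, hρ₀, fun Δ ρ hΔ hΔρ hρ => ?_⟩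
      obtain ⟨⟨h1, h2⟩, h3, h4⟩ := H Δ ρ hΔ hΔρ hρ
      exact ⟨fun _ => ⟨h1, h3⟩, fun _ => ⟨h2, h4⟩⟩
    · exact ⟨1, one_pos, fun Δ ρ _ _ _ =>
        ⟨fun h' => absurd h' hB, fun h' => absurd (Or.inr h') hB⟩⟩
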